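/- Notation. Let $\mathbb{R}_+=(0,\infty)$, let $\epsilon=\begin{pmatrix}0&1\\1&0\end{pmatrix}$, and let $Q$ be a bounded measurable function on $\mathbb{R}_+$ with values in the Hermitian $2\times2$ complex matrices. Let $\alpha\in\mathbb{C}\cup\{\infty\}$. Consider the operator $\mathbf{H}=-\epsilon\frac{d^2}{dx^2}+Q$ in $L^2(\mathbb{R}_+;\mathbb{C}^2)$ with the boundary condition $F'(0)+AF(0)=0$, $A=\begin{pmatrix}\overline{\alpha}&0\\0&\alpha\end{pmatrix}$, if $\alpha\ne\infty$, and $F(0)=0$ if $\alpha=\infty$. Put $S=(1+|\alpha|^2)^{-1/2}I$ and $C=(1+|\alpha|^2)^{-1/2}\epsilon A$ if $\alpha\neq\infty$, and $S=0$, $C=\epsilon$ if $\alpha=\infty$. For $\lambda\in\mathbb{C}$ let $\Phi(\cdot,\lambda)$, $\Theta(\cdot,\lambda)$ be the $2\times2$ matrix solutions of $-\epsilon F''+QF=\lambda F$ on $\mathbb{R}_+$ with $$\Phi(0,\lambda)=S,\quad \epsilon\Phi'(0,\lambda)=-C,\qquad \Theta(0,\lambda)=C,\quad \epsilon\Theta'(0,\lambda)=S.$$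 The $M$-function $M_\alpha$ of $\mathbf{H}$ assigns to $\lambda\in\mathbb{C}\setminus\mathbb{R}$ the matrix $M_\alpha(\lambda)$ for which both columns of $\Theta(\cdot,\lambda)-\Phi(\cdot,\lambda)M_\alpha(\lambda)$ belong to $L^2(\mathbb{R}_+;\mathbb{C}^2)$. The spectral measure of $\mathbf{H}$ is the locally finite, positive semidefinite $2\times2$ matrix-valued Borel measure $\Sigma$ on $\mathbb{R}$ such that $\int_{\mathbb{R}}\frac{d\Sigma(t)}{1+t^2}$ converges and $$M_\alpha(\lambda)=\operatorname{Re}M_\alpha(\mathrm{i})+\int_{\mathbb{R}}\Bigl(\frac1{t-\lambda}-\frac{t}{1+t^2}\Bigr)\,d\Sigma(t),\qquad \lambda\in\mathbb{C}\setminus\mathbb{R},$$ where $\operatorname{Re}M=\frac12(M+M^*)$. Write $|\Sigma|(r)=\Sigma([0,r])$ for $r\ge0$ and $|\Sigma|(r)=\Sigma([r,0])$ for $r<0$. Theorem. For all $Q$ and $\alpha$ as above, the spectral measure $\Sigma$ of $\mathbf{H}$ exists, and it satisfies $$\lim_{r\to\infty}\frac{|\Sigma|(\pm r)}{r^{1/2}}=\frac{1+|\alpha|^2}{\pi}\begin{pmatrix}1&\pm1\\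 \pm1&1\end{pmatrix}\quad\text{if }\alpha\ne\infty,$$ $$\lim_{r\to\infty}\frac{|\Sigma|(\pm r)}{r^{3/2}}=\frac{1}{3\pi}\begin{pmatrix}1&\pm1\\ \pm1&1\end{pmatrix}\quad\text{if }\alpha=\infty.$$ -/

import Mathlib

open scoped Matrix Topology ComplexOrder

noncomputable section

namespace Hermitised

/-- The sign-indefinite matrix `ε`. -/
def eps : Matrix (Fin 2) (Fin 2) ℂ := !![0, 1; 1, 0]

/-- The matrix `A = diag (conj α, α)` of the boundary condition `F'(0) + A F(0) = 0`. -/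
def bcA (a : ℂ) : Matrix (Fin 2) (Fin 2) ℂ := !![star a, 0; 0, a]

/-- The matrix `S` of the boundary condition `C F(0) + S ε F'(0) = 0`;
the boundary parameter is a point of `ℂ ∪ {∞}`, and `∞` is the Dirichlet condition. -/
def bcS (α : OnePoint ℂ) : Matrix (Fin 2) (Fin 2) ℂ :=
  α.elim 0 fun a => ((1 / Real.sqrt (1 + ‖a‖ ^ 2) : ℝ) : ℂ) • 1

/-- The matrix `C` of the boundary condition `C F(0) + S ε F'(0) = 0`. -/
def bcC (α : OnePoint ℂ) : Matrix (Fin 2) (Fin 2) ℂ :=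
  α.elim eps fun a => ((1 / Real.sqrt (1 + ‖a‖ ^ 2) : ℝ) : ℂ) • (eps * bcA a)

/-- `F : [0, ∞) → ℂ²` is a (Carathéodory) solution of `-ε F'' + Q F = z F` on the half-line, with
derivative `F'`: `F` is differentiable on `[0, ∞)` (one-sidedly at `0`) with derivative `F'`, and
the equation holds in integrated form, that is, `F'` is locally absolutely continuous and the
differential equation holds almost everywhere. Values at negative arguments play no role. -/
structure IsSolution (Q : ℝ → Matrix (Fin 2) (Fin 2) ℂ) (z : ℂ) (F F' : ℝ → Fin 2 → ℂ) :
    Prop where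
  hasDeriv : ∀ x, 0 ≤ x → HasDerivWithinAt F (F' x) (Set.Ici 0) x
  equation : ∀ x, 0 ≤ x → eps *ᵥ (F' x - F' 0) = ∫ t in (0 : ℝ)..x, (Q t *ᵥ F t - z • F t)

/-- A `2 × 2` matrix-valued solution: every column is a solution. -/
def IsMatrixSolution (Q : ℝ → Matrix (Fin 2) (Fin 2) ℂ) (z : ℂ)
    (F F' : ℝ → Matrix (Fin 2) (Fin 2) ℂ) : Prop :=
  ∀ j, IsSolution Q z (fun x i => F x i j) (fun x i => F' x i j)

/-- `M` is the value at `z` of the Titchmarsh-Weyl `M`-function: with the fundamental system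
`Φ(0) = S`, `ε Φ'(0) = -C`, `Θ(0) = C`, `ε Θ'(0) = S`, both columns of `Θ - Φ M` belong to
`L²((0, ∞); ℂ²)`. -/
def IsWeylMatrix (Q : ℝ → Matrix (Fin 2) (Fin 2) ℂ) (α : OnePoint ℂ) (z : ℂ)
    (M : Matrix (Fin 2) (Fin 2) ℂ) : Prop :=
  ∃ Φ Φ' Θ Θ' : ℝ → Matrix (Fin 2) (Fin 2) ℂ,
    IsMatrixSolution Q z Φ Φ' ∧ Φ 0 = bcS α ∧ eps * Φ' 0 = -bcC α ∧
    IsMatrixSolution Q z Θ Θ' ∧ Θ 0 = bcC α ∧ eps * Θ' 0 = bcS α ∧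
    ∀ i j, MeasureTheory.MemLp (fun x => (Θ x - Φ x * M) i j) 2
      (MeasureTheory.volume.restrict (Set.Ioi 0))

/-- A `2 × 2` matrix-valued (positive semidefinite, locally finite) Borel measure on `ℝ`, written
as `dΣ = W dμ` with a positive measure `μ` and a positive semidefinite density `W`; by the
Radon-Nikodym theorem every such measure is of this form, with `μ` its trace. -/
structure MatrixMeasure where
  base : MeasureTheory.Measure ℝ
  density : ℝ → Matrix (Fin 2) (Fin 2) ℂ
  posSemidef : ∀ t, (density t).PosSemidef
  locallyIntegrable : ∀ i j, MeasureTheory.LocallyIntegrable (fun t => density t i j) base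

/-- The value `Σ(B)` on a bounded Borel set `B`. -/
def MatrixMeasure.value (Sg : MatrixMeasure) (B : Set ℝ) : Matrix (Fin 2) (Fin 2) ℂ :=
  Matrix.of fun i j => ∫ t in B, Sg.density t i j ∂Sg.base

/-- The integral `∫ f dΣ` of a scalar function, entry by entry. -/
def MatrixMeasure.integral (Sg : MatrixMeasure) (f : ℝ → ℂ) : Matrix (Fin 2) (Fin 2) ℂ :=
  Matrix.of fun i j => ∫ t, f t * Sg.density t i j ∂Sg.base

/-- Convergence of the integral `∫ f dΣ`. -/
def MatrixMeasure.Integrable (Sg : MatrixMeasure) (f : ℝ → ℂ) : Prop :=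
  ∀ i j, MeasureTheory.Integrable (fun t => f t * Sg.density t i j) Sg.base

/-- The function `|Σ|(r)`: `Σ([0, r])` for `r ≥ 0` and `Σ([r, 0])` for `r < 0`. -/
def MatrixMeasure.cumulative (Sg : MatrixMeasure) (r : ℝ) : Matrix (Fin 2) (Fin 2) ℂ :=
  if 0 ≤ r then Sg.value (Set.Icc 0 r) else Sg.value (Set.Icc r 0)

/-- `Σ` is the spectral measure of `-ε d²/dx² + Q` with boundary parameter `α`: the measure in the
Herglotz-Nevanlinna representation
`M(z) = Re M(i) + ∫ (1 / (t - z) - t / (1 + t²)) dΣ(t)` of the `M`-function, where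
`Re M = (M + M*) / 2` and `∫ dΣ(t) / (1 + t²)` converges. -/
def IsSpectralMeasure (Q : ℝ → Matrix (Fin 2) (Fin 2) ℂ) (α : OnePoint ℂ)
    (Sg : MatrixMeasure) : Prop :=
  ∃ M : ℂ → Matrix (Fin 2) (Fin 2) ℂ,
    (∀ z : ℂ, z.im ≠ 0 → IsWeylMatrix Q α z (M z)) ∧
    Sg.Integrable (fun t => 1 / (1 + (t : ℂ) ^ 2)) ∧
    ∀ z : ℂ, z.im ≠ 0 →
      M z = (1 / 2 : ℂ) • (M Complex.I + (M Complex.I)ᴴ) +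
        Sg.integral (fun t => 1 / ((t : ℂ) - z) - (t : ℂ) / (1 + (t : ℂ) ^ 2))

end Hermitised

end

open scoped Matrix Topology ComplexOrder

noncomputable section

namespace Hermitised

open MeasureTheory Set Filter ComplexConjugate

/-! The growth of `Σ` is read off from the behaviour of `M(iη)` as `η → ∞`, and to leading order
this behaviour does not see the potential.

Free problem. The vectors `(1, 1)` and `(1, -1)` diagonalise `ε`, so `-ε d²/dx²` splits into
`-d²/dx²` and `+d²/dx²`. At `z = 2ir²` the decaying solutions are `exp(-r(1-i)x)(1, 1)` and
`exp(-r(1+i)x)(1, -1)`, and they fix the ratio between `a = u(0)` and `b = εu'(0)` in each channel.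

Potential. Let `T` be multiplication by `Q`. Pairing a square integrable solution `u` with these
exponentials through Green's identity (`norm_boundary_le`) gives the free relations between `a` and
`b` up to an error `r^(-1/2) ‖T‖ ‖u‖`. Green's identity for `u` with itself
(`norm_le_boundarySize_div`) bounds `‖u‖` by the size of the boundary data divided by `r`. The error
can then be absorbed, with no regularity of `Q` beyond boundedness. The results are
`tendsto_weyl_dirichlet`, where `M(iη)` grows like `η^(1/2)`, and `tendsto_weyl_robin`, where
`M(iη)` minus a constant Hermitian matrix decays like `η^(-1/2)`. In both cases the leading
coefficient is imaginary on the diagonal and real off it.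

Tauberian step. Let `β = 1/2` or `-1/2` be the exponent. After division by `ρ^(β+1)` and by `1 +
t²`, the measures `Σ(ρ dt)` have bounded mass. Their integrals against `1` and `1/(t-iy)`, with `y`
different from `0, 1, -1`, are combinations of `M(±iρ)` and `M(iyρ)`, hence converge. By
Stone-Weierstrass these functions span a dense subspace of the continuous functions on the one-point
compactification of the line (`span_cauchyKernel_dense`). The limit is therefore the homogeneous
measure with that Stieltjes transform: its density is a multiple of `|t|^β` on the diagonal and of
`sgn(t)|t|^β` off it (`isHomogeneousModel_even`, `isHomogeneousModel_odd`). The limit has no atoms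
and every entry of `Σ` is dominated by the trace, so convergence passes to the intervals `[0, ρ]`
and `[-ρ, 0]` (`HasScaledLimit.tendsto_setIntegral`); integrating `|t|^β` produces the constants.

Existence. The differential expression is treated as an abstract relation with boundary maps. The
free Dirichlet problem is solved explicitly, finite-dimensional linear algebra changes the boundary
condition, and a Neumann series adds `T` for large `|Im z|`. The Cayley transform of the resulting
self-adjoint restriction is unitary. Its continuous functional calculus, the Riesz-Markov theorem
and polarization give a positive semidefinite matrix measure on the circle without an atom at `1`.
Transported to the line, it represents `M` (`exists_herglotz`). -/

/-- Lebesgue measure on the half-line. -/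
abbrev halfLine : Measure ℝ := volume.restrict (Ioi (0 : ℝ))

/-! ### Indefinite integrals on the half-line -/

/-- `p` is, on `[0, ∞)`, an indefinite integral of the locally integrable function `a`. -/
structure IsPrimitive (p a : ℝ → ℂ) : Prop where
  locInt : ∀ x, 0 ≤ x → IntervalIntegrable a volume 0 x
  eq : ∀ x, 0 ≤ x → p x = p 0 + ∫ t in (0 : ℝ)..x, a t

/-- Real and imaginary parts are treated separately and recombined as real functions times the
constants `1` and `i`. -/
theorem absolutelyContinuousOnInterval_integral {f : ℝ → ℂ} {a b : ℝ}
    (h : IntervalIntegrable f volume a b) :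
    AbsolutelyContinuousOnInterval (fun x => ∫ v in a..x, f v) a b := by
  have hre : IntervalIntegrable (fun x => (f x).re) volume a b := ⟨h.1.re, h.2.re⟩
  have him : IntervalIntegrable (fun x => (f x).im) volume a b := ⟨h.1.im, h.2.im⟩
  have hc : ∀ c : ℂ, AbsolutelyContinuousOnInterval (fun _ : ℝ => c) a b := fun c =>
    ((LipschitzWith.const c).lipschitzOnWith (s := uIcc a b)).absolutelyContinuousOnInterval
  have h1 := (hre.absolutelyContinuousOnInterval_intervalIntegral left_mem_uIcc).smul (hc 1)
  have h2 := (him.absolutelyContinuousOnInterval_intervalIntegral left_mem_uIcc).smul (hc Complex.I)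
  have h3 := h1.add h2
  rw [absolutelyContinuousOnInterval_iff] at h3 ⊢
  intro ε hε
  obtain ⟨δ, hδ, H⟩ := h3 ε hε
  refine ⟨δ, hδ, fun E hE hE' => ?_⟩
  have key : ∀ x ∈ uIcc a b, ∫ v in a..x, f v =
      ((fun x => ∫ v in a..x, (f v).re) • (fun _ : ℝ => (1 : ℂ)) +
        (fun x => ∫ v in a..x, (f v).im) • (fun _ : ℝ => Complex.I)) x := by
    intro x hx
    have hi : IntervalIntegrable f volume a x := h.mono_set (uIcc_subset_uIcc left_mem_uIcc hx)
    simp only [Pi.add_apply, Pi.smul_apply', Complex.real_smul, mul_one]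
    rw [← intervalIntegral.integral_ofReal, ← intervalIntegral.integral_ofReal,
      ← intervalIntegral.integral_mul_const, ← intervalIntegral.integral_add]
    · simp_rw [Complex.re_add_im]
    · exact ⟨hi.1.re.ofReal, hi.2.re.ofReal⟩
    · exact IntervalIntegrable.mul_const ⟨hi.1.im.ofReal, hi.2.im.ofReal⟩ _
  have := H E hE hE'
  refine lt_of_eq_of_lt (Finset.sum_congr rfl fun i hi => ?_) this
  obtain ⟨h1, h2⟩ := hE.1 i hi
  rw [key _ h1, key _ h2]

namespace IsPrimitive

variable {p q a b : ℝ → ℂ}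

theorem continuousOn (h : IsPrimitive p a) : ContinuousOn p (Ici 0) := by
  intro x hx
  have hx : 0 ≤ x := hx
  have h1 : ContinuousOn (fun y => p 0 + ∫ t in (0 : ℝ)..y, a t) (Icc 0 (x + 1)) := by
    have := (intervalIntegral.continuousOn_primitive_interval'
      (h.locInt (x + 1) (by linarith)) left_mem_uIcc)
    rw [uIcc_of_le (by linarith)] at this
    exact continuousOn_const.add this
  have h2 : ContinuousOn p (Icc 0 (x + 1)) := h1.congr fun y hy => h.eq y hy.1
  refine (h2 x ⟨hx, by linarith⟩).mono_of_mem_nhdsWithin ?_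
  rw [mem_nhdsWithin]
  exact ⟨Iio (x + 1), isOpen_Iio, by simp, fun y hy => ⟨hy.2, hy.1.le⟩⟩

theorem continuousOn_uIcc (h : IsPrimitive p a) {x : ℝ} (hx : 0 ≤ x) :
    ContinuousOn p (uIcc 0 x) :=
  h.continuousOn.mono fun y hy => by
    rw [uIcc_of_le hx] at hy; exact hy.1

/-- The difference between the product and the integral of its expected derivative is absolutely
continuous with derivative zero almost everywhere, hence constant. This is integration by parts for
merely locally integrable derivatives. -/
theorem mul (hp : IsPrimitive p a) (hq : IsPrimitive q b) :
    IsPrimitive (fun t => p t * q t) (fun t => a t * q t + p t * b t) := by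
  have hint : ∀ x, 0 ≤ x → IntervalIntegrable (fun t => a t * q t + p t * b t) volume 0 x :=
    fun x hx => ((hp.locInt x hx).mul_continuousOn (hq.continuousOn_uIcc hx)).add
      ((hq.locInt x hx).continuousOn_mul (hp.continuousOn_uIcc hx))
  refine ⟨hint, fun x hx => ?_⟩
  have hac : ∀ f g : ℝ → ℂ, IsPrimitive f g → AbsolutelyContinuousOnInterval f 0 x := by
    intro f g h
    have h1 := (absolutelyContinuousOnInterval_integral (h.locInt x hx))
    rw [absolutelyContinuousOnInterval_iff] at h1 ⊢
    intro ε hε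
    obtain ⟨δ, hδ, H⟩ := h1 ε hε
    refine ⟨δ, hδ, fun E hE hE' => ?_⟩
    refine lt_of_eq_of_lt (Finset.sum_congr rfl fun i hi => ?_) (H E hE hE')
    obtain ⟨h1, h2⟩ := hE.1 i hi
    rw [uIcc_of_le hx] at h1 h2
    rw [h.eq _ h1.1, h.eq _ h2.1, dist_add_left]
  have hder : ∀ f g : ℝ → ℂ, IsPrimitive f g →
      ∀ᵐ y, y ∈ uIcc 0 x → HasDerivAt f (g y) y := by
    intro f g h
    -- Nothing is known about `f` at negative arguments, so the two-sided derivative at `0` has to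
    -- be discarded.
    have h0 : ∀ᵐ y : ℝ, y ≠ 0 := by simp [ae_iff]
    filter_upwards [(h.locInt x hx).ae_hasDerivAt_integral, h0] with y hy hy0 hyx
    have h1 := (hy hyx 0 left_mem_uIcc).const_add (f 0)
    refine h1.congr_of_eventuallyEq ?_
    rw [uIcc_of_le hx] at hyx
    have : 0 < y := lt_of_le_of_ne hyx.1 (Ne.symm hy0)
    filter_upwards [Ioi_mem_nhds this] with w hw using h.eq w (le_of_lt hw)
  have hD := ((hac p a hp).smul (hac q b hq)).sub
    (absolutelyContinuousOnInterval_integral (hint x hx))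
  obtain ⟨C, hC⟩ := hD.const_of_ae_hasDerivAt_zero (by
    filter_upwards [hder p a hp, hder q b hq, (hint x hx).ae_hasDerivAt_integral]
      with y h1 h2 h3 hy
    have := ((h1 hy).mul (h2 hy)).sub (h3 hy 0 left_mem_uIcc)
    rw [sub_self] at this
    exact this)
  have e1 := hC x right_mem_uIcc
  have e0 := hC 0 left_mem_uIcc
  simp only [Pi.sub_apply, Pi.mul_apply, smul_eq_mul, intervalIntegral.integral_same,
    sub_zero] at e0 e1
  linear_combination e1 - e0

theorem add (hp : IsPrimitive p a) (hq : IsPrimitive q b) :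
    IsPrimitive (fun t => p t + q t) (fun t => a t + b t) :=
  ⟨fun x hx => (hp.locInt x hx).add (hq.locInt x hx), fun x hx => by
    rw [intervalIntegral.integral_add (hp.locInt x hx) (hq.locInt x hx), hp.eq x hx, hq.eq x hx]
    ring⟩

theorem const_mul (hp : IsPrimitive p a) (c : ℂ) :
    IsPrimitive (fun t => c * p t) (fun t => c * a t) :=
  ⟨fun x hx => (hp.locInt x hx).const_mul c, fun x hx => by
    rw [intervalIntegral.integral_const_mul, hp.eq x hx]; ring⟩

theorem conjugate (hp : IsPrimitive p a) :
    IsPrimitive (fun t => conj (p t)) (fun t => conj (a t)) := by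
  refine ⟨fun x hx => ?_, fun x hx => ?_⟩
  · have := hp.locInt x hx
    exact ⟨Complex.conjCLE.toContinuousLinearMap.integrable_comp this.1,
      Complex.conjCLE.toContinuousLinearMap.integrable_comp this.2⟩
  · rw [hp.eq x hx, map_add, intervalIntegral.integral_of_le hx, intervalIntegral.integral_of_le hx,
      integral_conj]

theorem congr_right (hp : IsPrimitive p a) (h : ∀ t, 0 < t → a t = b t) : IsPrimitive p b := by
  refine ⟨fun x hx => (hp.locInt x hx).congr ?_, fun x hx => ?_⟩
  · intro t ht
    rw [uIoc_of_le hx] at ht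
    exact h t ht.1
  · rw [hp.eq x hx]
    congr 1
    refine intervalIntegral.integral_congr_ae (Eventually.of_forall fun t ht => ?_)
    rw [uIoc_of_le hx] at ht
    exact h t ht.1

theorem of_hasDerivAt (h : ∀ t, HasDerivAt p (a t) t) (ha : Continuous a) : IsPrimitive p a :=
  ⟨fun x _ => ha.intervalIntegrable 0 x, fun x _ => by
    rw [intervalIntegral.integral_eq_sub_of_hasDerivAt (fun t _ => h t)
      (ha.intervalIntegrable 0 x)]; ring⟩

theorem hasDerivWithinAt (h : IsPrimitive p a) (ha : ContinuousOn a (Ici 0)) {x : ℝ}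
    (hx : 0 ≤ x) : HasDerivWithinAt p (a x) (Ici 0) x := by
  have hc : Continuous fun t => a (max t 0) :=
    ha.comp_continuous (by fun_prop) fun t => le_max_right t 0
  have h1 : HasDerivAt (fun y => p 0 + ∫ t in (0 : ℝ)..y, a (max t 0)) (a (max x 0)) x :=
    (intervalIntegral.integral_hasDerivAt_right (hc.intervalIntegrable 0 x)
      (hc.stronglyMeasurableAtFilter _ _) hc.continuousAt).const_add _
  rw [max_eq_left hx] at h1
  have e : ∀ y, 0 ≤ y → p y = p 0 + ∫ t in (0 : ℝ)..y, a (max t 0) := by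
    intro y hy
    rw [h.eq y hy]
    congr 1
    refine intervalIntegral.integral_congr fun t ht => ?_
    rw [uIcc_of_le hy] at ht
    simp only [max_eq_left ht.1]
  exact h1.hasDerivWithinAt.congr (fun y hy => e y hy) (e x hx)

theorem tendsto (h : IsPrimitive p a) (ha : Integrable a halfLine) :
    Tendsto p atTop (𝓝 (p 0 + ∫ t, a t ∂halfLine)) := by
  have h1 := (intervalIntegral_tendsto_integral_Ioi 0 ha tendsto_id).const_add (p 0)
  refine h1.congr' ?_
  filter_upwards [eventually_ge_atTop 0] with x hx using (h.eq x hx).symm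

end IsPrimitive

theorem not_integrable_of_eventually_norm_ge {p : ℝ → ℂ} {c : ℝ} (hc : 0 < c)
    (h : ∀ᶠ x in atTop, c ≤ ‖p x‖) : ¬ Integrable p halfLine := by
  intro hp
  obtain ⟨X, hX⟩ := eventually_atTop.1 h
  have h1 : IntegrableOn p (Ioi (max X 0)) :=
    IntegrableOn.mono_set hp (Ioi_subset_Ioi (le_max_right _ _))
  have h2 : IntegrableOn (fun _ : ℝ => c) (Ioi (max X 0)) := by
    refine Integrable.mono h1 aestronglyMeasurable_const ?_
    refine (ae_restrict_iff' measurableSet_Ioi).2 (Eventually.of_forall fun x hx => ?_)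
    rw [Real.norm_of_nonneg hc.le]
    exact hX x ((le_max_left _ _).trans (le_of_lt hx))
  rw [integrableOn_const_iff] at h2
  simp [hc.ne'] at h2

theorem eq_zero_of_tendsto_of_integrable {p : ℝ → ℂ} {L : ℂ} (hp : Integrable p halfLine)
    (h : Tendsto p atTop (𝓝 L)) : L = 0 := by
  by_contra hL
  have hpos : 0 < ‖L‖ := norm_pos_iff.2 hL
  refine not_integrable_of_eventually_norm_ge (half_pos hpos) ?_ hp
  exact (h.norm.eventually (lt_mem_nhds (half_lt_self hpos))).mono fun x hx => hx.le

/-- Integrability of the derivative gives a limit at infinity, and integrability of the function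
forces this limit to vanish: no boundary term survives at infinity. -/
theorem IsPrimitive.add_integral_eq_zero {p a : ℝ → ℂ} (h : IsPrimitive p a)
    (hp : Integrable p halfLine) (ha : Integrable a halfLine) :
    p 0 + ∫ t, a t ∂halfLine = 0 :=
  eq_zero_of_tendsto_of_integrable hp (h.tendsto ha)

theorem integrable_mul_of_memLp {f g : ℝ → ℂ} (hf : MemLp f 2 halfLine)
    (hg : MemLp g 2 halfLine) : Integrable (fun t => f t * g t) halfLine :=
  hf.integrable_mul hg

theorem memLp_conj {f : ℝ → ℂ} (hf : MemLp f 2 halfLine) :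
    MemLp (fun t => conj (f t)) 2 halfLine := hf.star

theorem intervalIntegrable_of_memLp {f : ℝ → ℂ} (hf : MemLp f 2 halfLine) {x : ℝ} (hx : 0 ≤ x) :
    IntervalIntegrable f volume 0 x := by
  rw [intervalIntegrable_iff_integrableOn_Ioc_of_le hx]
  have h1 : MemLp f 2 (volume.restrict (Ioc 0 x)) :=
    hf.mono_measure (Measure.restrict_mono_set _ Ioc_subset_Ioi_self)
  exact h1.integrable one_le_two

namespace IsPrimitive

variable {p a : ℝ → ℂ}

theorem re_eq (h : IsPrimitive p a) {x : ℝ} (hx : 0 ≤ x) :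
    (p x).re = (p 0).re + ∫ t in (0 : ℝ)..x, (a t).re := by
  have h1 := congrArg Complex.re (h.eq x hx)
  rw [Complex.add_re] at h1
  rw [h1]
  congr 1
  exact (Complex.reCLM.intervalIntegral_comp_comm (h.locInt x hx)).symm

theorem re_intervalIntegrable (h : IsPrimitive p a) {x : ℝ} (hx : 0 ≤ x) :
    IntervalIntegrable (fun t => (a t).re) volume 0 x :=
  ⟨(h.locInt x hx).1.re, (h.locInt x hx).2.re⟩

theorem normSq (h : IsPrimitive p a) {x : ℝ} (hx : 0 ≤ x) :
    IntervalIntegrable (fun t => 2 * (conj (p t) * a t).re) volume 0 x ∧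
    ‖p x‖ ^ 2 = ‖p 0‖ ^ 2 + ∫ t in (0 : ℝ)..x, 2 * (conj (p t) * a t).re := by
  have h1 := h.conjugate.mul h
  have e : ∀ t, (conj (a t) * p t + conj (p t) * a t).re = 2 * (conj (p t) * a t).re := by
    intro t
    simp only [Complex.add_re, Complex.mul_re, Complex.conj_re, Complex.conj_im]; ring
  have e' : ∀ t, (conj (p t) * p t).re = ‖p t‖ ^ 2 := by
    intro t
    rw [Complex.conj_mul']; norm_cast
  have h2 := h1.re_eq hx
  have h3 := h1.re_intervalIntegrable hx
  simp only [e, e'] at h2 h3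
  exact ⟨h3, h2⟩

/-- The bounded solutions of a first-order equation with square integrable right-hand side are
square integrable. -/
theorem memLp_of_energy {h : ℝ → ℂ} {κ : ℂ} (hκ : κ.re ≠ 0) (hh : MemLp h 2 halfLine)
    (hp : IsPrimitive p (fun t => κ * p t + h t)) {B : ℝ}
    (hB : ∀ x, 0 ≤ x → κ.re * ‖p x‖ ^ 2 ≤ B) : MemLp p 2 halfLine := by
  have hm : AEStronglyMeasurable p halfLine :=
    (hp.continuousOn.mono Ioi_subset_Ici_self).aestronglyMeasurable measurableSet_Ioi
  rw [memLp_two_iff_integrable_sq_norm hm]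
  have hcont : ContinuousOn (fun t => ‖p t‖ ^ 2) (Ici 0) := hp.continuousOn.norm.pow 2
  have hii : ∀ x, 0 ≤ x → IntervalIntegrable (fun t => ‖p t‖ ^ 2) volume 0 x := fun x hx =>
    (hcont.mono (by rw [uIcc_of_le hx]; exact Icc_subset_Ici_self)).intervalIntegrable
  have hh2 : Integrable (fun t => ‖h t‖ ^ 2) halfLine :=
    (memLp_two_iff_integrable_sq_norm hh.1).1 hh
  have hhi : ∀ x, 0 ≤ x → IntervalIntegrable (fun t => ‖h t‖ ^ 2) volume 0 x := fun x hx => by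
    rw [intervalIntegrable_iff_integrableOn_Ioc_of_le hx]
    exact IntegrableOn.mono_set hh2 Ioc_subset_Ioi_self
  set r := κ.re with hr
  have hr2 : 0 < r ^ 2 := by positivity
  refine integrableOn_Ioi_of_intervalIntegral_norm_bounded (b := fun x : ℝ => x) (l := atTop)
    ((r ^ 2)⁻¹ * (B - r * ‖p 0‖ ^ 2 + ∫ t, ‖h t‖ ^ 2 ∂halfLine)) 0 ?_ tendsto_id ?_
  · intro x
    rcases le_total 0 x with hx | hx
    · exact (intervalIntegrable_iff_integrableOn_Ioc_of_le hx).1 (hii x hx)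
    · rw [Ioc_eq_empty (by linarith)]; exact integrableOn_empty
  · filter_upwards [eventually_ge_atTop 0] with x hx
    obtain ⟨h1, h2⟩ := hp.normSq hx
    have hnn : ∀ t, ‖‖p t‖ ^ 2‖ = ‖p t‖ ^ 2 := fun t => by simp
    simp only [hnn]
    -- By `2|r||p||h| ≤ r²|p|² + |h|²`, the derivative of `r|p|²` dominates `r²|p|² - |h|²`.
    -- Integrating, an upper bound for `r|p|²` controls the `L²` norm of `p`. For `r < 0` that upper
    -- bound is free.
    have pt : ∀ t, r ^ 2 * ‖p t‖ ^ 2 - ‖h t‖ ^ 2 ≤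
        r * (2 * (conj (p t) * (κ * p t + h t)).re) := by
      intro t
      have e1 : (conj (p t) * (κ * p t + h t)).re = r * ‖p t‖ ^ 2 + (conj (p t) * h t).re := by
        rw [mul_add, Complex.add_re, mul_left_comm, Complex.conj_mul']
        congr 1
        rw [← Complex.ofReal_pow, Complex.re_mul_ofReal]
      have e2 : |(conj (p t) * h t).re| ≤ ‖p t‖ * ‖h t‖ := by
        refine (Complex.abs_re_le_norm _).trans ?_
        rw [norm_mul, RCLike.norm_conj]
      rw [e1]
      have e3 : -(|r| * (‖p t‖ * ‖h t‖)) ≤ r * (conj (p t) * h t).re := by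
        have := neg_abs_le (r * (conj (p t) * h t).re)
        rw [abs_mul] at this
        have h5 := mul_le_mul_of_nonneg_left e2 (abs_nonneg r)
        linarith
      have e4 : 0 ≤ (|r| * ‖p t‖ - ‖h t‖) ^ 2 := sq_nonneg _
      have e5 : |r| ^ 2 = r ^ 2 := sq_abs r
      nlinarith
    have h3 := intervalIntegral.integral_mono_on hx
      (((hii x hx).const_mul (r ^ 2)).sub (hhi x hx)) (h1.const_mul r) (fun t _ => pt t)
    rw [intervalIntegral.integral_sub ((hii x hx).const_mul _) (hhi x hx),
      intervalIntegral.integral_const_mul, intervalIntegral.integral_const_mul] at h3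
    have h4 : ∫ t in (0 : ℝ)..x, ‖h t‖ ^ 2 ≤ ∫ t, ‖h t‖ ^ 2 ∂halfLine := by
      rw [intervalIntegral.integral_of_le hx]
      exact setIntegral_mono_set hh2 (Eventually.of_forall fun t => by positivity)
        Ioc_subset_Ioi_self.eventuallyLE
    have h5 := hB x hx
    rw [h2] at h5
    rw [← div_eq_inv_mul, le_div_iff₀ hr2]
    linarith

/-- Variation of constants for `p' = κ p + h` with `p(0) = c`. -/
theorem exists_linear (κ c : ℂ) {h : ℝ → ℂ} (hh : ∀ x, 0 ≤ x → IntervalIntegrable h volume 0 x) :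
    IsPrimitive (fun x => Complex.exp (κ * x) *
        (c + ∫ t in (0 : ℝ)..x, Complex.exp (-κ * t) * h t))
      (fun x => κ * (Complex.exp (κ * x) * (c + ∫ t in (0 : ℝ)..x, Complex.exp (-κ * t) * h t))
        + h x) := by
  have hexp : ∀ κ : ℂ, Continuous fun x : ℝ => Complex.exp (κ * x) := fun κ => by fun_prop
  have h1 : IsPrimitive (fun x : ℝ => Complex.exp (κ * x)) (fun x => κ * Complex.exp (κ * x)) := by
    refine of_hasDerivAt (fun t => ?_) (by fun_prop)
    have : HasDerivAt (fun x : ℝ => κ * (x : ℂ)) (κ * 1) t :=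
      (Complex.ofRealCLM.hasDerivAt).const_mul κ
    convert this.cexp using 1
    ring
  have h2 : IsPrimitive (fun x : ℝ => c + ∫ t in (0 : ℝ)..x, Complex.exp (-κ * t) * h t)
      (fun t => Complex.exp (-κ * t) * h t) :=
    ⟨fun x hx => (hh x hx).continuousOn_mul (hexp (-κ)).continuousOn, fun x hx => by simp⟩
  refine (h1.mul h2).congr_right fun t _ => ?_
  have : Complex.exp (κ * t) * Complex.exp (-κ * t) = 1 := by
    rw [← Complex.exp_add]; simp
  linear_combination h t * this

end IsPrimitive

/-! ### The second order Sobolev space and the scalar Dirichlet problem -/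

/-- `u` is in the second order Sobolev space of the half-line, with derivatives `u'` and `g`. -/
structure IsSobolev (u u' g : ℝ → ℂ) : Prop where
  prim : IsPrimitive u u'
  prim' : IsPrimitive u' g
  memLp : MemLp u 2 halfLine
  memLp_snd : MemLp g 2 halfLine

namespace IsSobolev

variable {u u' g w w' h : ℝ → ℂ}

theorem conjugate (H : IsSobolev u u' g) :
    IsSobolev (fun t => conj (u t)) (fun t => conj (u' t)) (fun t => conj (g t)) :=
  ⟨H.prim.conjugate, H.prim'.conjugate, memLp_conj H.memLp, memLp_conj H.memLp_snd⟩

theorem add (H : IsSobolev u u' g) (K : IsSobolev w w' h) :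
    IsSobolev (fun t => u t + w t) (fun t => u' t + w' t) (fun t => g t + h t) :=
  ⟨H.prim.add K.prim, H.prim'.add K.prim', H.memLp.add K.memLp, H.memLp_snd.add K.memLp_snd⟩

theorem const_mul (H : IsSobolev u u' g) (c : ℂ) :
    IsSobolev (fun t => c * u t) (fun t => c * u' t) (fun t => c * g t) :=
  ⟨H.prim.const_mul c, H.prim'.const_mul c, H.memLp.const_mul c, H.memLp_snd.const_mul c⟩

theorem congr_snd (H : IsSobolev u u' g) (e : ∀ t, 0 < t → g t = h t) : IsSobolev u u' h :=
  ⟨H.prim, H.prim'.congr_right e, H.memLp, H.memLp_snd.ae_eq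
    ((ae_restrict_iff' measurableSet_Ioi).2 (Eventually.of_forall fun t ht => e t ht))⟩

/-- Integrating `(conj u · u')' = |u'|² + conj u · g` bounds `∫₀ˣ |u'|²` by `Re (conj u · u')(x) +
c`. If the integral ever exceeded `c + 1`, this real part would stay at least `1` from there on,
`|u|²` would grow linearly, and `u` would not be square integrable. -/
theorem memLp_deriv (H : IsSobolev u u' g) : MemLp u' 2 halfLine := by
  have hcont : ContinuousOn (fun t => ‖u' t‖ ^ 2) (Ici 0) := H.prim'.continuousOn.norm.pow 2
  have hii : ∀ x, 0 ≤ x → IntervalIntegrable (fun t => ‖u' t‖ ^ 2) volume 0 x := fun x hx =>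
    (hcont.mono (by rw [uIcc_of_le hx]; exact Icc_subset_Ici_self)).intervalIntegrable
  have hm : AEStronglyMeasurable u' halfLine :=
    (H.prim'.continuousOn.mono Ioi_subset_Ici_self).aestronglyMeasurable measurableSet_Ioi
  rw [memLp_two_iff_integrable_sq_norm hm]
  have hug := integrable_mul_of_memLp (memLp_conj H.memLp) H.memLp_snd
  set c : ℝ := ‖conj (u 0) * u' 0‖ + ∫ t, ‖conj (u t) * g t‖ ∂halfLine with hc
  have hφ := H.prim.conjugate.mul H.prim'
  have hre : ∀ x, 0 ≤ x → ∫ t in (0 : ℝ)..x, ‖u' t‖ ^ 2 ≤ (conj (u x) * u' x).re + c := by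
    intro x hx
    have hugi : IntervalIntegrable (fun t => conj (u t) * g t) volume 0 x := by
      rw [intervalIntegrable_iff_integrableOn_Ioc_of_le hx]
      exact IntegrableOn.mono_set hug Ioc_subset_Ioi_self
    have h1 := hφ.re_eq hx
    have e : ∀ t, (conj (u' t) * u' t + conj (u t) * g t).re =
        ‖u' t‖ ^ 2 + (conj (u t) * g t).re := by
      intro t
      rw [Complex.add_re, Complex.conj_mul']; norm_cast
    simp only [e] at h1
    have hugr : IntervalIntegrable (fun t => (conj (u t) * g t).re) volume 0 x :=
      ⟨hugi.1.re, hugi.2.re⟩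
    rw [intervalIntegral.integral_add (hii x hx) hugr] at h1
    have h2 : |∫ t in (0 : ℝ)..x, (conj (u t) * g t).re| ≤ ∫ t, ‖conj (u t) * g t‖ ∂halfLine := by
      rw [← Real.norm_eq_abs, intervalIntegral.integral_of_le hx]
      refine (norm_integral_le_integral_norm _).trans ?_
      refine (integral_mono hugr.1.norm hugi.1.norm fun t => Complex.abs_re_le_norm _).trans ?_
      exact setIntegral_mono_set hug.norm (Eventually.of_forall fun t => by positivity)
        Ioc_subset_Ioi_self.eventuallyLE
    have h3 := (abs_le.1 h2).1
    have h4 := (abs_le.1 (Complex.abs_re_le_norm (conj (u 0) * u' 0))).1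
    linarith
  have hbdd : ∀ X, 0 ≤ X → ∫ t in (0 : ℝ)..X, ‖u' t‖ ^ 2 ≤ c + 1 := by
    intro X hX
    by_contra hcon
    push Not at hcon
    refine not_integrable_of_eventually_norm_ge (c := 1) one_pos ?_
      (integrable_mul_of_memLp (memLp_conj H.memLp) H.memLp)
    filter_upwards [eventually_ge_atTop (X + 1)] with x hx
    have hx0 : 0 ≤ x := by linarith
    have hge : ∀ y, X ≤ y → 1 ≤ (conj (u y) * u' y).re := by
      intro y hy
      have h1 := hre y (hX.trans hy)
      have h2 := intervalIntegral.integral_mono_interval le_rfl hX hy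
        (Eventually.of_forall fun t => sq_nonneg ‖u' t‖) (hii y (hX.trans hy))
      linarith
    obtain ⟨i1, e1⟩ := H.prim.normSq hx0
    obtain ⟨i2, e2⟩ := H.prim.normSq hX
    have hi := (i2.symm.trans i1)
    have e3 := intervalIntegral.integral_interval_sub_left i1 i2
    have h4 : (∫ _ in X..x, (2 : ℝ)) ≤ ∫ t in X..x, 2 * (conj (u t) * u' t).re :=
      intervalIntegral.integral_mono_on (by linarith) (by simp) hi
        fun t ht => by linarith [hge t ht.1]
    rw [intervalIntegral.integral_const, smul_eq_mul] at h4
    have : ‖conj (u x) * u x‖ = ‖u x‖ ^ 2 := by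
      rw [norm_mul, RCLike.norm_conj, sq]
    rw [this]
    nlinarith [sq_nonneg ‖u X‖]
  refine integrableOn_Ioi_of_intervalIntegral_norm_bounded (b := fun x : ℝ => x) (l := atTop)
    (c + 1) 0 ?_ tendsto_id ?_
  · intro x
    rcases le_total 0 x with hx | hx
    · exact (intervalIntegrable_iff_integrableOn_Ioc_of_le hx).1 (hii x hx)
    · rw [Ioc_eq_empty (by linarith)]; exact integrableOn_empty
  · filter_upwards [eventually_ge_atTop 0] with x hx
    have hnn : ∀ t, ‖‖u' t‖ ^ 2‖ = ‖u' t‖ ^ 2 := fun t => by simp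
    simp only [hnn]
    exact hbdd x hx

/-- Green's identity on the half-line. -/
theorem green (H : IsSobolev u u' g) (K : IsSobolev w w' h) :
    ∫ t, (u t * h t - g t * w t) ∂halfLine = u' 0 * w 0 - u 0 * w' 0 := by
  have hp := ((H.prim.mul K.prim').add ((H.prim'.mul K.prim).const_mul (-1))).congr_right
    (b := fun t => u t * h t - g t * w t) (fun t _ => by ring)
  have h1 := (integrable_mul_of_memLp H.memLp K.memLp_deriv).add
    ((integrable_mul_of_memLp H.memLp_deriv K.memLp).const_mul (-1))
  have h2 := (integrable_mul_of_memLp H.memLp K.memLp_snd).sub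
    (integrable_mul_of_memLp H.memLp_snd K.memLp)
  have h3 := hp.add_integral_eq_zero h1 h2
  linear_combination h3

theorem memLp_exp {κ : ℂ} (hκ : 0 < κ.re) :
    MemLp (fun x : ℝ => Complex.exp (-κ * x)) 2 halfLine ∧
      ∫ x, ‖Complex.exp (-κ * x)‖ ^ 2 ∂halfLine = 1 / (2 * κ.re) := by
  have hm : AEStronglyMeasurable (fun x : ℝ => Complex.exp (-κ * x)) halfLine :=
    (by fun_prop : Continuous fun x : ℝ => Complex.exp (-κ * x)).aestronglyMeasurable
  have e : ∀ x : ℝ, ‖Complex.exp (-κ * x)‖ ^ 2 = Real.exp (-(2 * κ.re) * x) := by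
    intro x
    rw [Complex.norm_exp, sq, ← Real.exp_add]
    congr 1
    simp; ring
  rw [memLp_two_iff_integrable_sq_norm hm]
  simp only [e]
  refine ⟨exp_neg_integrableOn_Ioi 0 (by positivity), ?_⟩
  rw [integral_exp_mul_Ioi (by linarith)]
  simp

theorem exp {κ : ℂ} (hκ : 0 < κ.re) :
    IsSobolev (fun x : ℝ => Complex.exp (-κ * x)) (fun x => -κ * Complex.exp (-κ * x))
      (fun x => κ ^ 2 * Complex.exp (-κ * x)) := by
  have hd : IsPrimitive (fun x : ℝ => Complex.exp (-κ * x))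
      (fun x => -κ * Complex.exp (-κ * x)) := by
    have := IsPrimitive.exists_linear (-κ) 1 (h := fun _ => 0) (by simp)
    simpa using this
  refine ⟨hd, ?_, (memLp_exp hκ).1, (memLp_exp hκ).1.const_mul _⟩
  exact (hd.const_mul (-κ)).congr_right fun t _ => by ring

/-- The Dirichlet problem for `u'' = κ² u - g`. -/
theorem exists_dirichlet {κ : ℂ} (hκ : 0 < κ.re) (c : ℂ) (hg : MemLp g 2 halfLine) :
    ∃ u u' : ℝ → ℂ, IsSobolev u u' (fun t => κ ^ 2 * u t - g t) ∧ u 0 = c := by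
  have hE := (memLp_exp hκ).1
  have hint : Integrable (fun t : ℝ => Complex.exp (-κ * t) * g t) halfLine :=
    integrable_mul_of_memLp hE hg
  set I : ℂ := ∫ t, Complex.exp (-κ * t) * g t ∂halfLine with hI
  have hgi : ∀ x, 0 ≤ x → IntervalIntegrable g volume 0 x := fun x hx =>
    intervalIntegrable_of_memLp hg hx
  -- The equation factors as `(d/dx - κ)(d/dx + κ)u = -g`. The factor `w' = κw - g` has growing
  -- homogeneous solutions, and the initial value `I` singles out the bounded solution `∫ₓ^∞
  -- exp(κ(x-t)) g(t) dt`. Then `u' = -κu + w` is stable for every initial value.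
  have hw := IsPrimitive.exists_linear κ I (h := fun t => -g t) (fun x hx => (hgi x hx).neg)
  set w : ℝ → ℂ := fun x => Complex.exp (κ * x) *
        (I + ∫ t in (0 : ℝ)..x, Complex.exp (-κ * t) * -g t) with hwdef
  have hg2 : Integrable (fun t => ‖g t‖ ^ 2) halfLine :=
    (memLp_two_iff_integrable_sq_norm hg.1).1 hg
  have hwb : ∀ x, 0 ≤ x → ‖w x‖ ≤ 1 / (2 * κ.re) + ∫ t, ‖g t‖ ^ 2 ∂halfLine := by
    intro x hx
    have e1 : I + ∫ t in (0 : ℝ)..x, Complex.exp (-κ * t) * -g t =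
        ∫ t in Ioi x, Complex.exp (-κ * t) * g t := by
      simp only [mul_neg, intervalIntegral.integral_neg]
      rw [hI, ← sub_eq_add_neg, sub_eq_iff_eq_add, intervalIntegral.integral_of_le hx, add_comm,
        ← setIntegral_union (Ioc_disjoint_Ioi le_rfl) measurableSet_Ioi, Ioc_union_Ioi_eq_Ioi hx]
      · exact IntegrableOn.mono_set hint Ioc_subset_Ioi_self
      · exact IntegrableOn.mono_set hint (Ioi_subset_Ioi hx)
    have e2 : w x = ∫ t in Ioi x, Complex.exp (κ * x) * (Complex.exp (-κ * t) * g t) := by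
      rw [integral_const_mul, ← e1]
    rw [e2]
    refine (norm_integral_le_integral_norm _).trans ?_
    have i1 : IntegrableOn (fun t : ℝ => Real.exp (2 * κ.re * x) * Real.exp (-(2 * κ.re) * t))
        (Ioi x) := (exp_neg_integrableOn_Ioi x (by positivity)).const_mul _
    have i2 : IntegrableOn (fun t => ‖g t‖ ^ 2) (Ioi x) :=
      IntegrableOn.mono_set hg2 (Ioi_subset_Ioi hx)
    have hle : ∀ t : ℝ, ‖Complex.exp (κ * x) * (Complex.exp (-κ * t) * g t)‖ ≤
        Real.exp (2 * κ.re * x) * Real.exp (-(2 * κ.re) * t) + ‖g t‖ ^ 2 := by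
      intro t
      have e3 : ‖Complex.exp (κ * x) * (Complex.exp (-κ * t) * g t)‖ =
          Real.exp (κ.re * (x - t)) * ‖g t‖ := by
        rw [norm_mul, norm_mul, Complex.norm_exp, Complex.norm_exp, ← mul_assoc, ← Real.exp_add]
        congr 2
        simp; ring
      have e4 : Real.exp (2 * κ.re * x) * Real.exp (-(2 * κ.re) * t) =
          Real.exp (κ.re * (x - t)) ^ 2 := by
        rw [sq, ← Real.exp_add, ← Real.exp_add]; congr 1; ring
      rw [e3, e4]
      nlinarith [sq_nonneg (Real.exp (κ.re * (x - t)) - ‖g t‖),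
        sq_nonneg (Real.exp (κ.re * (x - t))), sq_nonneg (‖g t‖)]
    refine (integral_mono_of_nonneg (Eventually.of_forall fun t => norm_nonneg _) (i1.add i2)
      (Eventually.of_forall hle)).trans ?_
    simp only [Pi.add_apply]
    rw [integral_add i1 i2, integral_const_mul, integral_exp_mul_Ioi (by linarith)]
    refine add_le_add (le_of_eq ?_) ?_
    · have : Real.exp (2 * κ.re * x) * Real.exp (-(2 * κ.re) * x) = 1 := by
        rw [← Real.exp_add]; simp
      have hne : κ.re ≠ 0 := hκ.ne'
      field_simp
      rw [← this]; ring_nf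
    · exact setIntegral_mono_set hg2 (Eventually.of_forall fun t => by positivity)
        (Ioi_subset_Ioi hx).eventuallyLE
  have hwL : MemLp w 2 halfLine := by
    refine hw.memLp_of_energy hκ.ne' hg.neg
      (B := κ.re * (1 / (2 * κ.re) + ∫ t, ‖g t‖ ^ 2 ∂halfLine) ^ 2) fun x hx => ?_
    have := hwb x hx
    gcongr
  have hu := IsPrimitive.exists_linear (-κ) c (h := w)
    (fun x hx => (hw.continuousOn_uIcc hx).intervalIntegrable)
  set u : ℝ → ℂ := fun x => Complex.exp (-κ * x) *
        (c + ∫ t in (0 : ℝ)..x, Complex.exp (- -κ * t) * w t) with hudef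
  have huL : MemLp u 2 halfLine := by
    refine hu.memLp_of_energy (by simpa using hκ.ne') hwL (B := 0) fun x hx => ?_
    have := sq_nonneg ‖u x‖
    simp only [Complex.neg_re]
    nlinarith
  refine ⟨u, fun x => -κ * u x + w x, ⟨hu, ?_, huL, (huL.const_mul _).sub hg⟩, by simp [u]⟩
  exact ((hu.const_mul (-κ)).add hw).congr_right fun t _ => by ring

end IsSobolev

/-! ### Abstract boundary relations and self-adjoint boundary conditions -/

/-- A linear relation with two boundary maps into `ℂ²` that satisfies Green's identity: an
element `(u, g, a, b)` consists of a vector `u`, its image `g` and its boundary values. -/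
structure BoundaryRelation (H : Type*) [NormedAddCommGroup H] [InnerProductSpace ℂ H] where
  rel : Submodule ℂ (H × H × (Fin 2 → ℂ) × (Fin 2 → ℂ))
  green : ∀ {u g a b w h c d}, (u, g, a, b) ∈ rel → (w, h, c, d) ∈ rel →
    inner ℂ u h - inner ℂ g w = star a ⬝ᵥ d - star b ⬝ᵥ c
  zero : ∀ {g a b}, ((0 : H), g, a, b) ∈ rel → g = 0 ∧ a = 0 ∧ b = 0

/-- The matrices of a self-adjoint boundary condition `C a + S b = 0`. -/
structure IsBoundaryPair (C S : Matrix (Fin 2) (Fin 2) ℂ) : Prop where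
  hermC : Cᴴ = C
  hermS : Sᴴ = S
  comm : C * S = S * C
  sq : C * C + S * S = 1

namespace IsBoundaryPair

variable {C S : Matrix (Fin 2) (Fin 2) ℂ}

/-- The block matrix `[[C, S], [-S, C]]` is unitary, so passing to `(C a + S b, C b - S a)` is a
rotation of the boundary data, inverted by its adjoint. -/
theorem recover (h : IsBoundaryPair C S) (a b : Fin 2 → ℂ) :
    a = C *ᵥ (C *ᵥ a + S *ᵥ b) - S *ᵥ (C *ᵥ b - S *ᵥ a) ∧
    b = S *ᵥ (C *ᵥ a + S *ᵥ b) + C *ᵥ (C *ᵥ b - S *ᵥ a) := by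
  have e : ∀ x : Fin 2 → ℂ, (C * C) *ᵥ x + (S * S) *ᵥ x = x := fun x => by
    rw [← Matrix.add_mulVec, h.sq, Matrix.one_mulVec]
  constructor
  · simp only [Matrix.mulVec_add, Matrix.mulVec_sub, Matrix.mulVec_mulVec, h.comm]
    nth_rw 1 [← e a]; abel
  · simp only [Matrix.mulVec_add, Matrix.mulVec_sub, Matrix.mulVec_mulVec, h.comm]
    nth_rw 1 [← e b]; abel

/-- The boundary form in terms of the boundary data `C a + S b` and `C b - S a`. -/
theorem form_eq (h : IsBoundaryPair C S) (a b c d : Fin 2 → ℂ) :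
    star a ⬝ᵥ d - star b ⬝ᵥ c =
      star (C *ᵥ a + S *ᵥ b) ⬝ᵥ (C *ᵥ d - S *ᵥ c) -
        star (C *ᵥ b - S *ᵥ a) ⬝ᵥ (C *ᵥ c + S *ᵥ d) := by
  obtain ⟨h1, h2⟩ := h.recover c d
  have mv : ∀ (A : Matrix (Fin 2) (Fin 2) ℂ) (x y : Fin 2 → ℂ), Aᴴ = A →
      star x ⬝ᵥ (A *ᵥ y) = star (A *ᵥ x) ⬝ᵥ y := by
    intro A x y hA
    rw [Matrix.star_mulVec, hA, Matrix.dotProduct_mulVec]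
  set v := C *ᵥ c + S *ᵥ d
  set w := C *ᵥ d - S *ᵥ c
  rw [h1, h2]
  simp only [star_add, star_sub, dotProduct_add, dotProduct_sub, add_dotProduct, sub_dotProduct,
    mv C _ _ h.hermC, mv S _ _ h.hermS]
  ring

end IsBoundaryPair

namespace BoundaryRelation

variable {H : Type*} [NormedAddCommGroup H] [InnerProductSpace ℂ H] (R : BoundaryRelation H)
  {C S : Matrix (Fin 2) (Fin 2) ℂ}

/-- The boundary value problem `(g - z u = f, C a + S b = v)` is solvable for all `f` and `v`. -/
def Solvable (C S : Matrix (Fin 2) (Fin 2) ℂ) (z : ℂ) : Prop :=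
  ∀ (f : H) (v : Fin 2 → ℂ), ∃ u a b, (u, z • u + f, a, b) ∈ R.rel ∧ C *ᵥ a + S *ᵥ b = v

variable {R}

theorem green_hom (h : IsBoundaryPair C S) {u g w k : H} {a b c d : Fin 2 → ℂ}
    (h1 : (u, g, a, b) ∈ R.rel) (h2 : (w, k, c, d) ∈ R.rel)
    (hab : C *ᵥ a + S *ᵥ b = 0) (hcd : C *ᵥ c + S *ᵥ d = 0) : inner ℂ u k = inner ℂ g w := by
  rw [← sub_eq_zero, R.green h1 h2, h.form_eq, hab, hcd]
  simp

/-- The boundary form vanishes on the boundary condition, so Green's identity for `u` with itself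
leaves `Im z ‖u‖² = -Im ⟨u, f⟩`. -/
theorem norm_le (h : IsBoundaryPair C S) {u f : H} {z : ℂ} {a b : Fin 2 → ℂ}
    (h1 : (u, z • u + f, a, b) ∈ R.rel) (hab : C *ᵥ a + S *ᵥ b = 0) :
    |z.im| * ‖u‖ ≤ ‖f‖ := by
  have e := green_hom h h1 h1 hab hab
  rw [inner_add_right, inner_add_left, inner_smul_right, inner_smul_left,
    inner_self_eq_norm_sq_to_K] at e
  have e1 := congrArg Complex.im e
  have e2 : (inner ℂ f u : ℂ).im = -(inner ℂ u f : ℂ).im := by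
    rw [← inner_conj_symm u f, Complex.conj_im, neg_neg]
  have hre : (((‖u‖ : ℝ) : ℂ) ^ 2).re = ‖u‖ ^ 2 := by norm_cast
  have him : (((‖u‖ : ℝ) : ℂ) ^ 2).im = 0 := by norm_cast
  simp only [Complex.coe_algebraMap, Complex.add_im, Complex.mul_im, Complex.conj_re,
    Complex.conj_im, hre, him, e2] at e1
  have e3 : z.im * ‖u‖ ^ 2 = -(inner ℂ u f : ℂ).im := by linarith
  have e4 : |z.im| * ‖u‖ ^ 2 ≤ ‖u‖ * ‖f‖ := by
    have : |z.im| * ‖u‖ ^ 2 = |(inner ℂ u f : ℂ).im| := by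
      rw [← abs_neg (inner ℂ u f : ℂ).im, ← e3, abs_mul, abs_of_nonneg (sq_nonneg ‖u‖)]
    rw [this]
    exact (Complex.abs_im_le_norm _).trans (norm_inner_le_norm u f)
  rcases (norm_nonneg u).eq_or_lt with h0 | h0
  · rw [← h0]; simp
  · refine le_of_mul_le_mul_left ?_ h0
    linarith [e4, sq ‖u‖, mul_comm ‖u‖ (|z.im| * ‖u‖)]

theorem eq_zero (h : IsBoundaryPair C S) {u : H} {z : ℂ} (hz : z.im ≠ 0) {a b : Fin 2 → ℂ}
    (h1 : (u, z • u, a, b) ∈ R.rel) (hab : C *ᵥ a + S *ᵥ b = 0) : u = 0 ∧ a = 0 ∧ b = 0 := by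
  have h2 := norm_le (f := (0 : H)) (z := z) h (by rwa [add_zero]) hab
  rw [norm_zero] at h2
  have hu : u = 0 := by
    rw [← norm_le_zero_iff]
    exact le_of_mul_le_mul_left (by simpa using h2) (abs_pos.2 hz)
  subst hu
  exact ⟨rfl, (R.zero h1).2⟩

/-- The resolvent as a bounded operator. -/
theorem exists_resolvent (h : IsBoundaryPair C S) {z : ℂ} (hz : z.im ≠ 0)
    (hs : R.Solvable C S z) :
    ∃ A : H →L[ℂ] H, (∀ f u, (∃ a b, (u, z • u + f, a, b) ∈ R.rel ∧ C *ᵥ a + S *ᵥ b = 0) ↔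
      u = A f) ∧ ∀ f, ‖A f‖ ≤ |z.im|⁻¹ * ‖f‖ := by
  have huniq : ∀ f u u', (∃ a b, (u, z • u + f, a, b) ∈ R.rel ∧ C *ᵥ a + S *ᵥ b = 0) →
      (∃ a b, (u', z • u' + f, a, b) ∈ R.rel ∧ C *ᵥ a + S *ᵥ b = 0) → u = u' := by
    rintro f u u' ⟨a, b, h1, hab⟩ ⟨a', b', h2, hab'⟩
    have h3 := R.rel.sub_mem h1 h2
    simp only [Prod.mk_sub_mk] at h3
    have h4 := eq_zero h hz (u := u - u') (a := a - a') (b := b - b')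
      (by convert h3 using 3; module) (by
        rw [Matrix.mulVec_sub, Matrix.mulVec_sub,
          show C *ᵥ a - C *ᵥ a' + (S *ᵥ b - S *ᵥ b') =
            (C *ᵥ a + S *ᵥ b) - (C *ᵥ a' + S *ᵥ b') by abel, hab, hab', sub_zero])
    exact sub_eq_zero.1 h4.1
  have hex : ∀ f, ∃ u, ∃ a b, (u, z • u + f, a, b) ∈ R.rel ∧ C *ᵥ a + S *ᵥ b = 0 :=
    fun f => hs f 0
  choose A hA using hex
  have hb : ∀ f, ‖A f‖ ≤ |z.im|⁻¹ * ‖f‖ := fun f => by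
    obtain ⟨a, b, h1, hab⟩ := hA f
    rw [← div_eq_inv_mul, le_div_iff₀ (abs_pos.2 hz), mul_comm]
    exact norm_le h h1 hab
  let L : H →ₗ[ℂ] H :=
    { toFun := A
      map_add' := fun f f' => by
        refine huniq (f + f') _ _ (hA _) ?_
        obtain ⟨a, b, h1, hab⟩ := hA f
        obtain ⟨a', b', h2, hab'⟩ := hA f'
        refine ⟨a + a', b + b', ?_, ?_⟩
        · have := R.rel.add_mem h1 h2
          simp only [Prod.mk_add_mk] at this
          convert this using 3; module
        · rw [Matrix.mulVec_add, Matrix.mulVec_add,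
            show C *ᵥ a + C *ᵥ a' + (S *ᵥ b + S *ᵥ b') =
            (C *ᵥ a + S *ᵥ b) + (C *ᵥ a' + S *ᵥ b') by abel, hab, hab', add_zero]
      map_smul' := fun c f => by
        refine huniq (c • f) _ _ (hA _) ?_
        obtain ⟨a, b, h1, hab⟩ := hA f
        refine ⟨c • a, c • b, ?_, ?_⟩
        · have := R.rel.smul_mem c h1
          rwa [Prod.smul_mk, Prod.smul_mk, Prod.smul_mk, smul_add, smul_comm c z (A f)] at this
        · rw [Matrix.mulVec_smul, Matrix.mulVec_smul, ← smul_add, hab, smul_zero] }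
  refine ⟨L.mkContinuous _ hb, fun f u => ⟨fun hu => huniq f _ _ hu (hA f), ?_⟩, hb⟩
  rintro rfl
  exact hA f

/-- Solvability passes from the Dirichlet condition to every self-adjoint boundary condition. -/
theorem Solvable.of_dirichlet (h : IsBoundaryPair C S) {z : ℂ} (hz : z.im ≠ 0)
    (hs : R.Solvable 1 0 z) : R.Solvable C S z := by
  simp only [Solvable, Matrix.one_mulVec, Matrix.zero_mulVec, add_zero] at hs
  choose w a' b' hw ha' using fun j : Fin 2 => hs 0 (Pi.single j 1)
  simp only [add_zero] at hw
  -- `L` maps Dirichlet data `c` to the value of `C a + S b` for the homogeneous solution with `a =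
  -- c`. A kernel element would be an eigenvector with a nonreal eigenvalue, so `L` is injective,
  -- and surjective by equality of dimensions.
  let L : (Fin 2 → ℂ) →ₗ[ℂ] (Fin 2 → ℂ) :=
    C.mulVecLin + S.mulVecLin ∘ₗ Fintype.linearCombination ℂ b'
  have hmem : ∀ c : Fin 2 → ℂ, (∑ j, c j • w j, z • ∑ j, c j • w j, c, ∑ j, c j • b' j) ∈
      R.rel := by
    intro c
    have := R.rel.sum_mem (t := Finset.univ) fun j _ => R.rel.smul_mem (c j) (hw j)
    convert this using 1
    simp only [ha', Fin.sum_univ_two, Prod.smul_mk, Prod.mk_add_mk, Prod.mk.injEq, true_and,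
      and_true]
    refine ⟨by module, ?_⟩
    ext i; fin_cases i <;> simp
  have hinj : Function.Injective L := by
    rw [← LinearMap.ker_eq_bot, LinearMap.ker_eq_bot']
    intro c hc
    exact (eq_zero h hz (hmem c) (by simpa [L, Fintype.linearCombination_apply] using hc)).2.1
  have hsurj := LinearMap.injective_iff_surjective.1 hinj
  intro f v
  obtain ⟨u, a, b, h1, ha⟩ := hs f 0
  obtain ⟨c, hc⟩ := hsurj (v - (C *ᵥ a + S *ᵥ b))
  refine ⟨u + ∑ j, c j • w j, a + c, b + ∑ j, c j • b' j, ?_, ?_⟩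
  · have := R.rel.add_mem h1 (hmem c)
    simp only [Prod.mk_add_mk] at this
    convert this using 3
    module
  · have : C *ᵥ c + S *ᵥ (∑ j, c j • b' j) = v - (C *ᵥ a + S *ᵥ b) := by
      rw [← hc]; simp [L, Fintype.linearCombination_apply]
    rw [Matrix.mulVec_add, Matrix.mulVec_add,
      show C *ᵥ a + C *ᵥ c + (S *ᵥ b + S *ᵥ (∑ j, c j • b' j)) =
        (C *ᵥ a + S *ᵥ b) + (C *ᵥ c + S *ᵥ (∑ j, c j • b' j)) by abel, this]
    abel

variable (R) in
/-- The relation with a bounded symmetric operator added. -/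
def perturb (Q : H →L[ℂ] H) (hQ : ∀ u w, inner ℂ (Q u) w = inner ℂ u (Q w)) :
    BoundaryRelation H where
  rel :=
    { carrier := {p | (p.1, p.2.1 - Q p.1, p.2.2) ∈ R.rel}
      add_mem' := fun {p q} hp hq => by
        have := R.rel.add_mem hp hq
        simp only [Prod.mk_add_mk] at this
        simp only [mem_ofPred_eq, Prod.fst_add, Prod.snd_add, map_add]
        convert this using 3
        abel
      zero_mem' := by
        simp only [mem_ofPred_eq, Prod.fst_zero, Prod.snd_zero, map_zero, sub_zero]
        exact R.rel.zero_mem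
      smul_mem' := fun c p hp => by
        have := R.rel.smul_mem c hp
        simp only [Prod.smul_mk] at this
        simp only [mem_ofPred_eq, Prod.smul_fst, Prod.smul_snd, map_smul]
        convert this using 3
        rw [smul_sub] }
  green := by
    intro u g a b w h c d h1 h2
    have := R.green (u := u) (g := g - Q u) (a := a) (b := b) (w := w) (h := h - Q w) (c := c)
      (d := d) h1 h2
    rw [← this, inner_sub_left, inner_sub_right, hQ]
    ring
  zero := by
    intro g a b h1
    have := R.zero (g := g - Q 0) (a := a) (b := b) h1
    simpa using this

theorem mem_perturb {Q : H →L[ℂ] H} {hQ : ∀ u w, inner ℂ (Q u) w = inner ℂ u (Q w)}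
    {u g : H} {a b : Fin 2 → ℂ} :
    (u, g, a, b) ∈ (R.perturb Q hQ).rel ↔ (u, g - Q u, a, b) ∈ R.rel := Iff.rfl

/-- With `A` the unperturbed resolvent and `u₀` the unperturbed solution, the perturbed problem
reads `u = u₀ - A Q u`. The resolvent bound gives `‖A Q‖ ≤ ‖Q‖ / |Im z| < 1`, so `1 + A Q` is
invertible. -/
theorem Solvable.perturb [CompleteSpace H] (h : IsBoundaryPair C S) {z : ℂ} (hz : z.im ≠ 0)
    (hs : R.Solvable C S z) (Q : H →L[ℂ] H) (hQ : ∀ u w, inner ℂ (Q u) w = inner ℂ u (Q w))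
    (hn : ‖Q‖ < |z.im|) : (R.perturb Q hQ).Solvable C S z := by
  obtain ⟨A, hA, hAb⟩ := exists_resolvent h hz hs
  have hpos := abs_pos.2 hz
  have hAQ : ‖-(A ∘L Q)‖ < 1 := by
    rw [norm_neg]
    refine (ContinuousLinearMap.opNorm_comp_le _ _).trans_lt ?_
    have h1 : ‖A‖ ≤ |z.im|⁻¹ := ContinuousLinearMap.opNorm_le_bound _ (by positivity) hAb
    calc ‖A‖ * ‖Q‖ ≤ |z.im|⁻¹ * ‖Q‖ := by gcongr
      _ < |z.im|⁻¹ * |z.im| := by gcongr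
      _ = 1 := inv_mul_cancel₀ hpos.ne'
  have hunit := isUnit_one_sub_of_norm_lt_one hAQ
  obtain ⟨B, hB⟩ := hunit.exists_right_inv
  intro f v
  obtain ⟨u₀, a₀, b₀, h0, hv⟩ := hs f v
  set u := B u₀ with hu
  have e : u = u₀ + A (-Q u) := by
    have := congrArg (fun T : H →L[ℂ] H => T u₀) hB
    have : u + A (Q u) = u₀ := by
      rw [← sub_neg_eq_add]; exact this
    rw [map_neg, ← sub_eq_add_neg, ← this]
    abel
  obtain ⟨a, b, h1, hab⟩ := (hA (-Q u) _).2 rfl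
  refine ⟨u, a₀ + a, b₀ + b, ?_, ?_⟩
  · rw [mem_perturb]
    have := R.rel.add_mem h0 h1
    simp only [Prod.mk_add_mk, ← e] at this
    convert this using 3
    have e' : A (-Q u) = u - u₀ := by rw [eq_sub_iff_add_eq', ← e]
    rw [e']; module
  · rw [Matrix.mulVec_add, Matrix.mulVec_add,
      show C *ᵥ a₀ + C *ᵥ a + (S *ᵥ b₀ + S *ᵥ b) =
      (C *ᵥ a₀ + S *ᵥ b₀) + (C *ᵥ a + S *ᵥ b) by abel, hab, hv, add_zero]

end BoundaryRelation

/-! ### The maximal relation of `-ε d²/dx²` on the half-line -/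

theorem halfLine_eq_restrict_Ici : halfLine = volume.restrict (Ici (0 : ℝ)) :=
  Measure.restrict_congr_set Ioi_ae_eq_Ici

/-- Continuity turns vanishing almost everywhere into vanishing everywhere, and Lebesgue
differentiation then kills the integrand. Applied twice, it shows that an `L²` class determines its
image and boundary values in `freeRelation`. -/
theorem IsPrimitive.eq_zero_of_ae {p a : ℝ → ℂ} (h : IsPrimitive p a)
    (hp : p =ᵐ[halfLine] fun _ => 0) : (∀ x, 0 ≤ x → p x = 0) ∧ a =ᵐ[halfLine] fun _ => 0 := by
  have h0 : ∀ x, 0 ≤ x → p x = 0 := by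
    rw [halfLine_eq_restrict_Ici] at hp
    have := Measure.eqOn_of_ae_eq hp h.continuousOn continuousOn_const
      (by rw [interior_Ici, closure_Ioi])
    exact fun x hx => this hx
  refine ⟨h0, (ae_restrict_iff' measurableSet_Ioi).2 ?_⟩
  have h1 : ∀ n : ℕ, ∀ᵐ y : ℝ, y ∈ uIcc (0 : ℝ) n → ∀ c ∈ uIcc (0 : ℝ) n,
      HasDerivAt (fun x => ∫ t in c..x, a t) (a y) y :=
    fun n => (h.locInt n n.cast_nonneg).ae_hasDerivAt_integral
  filter_upwards [ae_all_iff.2 h1] with y hy hy0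
  have hy0 : 0 < y := hy0
  obtain ⟨n, hn⟩ := exists_nat_ge y
  have h2 := hy n (by rw [uIcc_of_le n.cast_nonneg]; exact ⟨hy0.le, hn⟩) 0 left_mem_uIcc
  refine h2.unique ((hasDerivAt_const y (0 : ℂ)).congr_of_eventuallyEq ?_)
  filter_upwards [Ioi_mem_nhds hy0] with x hx
  have hx : 0 < x := hx
  have := h.eq x hx.le
  rw [h0 x hx.le, h0 0 le_rfl, zero_add] at this
  exact this.symm

/-- The Hilbert space `L²((0, ∞); ℂ²)`. -/
abbrev L2Space : Type := PiLp 2 fun _ : Fin 2 => Lp ℂ 2 halfLine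

theorem inner_L2Space (u w : L2Space) {U W : Fin 2 → ℝ → ℂ} (hu : ∀ i, u i =ᵐ[halfLine] U i)
    (hw : ∀ i, w i =ᵐ[halfLine] W i) :
    inner ℂ u w = ∑ i, ∫ t, conj (U i t) * W i t ∂halfLine := by
  rw [PiLp.inner_apply]
  refine Finset.sum_congr rfl fun i _ => ?_
  rw [L2.inner_def]
  refine integral_congr_ae ?_
  filter_upwards [hu i, hw i] with t h1 h2
  rw [h1, h2, RCLike.inner_apply, mul_comm]

/-- The elements of `L2Space` with given components. -/
def mkL2 (V : Fin 2 → ℝ → ℂ) (hV : ∀ i, MemLp (V i) 2 halfLine) : L2Space :=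
  WithLp.toLp 2 fun i => (hV i).toLp (V i)

theorem coeFn_mkL2 (V : Fin 2 → ℝ → ℂ) (hV : ∀ i, MemLp (V i) 2 halfLine) (i : Fin 2) :
    mkL2 V hV i =ᵐ[halfLine] V i := (hV i).coeFn_toLp

theorem L2Space.ext {u w : L2Space} (h : ∀ i, u i =ᵐ[halfLine] w i) : u = w :=
  PiLp.ext fun i => Lp.ext (h i)

theorem coeFn_add_L2 (u w : L2Space) (i : Fin 2) :
    (u + w) i =ᵐ[halfLine] fun t => u i t + w i t := Lp.coeFn_add (u i) (w i)

theorem coeFn_sub_L2 (u w : L2Space) (i : Fin 2) :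
    (u - w) i =ᵐ[halfLine] fun t => u i t - w i t := Lp.coeFn_sub (u i) (w i)

theorem coeFn_smul_L2 (c : ℂ) (u : L2Space) (i : Fin 2) :
    (c • u) i =ᵐ[halfLine] fun t => c * u i t := Lp.coeFn_smul c (u i)

theorem coeFn_zero_L2 (i : Fin 2) : (0 : L2Space) i =ᵐ[halfLine] fun _ => 0 :=
  Lp.coeFn_zero ℂ 2 halfLine

/-- The maximal relation of `-ε d²/dx²` with the boundary maps `u(0)` and `ε u'(0)`. -/
def freeRelation : BoundaryRelation L2Space where
  rel :=
    -- In `Fin 2` the index `i + 1` is the other index, so the shift implements `ε`.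
    { carrier := {p | ∃ V V' G : Fin 2 → ℝ → ℂ, (∀ i, IsSobolev (V i) (V' i) (G i)) ∧
        (∀ i, p.1 i =ᵐ[halfLine] V i) ∧ (∀ i, p.2.1 i =ᵐ[halfLine] fun t => -G (i + 1) t) ∧
        (∀ i, p.2.2.1 i = V i 0) ∧ ∀ i, p.2.2.2 i = V' (i + 1) 0}
      add_mem' := by
        rintro p q ⟨V, V', G, h1, h2, h3, h4, h5⟩ ⟨W, W', K, k1, k2, k3, k4, k5⟩
        refine ⟨_, _, _, fun i => (h1 i).add (k1 i), fun i => ?_, fun i => ?_, fun i => ?_,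
          fun i => ?_⟩
        · filter_upwards [h2 i, k2 i, coeFn_add_L2 p.1 q.1 i] with t e1 e2 e3
          rw [Prod.fst_add, e3, e1, e2]
        · filter_upwards [h3 i, k3 i, coeFn_add_L2 p.2.1 q.2.1 i] with t e1 e2 e3
          rw [Prod.snd_add, Prod.fst_add, e3, e1, e2]; ring
        · simp [h4, k4]
        · simp [h5, k5]
      zero_mem' := by
        have h0 : IsSobolev (fun _ => 0) (fun _ => 0) (fun _ => 0) :=
          ⟨⟨by simp, by simp⟩, ⟨by simp, by simp⟩, MemLp.zero, MemLp.zero⟩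
        refine ⟨_, _, _, fun _ => h0, fun i => coeFn_zero_L2 i, fun i => ?_, by simp, by simp⟩
        simpa using coeFn_zero_L2 i
      smul_mem' := by
        rintro c p ⟨V, V', G, h1, h2, h3, h4, h5⟩
        refine ⟨_, _, _, fun i => (h1 i).const_mul c, fun i => ?_, fun i => ?_, fun i => ?_,
          fun i => ?_⟩
        · filter_upwards [h2 i, coeFn_smul_L2 c p.1 i] with t e1 e3
          rw [Prod.smul_fst, e3, e1]
        · filter_upwards [h3 i, coeFn_smul_L2 c p.2.1 i] with t e1 e3
          rw [Prod.smul_snd, Prod.smul_fst, e3, e1]; ring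
        · simp [h4]
        · simp [h5] }
  green := by
    rintro u g a b w h c d ⟨V, V', G, h1, h2, h3, h4, h5⟩ ⟨W, W', K, k1, k2, k3, k4, k5⟩
    dsimp only at h2 h3 h4 h5 k2 k3 k4 k5
    have I1 : ∀ i j, Integrable (fun t => conj (V i t) * K j t) halfLine := fun i j =>
      integrable_mul_of_memLp (memLp_conj (h1 i).memLp) (k1 j).memLp_snd
    have I2 : ∀ i j, Integrable (fun t => conj (G i t) * W j t) halfLine := fun i j =>
      integrable_mul_of_memLp (memLp_conj (h1 i).memLp_snd) (k1 j).memLp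
    have gr : ∀ i j, ∫ t, conj (V i t) * K j t ∂halfLine - ∫ t, conj (G i t) * W j t ∂halfLine =
        conj (V' i 0) * W j 0 - conj (V i 0) * W' j 0 := fun i j => by
      rw [← integral_sub (I1 i j) (I2 i j)]
      exact (h1 i).conjugate.green (k1 j)
    rw [inner_L2Space u h h2 k3, inner_L2Space g w h3 k2]
    simp only [dotProduct, Fin.sum_univ_two, Pi.star_apply, h4, h5, k4, k5, mul_neg, map_neg,
      neg_mul, integral_neg, Fin.isValue, zero_add, Fin.reduceAdd,
      ← starRingEnd_apply]
    linear_combination (-1 : ℂ) * gr 0 1 + (-1 : ℂ) * gr 1 0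
  zero := by
    rintro g a b ⟨V, V', G, h1, h2, h3, h4, h5⟩
    dsimp only at h2 h3 h4 h5
    have hV : ∀ i, V i =ᵐ[halfLine] fun _ => 0 := fun i => (h2 i).symm.trans (coeFn_zero_L2 i)
    have e1 := fun i => (h1 i).prim.eq_zero_of_ae (hV i)
    have e2 := fun i => (h1 i).prim'.eq_zero_of_ae (e1 i).2
    refine ⟨L2Space.ext fun i => ?_, funext fun i => ?_, funext fun i => ?_⟩
    · filter_upwards [h3 i, (e2 (i + 1)).2, coeFn_zero_L2 i] with t t1 t2 t3
      rw [t1, t2, t3, neg_zero]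
    · rw [h4, (e1 i).1 0 le_rfl]; rfl
    · rw [h5, (e2 _).1 0 le_rfl]; rfl

theorem mem_freeRelation {u g : L2Space} {a b : Fin 2 → ℂ} :
    (u, g, a, b) ∈ freeRelation.rel ↔
      ∃ V V' G : Fin 2 → ℝ → ℂ, (∀ i, IsSobolev (V i) (V' i) (G i)) ∧
        (∀ i, u i =ᵐ[halfLine] V i) ∧ (∀ i, g i =ᵐ[halfLine] fun t => -G (i + 1) t) ∧
        (∀ i, a i = V i 0) ∧ ∀ i, b i = V' (i + 1) 0 := Iff.rfl

theorem mem_freeRelation_of_components {v v' g w w' h : ℝ → ℂ} (hv : IsSobolev v v' g)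
    (hw : IsSobolev w w' h) {u k : L2Space} (hu0 : u 0 =ᵐ[halfLine] v) (hu1 : u 1 =ᵐ[halfLine] w)
    (hk0 : k 0 =ᵐ[halfLine] fun t => -h t) (hk1 : k 1 =ᵐ[halfLine] fun t => -g t) :
    (u, k, ![v 0, w 0], ![w' 0, v' 0]) ∈ freeRelation.rel := by
  refine mem_freeRelation.2 ⟨![v, w], ![v', w'], ![g, h], ?_, ?_, ?_, ?_, ?_⟩
  · intro i; fin_cases i <;> assumption
  · intro i; fin_cases i <;> assumption
  · intro i; fin_cases i <;> assumption
  · intro i; fin_cases i <;> rfl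
  · intro i; fin_cases i <;> rfl

theorem exists_sq_eq_of_im_ne_zero {w : ℂ} (hw : w.im ≠ 0) : ∃ κ : ℂ, 0 < κ.re ∧ κ ^ 2 = w := by
  obtain ⟨s, hs⟩ := IsAlgClosed.exists_pow_nat_eq w (n := 2) two_pos
  have hre : s.re ≠ 0 := by
    intro h
    apply hw
    rw [← hs, sq, Complex.mul_im, h]
    ring
  rcases lt_or_gt_of_ne hre with h | h
  · exact ⟨-s, by simpa using h, by rw [neg_sq, hs]⟩
  · exact ⟨s, h, hs⟩

/-- Sum and difference of the components diagonalise `ε`: `p = u₀ + u₁` and `q = u₀ - u₁` solve `p''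
= -z p - (f₀ + f₁)` and `q'' = z q - (f₁ - f₀)`. For nonreal `z` both `-z` and `z` have square roots
with positive real part, so the opposite signs of the two channels do no harm. -/
theorem freeRelation_solvable {z : ℂ} (hz : z.im ≠ 0) : freeRelation.Solvable 1 0 z := by
  intro f v
  obtain ⟨κ, hκ, hκ2⟩ := exists_sq_eq_of_im_ne_zero (w := -z) (by simpa using hz)
  obtain ⟨ν, hν, hν2⟩ := exists_sq_eq_of_im_ne_zero hz
  have hf : ∀ i, MemLp (f i) 2 halfLine := fun i => Lp.memLp (f i)
  obtain ⟨p, p', hp, hp0⟩ := IsSobolev.exists_dirichlet hκ (v 0 + v 1) ((hf 0).add (hf 1))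
  obtain ⟨q, q', hq, hq0⟩ := IsSobolev.exists_dirichlet hν (v 0 - v 1) ((hf 1).sub (hf 0))
  have k0 := ((hp.add hq).const_mul (1 / 2)).congr_snd
    (h := fun t => (1 / 2) * (-z * p t - (f 0 t + f 1 t) + (z * q t - (f 1 t - f 0 t))))
    (fun t _ => by simp only [hκ2, hν2, Pi.add_apply, Pi.sub_apply])
  have k1 := ((hp.add (hq.const_mul (-1))).const_mul (1 / 2)).congr_snd
    (h := fun t => (1 / 2) * (-z * p t - (f 0 t + f 1 t) + (-1) * (z * q t - (f 1 t - f 0 t))))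
    (fun t _ => by simp only [hκ2, hν2, Pi.add_apply, Pi.sub_apply])
  let V : Fin 2 → ℝ → ℂ :=
    ![fun t => (1 / 2) * (p t + q t), fun t => (1 / 2) * (p t + (-1) * q t)]
  have hV : ∀ i, MemLp (V i) 2 halfLine := by
    intro i; fin_cases i
    · exact k0.memLp
    · exact k1.memLp
  have e : ∀ i, (z • mkL2 V hV + f) i =ᵐ[halfLine] fun t => z * V i t + f i t := fun i => by
    filter_upwards [coeFn_add_L2 (z • mkL2 V hV) f i, coeFn_smul_L2 z (mkL2 V hV) i,
      coeFn_mkL2 V hV i] with t e1 e2 e3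
    rw [e1, e2, e3]
  refine ⟨mkL2 V hV, _, _, mem_freeRelation_of_components k0 k1 (coeFn_mkL2 V hV 0)
    (coeFn_mkL2 V hV 1) ?_ ?_, ?_⟩
  · filter_upwards [e 0] with t e1
    rw [e1]; simp [V]; ring
  · filter_upwards [e 1] with t e1
    rw [e1]; simp [V]; ring
  · ext i
    fin_cases i
    · simp [hp0, hq0]; ring
    · simp [hp0, hq0]; ring

/-- Testing against the decaying exponential solutions. -/
theorem norm_boundary_le {u g : L2Space} {a b : Fin 2 → ℂ} (h : (u, g, a, b) ∈ freeRelation.rel)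
    {κ : ℂ} (hκ : 0 < κ.re) {s : ℝ} (hs : s * s = 1) :
    ‖(b 0 + s * b 1) + s * κ * (a 0 + s * a 1)‖ ≤
      (Real.sqrt κ.re)⁻¹ * ‖g + (s * κ ^ 2) • u‖ := by
  -- The test function is `exp(-νx)(1, s)` with `ν = conj κ`, the inner product being
  -- conjugate-linear in its first argument. The free expression multiplies it by `-s ν²`, and its
  -- norm is `(Re κ)^(-1/2)`, the factor in the bound.
  have hκ' : 0 < (conj κ).re := by simpa using hκ
  have hs' : (s : ℂ) * s = 1 := by exact_mod_cast hs
  set ν := conj κ with hν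
  have hE := IsSobolev.exp hκ'
  let V : Fin 2 → ℝ → ℂ := ![fun x => 1 * Complex.exp (-ν * x), fun x => s * Complex.exp (-ν * x)]
  have hV : ∀ i, MemLp (V i) 2 halfLine := by
    intro i; fin_cases i
    · exact (hE.const_mul 1).memLp
    · exact (hE.const_mul s).memLp
  set w := mkL2 V hV with hwdef
  have hw : (w, -(s * ν ^ 2) • w, ![1, (s : ℂ)], (-(s * ν)) • ![1, (s : ℂ)]) ∈
      freeRelation.rel := by
    have e : ∀ i, (-(s * ν ^ 2) • w) i =ᵐ[halfLine] fun t => -(s * ν ^ 2) * V i t := fun i => by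
      filter_upwards [coeFn_smul_L2 (-(s * ν ^ 2)) w i, coeFn_mkL2 V hV i] with t e2 e3
      rw [e2, e3]
    convert mem_freeRelation_of_components (hE.const_mul 1) (hE.const_mul s) (u := w)
      (k := -(s * ν ^ 2) • w) (coeFn_mkL2 V hV 0) (coeFn_mkL2 V hV 1) ?_ ?_ using 4
    · simp
    · ext i; fin_cases i
      · simp
      · simp; linear_combination ν * hs'
    · filter_upwards [e 0] with t e1
      rw [e1]; simp [V]; ring
    · filter_upwards [e 1] with t e1
      rw [e1]; simp [V]; linear_combination (ν ^ 2 * Complex.exp (-(ν * t))) * hs'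
  have gr := freeRelation.green hw h
  have e1 : inner ℂ w (g + (s * κ ^ 2) • u) =
      (b 0 + s * b 1) + s * κ * (a 0 + s * a 1) := by
    have e2 : (conj (-((s : ℂ) * ν ^ 2))) = -(s * κ ^ 2) := by simp [hν]
    rw [inner_smul_left, e2] at gr
    rw [inner_add_right, inner_smul_right]
    have e3 : star ![(1 : ℂ), (s : ℂ)] ⬝ᵥ b - star ((-((s : ℂ) * ν)) • ![(1 : ℂ), (s : ℂ)]) ⬝ᵥ a =
        (b 0 + s * b 1) + s * κ * (a 0 + s * a 1) := by
      simp [dotProduct, Fin.sum_univ_two, hν]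
      ring
    rw [← e3, ← gr]; ring
  have hn : ‖w‖ = (Real.sqrt κ.re)⁻¹ := by
    have h1 : inner ℂ w w = (((κ.re)⁻¹ : ℝ) : ℂ) := by
      rw [inner_L2Space w w (coeFn_mkL2 V hV) (coeFn_mkL2 V hV), Fin.sum_univ_two]
      have e2 : ∀ c : ℂ, conj c * c = 1 → ∫ t : ℝ, conj (c * Complex.exp (-ν * t)) *
          (c * Complex.exp (-ν * t)) ∂halfLine = ((1 / (2 * κ.re) : ℝ) : ℂ) := by
        intro c hc
        have := (IsSobolev.memLp_exp hκ').2
        rw [show (conj κ).re = κ.re from Complex.conj_re κ] at this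
        rw [← this, ← integral_complex_ofReal]
        refine integral_congr_ae (Eventually.of_forall fun t => ?_)
        simp only [Complex.ofReal_pow]
        rw [← Complex.conj_mul', map_mul]
        linear_combination (conj (Complex.exp (-ν * t)) * Complex.exp (-ν * t)) * hc
      simp only [V, Matrix.cons_val_zero, Matrix.cons_val_one]
      rw [e2 1 (by simp), e2 s (by simpa using hs')]
      have : κ.re ≠ 0 := hκ.ne'
      norm_cast
      field_simp
      norm_num
    rw [inner_self_eq_norm_sq_to_K] at h1
    have h2 : ‖w‖ ^ 2 = (κ.re)⁻¹ := by
      refine Complex.ofReal_injective ?_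
      rw [Complex.ofReal_pow]
      exact h1
    rw [← Real.sqrt_inv, ← h2, Real.sqrt_sq (norm_nonneg _)]
  rw [← e1, ← hn]
  exact norm_inner_le_norm _ _

/-! ### The potential as a bounded symmetric operator -/

/-- Multiplication by a bounded Hermitian matrix function. -/
theorem exists_multiplication {Q : ℝ → Matrix (Fin 2) (Fin 2) ℂ}
    (hm : ∀ i j, Measurable fun x => Q x i j) (hherm : ∀ x, (Q x).IsHermitian)
    {K : ℝ} (hK : ∀ x i j, ‖Q x i j‖ ≤ K) :
    ∃ T : L2Space →L[ℂ] L2Space, (∀ u w, inner ℂ (T u) w = inner ℂ u (T w)) ∧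
      ∀ (u : L2Space) (V : Fin 2 → ℝ → ℂ), (∀ i, u i =ᵐ[halfLine] V i) →
        ∀ i, T u i =ᵐ[halfLine] fun t => ∑ j, Q t i j * V j t := by
  have hmem : ∀ (u : L2Space) i, MemLp (fun t => ∑ j, Q t i j * u j t) 2 halfLine := by
    intro u i
    refine memLp_finsetSum _ fun j _ => ?_
    refine MemLp.of_le_mul (c := K) (Lp.memLp (u j))
      ((hm i j).aestronglyMeasurable.mul (Lp.aestronglyMeasurable _)) ?_
    refine Eventually.of_forall fun t => ?_
    rw [norm_mul]
    exact mul_le_mul_of_nonneg_right (hK t i j) (norm_nonneg _)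
  let T : L2Space →ₗ[ℂ] L2Space :=
    { toFun := fun u => mkL2 _ (hmem u)
      map_add' := fun u w => L2Space.ext fun i => by
        filter_upwards [coeFn_mkL2 _ (hmem (u + w)) i, coeFn_mkL2 _ (hmem u) i,
          coeFn_mkL2 _ (hmem w) i, coeFn_add_L2 (mkL2 _ (hmem u)) (mkL2 _ (hmem w)) i,
          coeFn_add_L2 u w 0, coeFn_add_L2 u w 1] with t e1 e2 e3 e4 e5 e6
        rw [e4, e1, e2, e3]
        simp only [Fin.sum_univ_two, e5, e6]; ring
      map_smul' := fun c u => L2Space.ext fun i => by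
        filter_upwards [coeFn_mkL2 _ (hmem (c • u)) i, coeFn_mkL2 _ (hmem u) i,
          coeFn_smul_L2 c (mkL2 _ (hmem u)) i,
          coeFn_smul_L2 c u 0, coeFn_smul_L2 c u 1] with t e1 e2 e4 e5 e6
        rw [RingHom.id_apply, e4, e1, e2]
        simp only [Fin.sum_univ_two, e5, e6]; ring }
  have hTc : ∀ u i, T u i =ᵐ[halfLine] fun t => ∑ j, Q t i j * u j t := fun u i =>
    coeFn_mkL2 _ (hmem u) i
  have hI : ∀ (u w : L2Space) i j, Integrable (fun t => conj (Q t i j * u j t) * w i t) halfLine := by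
    intro u w i j
    refine integrable_mul_of_memLp (memLp_conj ?_) (Lp.memLp (w i))
    refine MemLp.of_le_mul (c := K) (Lp.memLp (u j))
      ((hm i j).aestronglyMeasurable.mul (Lp.aestronglyMeasurable _)) ?_
    refine Eventually.of_forall fun t => ?_
    rw [norm_mul]
    exact mul_le_mul_of_nonneg_right (hK t i j) (norm_nonneg _)
  have hsymm : T.IsSymmetric := by
    intro u w
    rw [inner_L2Space (T u) w (hTc u) (fun i => ae_eq_refl _),
      inner_L2Space u (T w) (fun i => ae_eq_refl _) (hTc w)]
    have h1 : ∀ i, ∫ t, conj (∑ j, Q t i j * u j t) * w i t ∂halfLine =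
        ∑ j, ∫ t, conj (Q t i j * u j t) * w i t ∂halfLine := fun i => by
      rw [← integral_finsetSum _ fun j _ => hI u w i j]
      simp only [map_sum, Finset.sum_mul]
    have e : ∀ i j t, conj (u i t) * (Q t i j * w j t) = conj (Q t j i * u i t) * w j t := by
      intro i j t
      have : Q t i j = conj (Q t j i) := ((hherm t).apply i j).symm
      rw [this, map_mul]; ring
    have h2 : ∀ i, ∫ t, conj (u i t) * (∑ j, Q t i j * w j t) ∂halfLine =
        ∑ j, ∫ t, conj (Q t j i * u i t) * w j t ∂halfLine := fun i => by
      rw [← integral_finsetSum _ fun j _ => hI u w j i]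
      simp only [Finset.mul_sum, e]
    simp only [h1, h2]
    rw [Finset.sum_comm]
  -- Hellinger-Toeplitz: a symmetric operator defined on the whole Hilbert space is bounded, so no
  -- norm estimate is needed.
  refine ⟨⟨T, hsymm.continuous⟩, hsymm, fun u V hV i => (hTc u i).trans ?_⟩
  filter_upwards [hV 0, hV 1] with t e1 e2
  simp only [Fin.sum_univ_two, e1, e2]

/-! ### Spectral measures from representations of `C(X)` -/

section Representation

variable {X : Type*} [TopologicalSpace X] {H : Type*} [NormedAddCommGroup H]
  [InnerProductSpace ℂ H] [CompleteSpace H]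

theorem inner_map_star (π : C(X, ℂ) →⋆ₐ[ℂ] (H →L[ℂ] H)) (f : C(X, ℂ)) (u v : H) :
    inner ℂ u (π (star f) v) = inner ℂ (π f u) v := by
  rw [map_star, ContinuousLinearMap.star_eq_adjoint, ContinuousLinearMap.adjoint_inner_right]

/-- A real continuous function, as a complex one. -/
def ofRealMap (f : C(X, ℝ)) : C(X, ℂ) := ⟨fun x => f x, by fun_prop⟩

theorem star_ofRealMap (f : C(X, ℝ)) : star (ofRealMap f) = ofRealMap f := by
  ext x; simp [ofRealMap]

end Representation

section Density

variable {X : Type*} [MetricSpace X] [MeasurableSpace X] [BorelSpace X]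

/-- A density that agrees with a finite positive measure on continuous functions is nonnegative. -/
theorem ae_nonneg_of_integral_eq {μ ν : Measure X} [IsFiniteMeasure μ] [IsFiniteMeasure ν]
    {h : X → ℝ} (hh : Integrable h μ)
    (heq : ∀ f : C(X, ℝ), ∫ x, f x * h x ∂μ = ∫ x, f x ∂ν) : ∀ᵐ x ∂μ, 0 ≤ h x := by
  have f1 := isFiniteMeasure_withDensity_ofReal hh.2
  have f2 := isFiniteMeasure_withDensity_ofReal hh.neg.2
  set A := μ.withDensity fun x => ENNReal.ofReal (h x)
  set B := μ.withDensity fun x => ENNReal.ofReal ((-h) x)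
  have m1 : AEMeasurable (fun x => ENNReal.ofReal (h x)) μ := hh.1.aemeasurable.ennreal_ofReal
  have m2 : AEMeasurable (fun x => ENNReal.ofReal ((-h) x)) μ :=
    hh.neg.1.aemeasurable.ennreal_ofReal
  -- `A` and `B` have the positive and negative parts of `h` as densities. The hypothesis says that
  -- `A` and `B + ν` agree on continuous functions, hence as measures, so `B ≤ A` on every set.
  have hAB : A = B + ν := by
    refine ext_of_forall_integral_eq_of_IsFiniteMeasure fun f => ?_
    have hf : ∀ {g : X → ℝ}, Integrable g μ → Integrable (fun x => g x * f x) μ := fun hg =>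
      hg.mul_bdd (c := ‖f‖) f.continuous.aestronglyMeasurable
        (Eventually.of_forall fun x => f.norm_coe_le_norm x)
    rw [integral_add_measure (f.integrable _) (f.integrable _),
      integral_withDensity_eq_integral_toReal_smul₀ m1
        (Eventually.of_forall fun x => ENNReal.ofReal_lt_top),
      integral_withDensity_eq_integral_toReal_smul₀ m2
        (Eventually.of_forall fun x => ENNReal.ofReal_lt_top), ← sub_eq_iff_eq_add']
    have := heq f.toContinuousMap
    simp only [BoundedContinuousFunction.coe_toContinuousMap] at this
    rw [← this, ← integral_sub]
    · refine integral_congr_ae (Eventually.of_forall fun x => ?_)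
      simp only [ENNReal.toReal_ofReal', smul_eq_mul, Pi.neg_apply]
      rcases le_total 0 (h x) with h0 | h0
      · rw [max_eq_left h0, max_eq_right (by linarith)]; ring
      · rw [max_eq_right h0, max_eq_left (by linarith)]; ring
    · simp only [ENNReal.toReal_ofReal', smul_eq_mul]
      exact hf hh.pos_part
    · simp only [ENNReal.toReal_ofReal', smul_eq_mul]
      exact hf hh.neg.pos_part
  refine ae_nonneg_of_forall_setIntegral_nonneg hh fun s hs _ => ?_
  rw [integral_eq_lintegral_pos_part_sub_lintegral_neg_part hh.integrableOn, sub_nonneg]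
  have e1 : ∫⁻ x in s, ENNReal.ofReal (h x) ∂μ = A s := (withDensity_apply _ hs).symm
  have e2 : ∫⁻ x in s, ENNReal.ofReal (-h x) ∂μ = B s := (withDensity_apply _ hs).symm
  rw [e1, e2]
  refine ENNReal.toReal_mono (measure_ne_top _ _) ?_
  rw [hAB, Measure.add_apply]
  exact le_self_add

variable [CompactSpace X]

theorem integrable_continuousMap_mul {μ : Measure X} {d : X → ℂ} (hd : Integrable d μ)
    (f : C(X, ℂ)) : Integrable (fun x => f x * d x) μ := by
  refine hd.bdd_mul (c := ‖f‖) f.continuous.aestronglyMeasurable ?_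
  exact Eventually.of_forall fun x => f.norm_coe_le_norm x

theorem integrable_continuousMap (μ : Measure X) [IsFiniteMeasure μ] (f : C(X, ℂ)) :
    Integrable (fun x => f x) μ := by
  simpa using integrable_continuousMap_mul (integrable_const (1 : ℂ)) f (μ := μ)

theorem exists_density {μ ν : Measure X} [IsFiniteMeasure μ] [IsFiniteMeasure ν] (h : ν ≪ μ) :
    ∃ d : X → ℝ, Integrable d μ ∧ ∀ f : C(X, ℂ), ∫ x, f x * d x ∂μ = ∫ x, f x ∂ν := by
  refine ⟨fun x => (ν.rnDeriv μ x).toReal, Measure.integrable_toReal_rnDeriv, fun f => ?_⟩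
  rw [← integral_rnDeriv_smul h]
  simp only [Complex.real_smul, mul_comm]

variable {H : Type*} [NormedAddCommGroup H] [InnerProductSpace ℂ H] [CompleteSpace H]

/-- The spectral measure of a vector. -/
theorem exists_scalar_measure (π : C(X, ℂ) →⋆ₐ[ℂ] (H →L[ℂ] H)) (v : H) :
    ∃ ν : Measure X, IsFiniteMeasure ν ∧ ∀ f : C(X, ℂ), ∫ x, f x ∂ν = inner ℂ v (π f v) := by
  let Λ : CompactlySupportedContinuousMap X ℝ →ₗ[ℝ] ℝ :=
    { toFun := fun f => (inner ℂ v (π (ofRealMap f.toContinuousMap) v) : ℂ).re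
      map_add' := fun f g => by
        have : ofRealMap (f + g).toContinuousMap =
            ofRealMap f.toContinuousMap + ofRealMap g.toContinuousMap := by
          ext x; simp [ofRealMap]
        rw [this, map_add, add_apply, inner_add_right, Complex.add_re]
      map_smul' := fun c f => by
        have : ofRealMap (c • f).toContinuousMap = (c : ℂ) • ofRealMap f.toContinuousMap := by
          ext x; simp [ofRealMap]
        rw [this, map_smul, smul_apply, inner_smul_right, Complex.re_ofReal_mul]
        rfl }
  have hpos : ∀ f, 0 ≤ f → 0 ≤ Λ f := by
    intro f hf
    -- Writing `f = g²` with `g` real turns the functional into `‖π(g) v‖²`, which is its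
    -- positivity.
    let g : C(X, ℝ) := ⟨fun x => Real.sqrt (f x), by fun_prop⟩
    have e : ofRealMap f.toContinuousMap = star (ofRealMap g) * ofRealMap g := by
      rw [star_ofRealMap]
      ext x
      have h0 : 0 ≤ f x := hf x
      simp only [ofRealMap, g, ContinuousMap.coe_mk, ContinuousMap.mul_apply]
      rw [← Complex.ofReal_mul, Real.mul_self_sqrt h0]
      rfl
    change 0 ≤ (inner ℂ v (π (ofRealMap f.toContinuousMap) v) : ℂ).re
    rw [e, map_mul, mul_apply_eq_comp, inner_map_star, inner_self_eq_norm_sq_to_K]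
    have : (((‖π (ofRealMap g) v‖ : ℝ) : ℂ) ^ 2).re = ‖π (ofRealMap g) v‖ ^ 2 := by norm_cast
    exact this ▸ sq_nonneg _
  let Λ' := PositiveLinearMap.mk₀ Λ hpos
  refine ⟨RealRMK.rieszMeasure Λ', inferInstance, fun f => ?_⟩
  have hre : ∀ f : C(X, ℝ), ∫ x, (f x : ℂ) ∂(RealRMK.rieszMeasure Λ') =
      inner ℂ v (π (ofRealMap f) v) := by
    intro f
    have h1 := RealRMK.integral_rieszMeasure Λ' ⟨f, HasCompactSupport.of_compactSpace f⟩
    have h2 : (inner ℂ v (π (ofRealMap f) v) : ℂ).im = 0 := by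
      have := inner_map_star π (ofRealMap f) v v
      rw [star_ofRealMap, ← inner_conj_symm (π (ofRealMap f) v)] at this
      exact Complex.conj_eq_iff_im.1 this.symm
    have h3 : ∫ x, (f x : ℂ) ∂(RealRMK.rieszMeasure Λ') =
        ((∫ x, f x ∂(RealRMK.rieszMeasure Λ') : ℝ) : ℂ) := integral_ofReal
    rw [h3]
    refine Complex.ext ?_ ?_
    · rw [Complex.ofReal_re]; exact h1
    · rw [Complex.ofReal_im, h2]
  let p : C(X, ℝ) := ⟨fun x => (f x).re, by fun_prop⟩
  let q : C(X, ℝ) := ⟨fun x => (f x).im, by fun_prop⟩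
  have e : f = ofRealMap p + Complex.I • ofRealMap q := by
    ext x
    simp [ofRealMap, p, q, mul_comm Complex.I, Complex.re_add_im]
  have i1 := integrable_continuousMap (RealRMK.rieszMeasure Λ') (ofRealMap p)
  have i2 := integrable_continuousMap (RealRMK.rieszMeasure Λ') (ofRealMap q)
  rw [e, map_add, map_smul, add_apply, smul_apply,
    inner_add_right, inner_smul_right, ← hre, ← hre, ← integral_const_mul, ← integral_add]
  · rfl
  · exact i1
  · exact i2.const_mul _

/-- The spectral measures of a pair of vectors form a positive semidefinite matrix measure. -/
theorem exists_matrix_density (π : C(X, ℂ) →⋆ₐ[ℂ] (H →L[ℂ] H)) (ψ : Fin 2 → H) :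
    ∃ (μ : Measure X) (D : X → Matrix (Fin 2) (Fin 2) ℂ), IsFiniteMeasure μ ∧
      (∀ x, (D x).PosSemidef) ∧ (∀ i j, Integrable (fun x => D x i j) μ) ∧
      (∀ (f : C(X, ℂ)) i j, ∫ x, f x * D x i j ∂μ = inner ℂ (ψ i) (π f (ψ j))) ∧
      ∀ x₀, (∀ (v : H) (ν : Measure X), IsFiniteMeasure ν →
        (∀ f : C(X, ℂ), ∫ x, f x ∂ν = inner ℂ v (π f v)) → ν {x₀} = 0) → μ {x₀} = 0 := by
  choose N hNf hN using exists_scalar_measure π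
  -- The last four vectors recover the mixed forms `⟨ψ₀, π f ψ₁⟩` and `⟨ψ₁, π f ψ₀⟩` by
  -- polarization. The sum `μ` of the six scalar measures dominates each of them, so all have
  -- densities with respect to it.
  let w : Fin 6 → H := ![ψ 0, ψ 1, ψ 0 + ψ 1, ψ 0 - ψ 1, ψ 0 + Complex.I • ψ 1,
    ψ 0 - Complex.I • ψ 1]
  let μ : Measure X := ∑ k, N (w k)
  have hμf : IsFiniteMeasure μ := inferInstance
  have hac : ∀ k, N (w k) ≪ μ := fun k =>
    (Measure.le_iff'.2 fun s => by
      rw [Measure.finsetSum_apply]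
      exact Finset.single_le_sum (f := fun k => N (w k) s) (fun _ _ => zero_le)
        (Finset.mem_univ k)).absolutelyContinuous
  choose d hd hdi using fun k => exists_density (hac k)
  have hdc : ∀ k, Integrable (fun x => (d k x : ℂ)) μ := fun k => (hd k).ofReal
  have hq : ∀ k (f : C(X, ℂ)), ∫ x, f x * d k x ∂μ = inner ℂ (w k) (π f (w k)) := fun k f => by
    rw [hdi, hN]
  have hqi : ∀ k (f : C(X, ℂ)), Integrable (fun x => f x * d k x) μ := fun k f =>
    integrable_continuousMap_mul (hdc k) f
  let δ : X → ℂ := fun x => (1 / 4) * ((d 2 x : ℂ) - d 3 x - Complex.I * d 4 x + Complex.I * d 5 x)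
  let δ' : X → ℂ := fun x => (1 / 4) * ((d 2 x : ℂ) - d 3 x + Complex.I * d 4 x - Complex.I * d 5 x)
  have hδδ : ∀ x, conj (δ x) = δ' x := fun x => by
    have h4 : conj (4 : ℂ) = 4 := map_ofNat _ 4
    simp [δ, δ', h4]; ring
  have hδi : Integrable δ μ := ((((hdc 2).sub (hdc 3)).sub ((hdc 4).const_mul _)).add
    ((hdc 5).const_mul _)).const_mul _
  have hδi' : Integrable δ' μ := ((((hdc 2).sub (hdc 3)).add ((hdc 4).const_mul _)).sub
    ((hdc 5).const_mul _)).const_mul _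
  let D : X → Matrix (Fin 2) (Fin 2) ℂ := fun x => !![(d 0 x : ℂ), δ x; δ' x, (d 1 x : ℂ)]
  have hDherm : ∀ x, (D x).IsHermitian := by
    intro x
    ext i j
    fin_cases i <;> fin_cases j
    · simp [D]
    · simp only [D, Matrix.conjTranspose_apply, Matrix.of_apply, ← hδδ]
      simp
    · simp only [D, Matrix.conjTranspose_apply, Matrix.of_apply, ← hδδ]
      simp
    · simp [D]
  have hDi : ∀ i j, Integrable (fun x => D x i j) μ := by
    intro i j
    fin_cases i <;> fin_cases j
    · exact hdc 0
    · exact hδi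
    · exact hδi'
    · exact hdc 1
  have hDint : ∀ (f : C(X, ℂ)) i j, ∫ x, f x * D x i j ∂μ = inner ℂ (ψ i) (π f (ψ j)) := by
    intro f i j
    have expand : ∀ s t : ℂ, ∫ x, f x * ((1 / 4) * ((d 2 x : ℂ) - d 3 x + s * d 4 x + t * d 5 x)) ∂μ =
        (1 / 4) * (∫ x, f x * d 2 x ∂μ - ∫ x, f x * d 3 x ∂μ + s * ∫ x, f x * d 4 x ∂μ +
          t * ∫ x, f x * d 5 x ∂μ) := by
      intro s t
      have j4 := (hqi 4 f).const_mul s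
      have j5 := (hqi 5 f).const_mul t
      have j23 : Integrable (fun x => f x * d 2 x - f x * d 3 x) μ := (hqi 2 f).sub (hqi 3 f)
      have j234 : Integrable (fun x => f x * d 2 x - f x * d 3 x + s * (f x * d 4 x)) μ :=
        j23.add j4
      rw [← integral_sub (hqi 2 f) (hqi 3 f), ← integral_const_mul, ← integral_const_mul,
        ← integral_add j23 j4, ← integral_add j234 j5,
        ← integral_const_mul]
      refine integral_congr_ae (Eventually.of_forall fun x => ?_)
      ring
    fin_cases i <;> fin_cases j
    · exact hq 0 f
    · have e := expand (-Complex.I) Complex.I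
      rw [hq, hq, hq, hq] at e
      simp only [w, Matrix.cons_val] at e
      refine (integral_congr_ae (Eventually.of_forall fun x => ?_)).trans (e.trans ?_)
      · change f x * δ x = _
        simp only [δ]; ring
      · change _ = inner ℂ (ψ 0) (π f (ψ 1))
        simp only [map_add, map_sub, map_smul, inner_add_left, inner_add_right, inner_sub_left,
          inner_sub_right, inner_smul_left, inner_smul_right, Complex.conj_I]
        linear_combination (-(1 / 2) * inner ℂ (ψ 0) (π f (ψ 1)) +
          (1 / 2) * inner ℂ (ψ 1) (π f (ψ 0))) * Complex.I_mul_I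
    · have e := expand Complex.I (-Complex.I)
      rw [hq, hq, hq, hq] at e
      simp only [w, Matrix.cons_val] at e
      refine (integral_congr_ae (Eventually.of_forall fun x => ?_)).trans (e.trans ?_)
      · change f x * δ' x = _
        simp only [δ']; ring
      · change _ = inner ℂ (ψ 1) (π f (ψ 0))
        simp only [map_add, map_sub, map_smul, inner_add_left, inner_add_right, inner_sub_left,
          inner_sub_right, inner_smul_left, inner_smul_right, Complex.conj_I]
        linear_combination ((1 / 2) * inner ℂ (ψ 0) (π f (ψ 1)) -
          (1 / 2) * inner ℂ (ψ 1) (π f (ψ 0))) * Complex.I_mul_I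
    · exact hq 1 f
  -- For fixed `c` the quadratic form is a density of the spectral measure of `∑ c_j ψ_j`, hence
  -- nonnegative almost everywhere. The exceptional set depends on `c`, so the conclusion for all
  -- `c` goes through a countable dense family and continuity.
  have hquad : ∀ (c : Fin 2 → ℂ), ∀ᵐ x ∂μ, 0 ≤ (star c ⬝ᵥ (D x *ᵥ c)).re := by
    intro c
    have hexp : ∀ x, star c ⬝ᵥ (D x *ᵥ c) = ∑ i, ∑ j, conj (c i) * c j * D x i j := by
      intro x
      simp only [dotProduct, Matrix.mulVec, Pi.star_apply, Finset.mul_sum, starRingEnd_apply]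
      refine Finset.sum_congr rfl fun i _ => Finset.sum_congr rfl fun j _ => by ring
    have hzi : Integrable (fun x => star c ⬝ᵥ (D x *ᵥ c)) μ := by
      simp only [hexp]
      exact integrable_finsetSum _ fun i _ => integrable_finsetSum _ fun j _ =>
        (hDi i j).const_mul _
    set v := ∑ j, c j • ψ j with hv
    have hz : ∀ f : C(X, ℂ), ∫ x, f x * (star c ⬝ᵥ (D x *ᵥ c)) ∂μ = inner ℂ v (π f v) := by
      intro f
      have I : ∀ i j, Integrable (fun x => conj (c i) * c j * (f x * D x i j)) μ := fun i j =>
        (integrable_continuousMap_mul (hDi i j) f).const_mul _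
      have e1 : ∀ x, f x * (star c ⬝ᵥ (D x *ᵥ c)) =
          ∑ i, ∑ j, conj (c i) * c j * (f x * D x i j) := fun x => by
        rw [hexp]
        simp only [Finset.mul_sum]
        refine Finset.sum_congr rfl fun i _ => Finset.sum_congr rfl fun j _ => by ring
      simp only [e1]
      rw [integral_finsetSum _ fun i _ => integrable_finsetSum _ fun j _ => I i j]
      rw [hv, map_sum, sum_inner]
      refine Finset.sum_congr rfl fun i _ => ?_
      rw [integral_finsetSum _ fun j _ => I i j, inner_sum]
      refine Finset.sum_congr rfl fun j _ => ?_
      rw [integral_const_mul, hDint, map_smul, inner_smul_left, inner_smul_right]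
      ring
    refine ae_nonneg_of_integral_eq (ν := N v) hzi.re fun f => ?_
    have h1 := hz (ofRealMap f)
    rw [← hN] at h1
    have h2 := congrArg Complex.re h1
    have h3 : ∫ x, ofRealMap f x ∂(N v) = ((∫ x, f x ∂(N v) : ℝ) : ℂ) := integral_ofReal
    rw [h3, Complex.ofReal_re] at h2
    rw [← h2]
    have h4 := integral_re (integrable_continuousMap_mul hzi (ofRealMap f))
    refine Eq.trans (integral_congr_ae (Eventually.of_forall fun x => ?_)) h4
    simp only [ofRealMap, ContinuousMap.coe_mk]
    exact (Complex.re_ofReal_mul _ _).symm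
  have hpsd : ∀ᵐ x ∂μ, (D x).PosSemidef := by
    have h1 : ∀ᵐ x ∂μ, ∀ n, 0 ≤ (star (TopologicalSpace.denseSeq (Fin 2 → ℂ) n) ⬝ᵥ
        (D x *ᵥ TopologicalSpace.denseSeq (Fin 2 → ℂ) n)).re :=
      ae_all_iff.2 fun n => hquad _
    filter_upwards [h1] with x hx
    refine Matrix.PosSemidef.of_dotProduct_mulVec_nonneg (hDherm x) fun c => ?_
    have hcl : IsClosed {c : Fin 2 → ℂ | 0 ≤ (star c ⬝ᵥ (D x *ᵥ c)).re} := by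
      refine isClosed_le continuous_const (Complex.continuous_re.comp ?_)
      exact (continuous_star).dotProduct (continuous_const.matrix_mulVec continuous_id)
    have hre : 0 ≤ (star c ⬝ᵥ (D x *ᵥ c)).re := by
      have := hcl.closure_subset_iff.2 (show range (TopologicalSpace.denseSeq (Fin 2 → ℂ)) ⊆ _ by
        rintro _ ⟨n, rfl⟩; exact hx n)
      exact this (TopologicalSpace.denseRange_denseSeq (Fin 2 → ℂ) c)
    have him : (star c ⬝ᵥ (D x *ᵥ c)).im = 0 := by
      have := (hDherm x).im_star_dotProduct_mulVec_self c
      exact this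
    rw [Complex.le_def]
    exact ⟨hre, him.symm⟩
  classical
  -- Semidefiniteness is wanted at every point, so the density is replaced by `0` on the null set
  -- where it fails.
  let D' : X → Matrix (Fin 2) (Fin 2) ℂ := fun x => if (D x).PosSemidef then D x else 0
  have hDD : ∀ᵐ x ∂μ, D' x = D x := by
    filter_upwards [hpsd] with x hx
    simp [D', hx]
  refine ⟨μ, D', hμf, fun x => ?_, fun i j => ?_, fun f i j => ?_, fun x₀ h0 => ?_⟩
  · by_cases hx : (D x).PosSemidef
    · simp [D', hx]
    · simp [D', hx, Matrix.PosSemidef.zero]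
  · exact (hDi i j).congr (hDD.mono fun x hx => (congrFun (congrFun hx i) j).symm)
  · rw [← hDint]
    exact integral_congr_ae (hDD.mono fun x hx => by simp only [hx])
  · rw [Measure.finsetSum_apply]
    exact Finset.sum_eq_zero fun k _ => h0 (w k) _ (hNf _) (hN _)

end Density

/-! ### Cayley transform and Herglotz representation -/

/-- The unit circle in the complex plane. -/
abbrev circ : Set ℂ := Metric.sphere (0 : ℂ) 1

/-- The inclusion of the unit circle. -/
def circCoe : C(circ, ℂ) := ⟨Subtype.val, continuous_subtype_val⟩

variable {H : Type*} [NormedAddCommGroup H] [InnerProductSpace ℂ H] [CompleteSpace H]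

theorem circ_normSq (w : circ) : (w : ℂ) * conj (w : ℂ) = 1 := by
  rw [Complex.mul_conj, Complex.normSq_eq_norm_sq, mem_sphere_zero_iff_norm.1 w.2]
  norm_num

/-- A spectral measure of a unitary operator has no atom at `1` if `U - 1` has dense range. -/
theorem measure_singleton_one_eq_zero (π : C(circ, ℂ) →⋆ₐ[ℂ] (H →L[ℂ] H))
    (hd : DenseRange ⇑(π circCoe - 1)) (v : H) (ν : Measure circ) [IsFiniteMeasure ν]
    (hν : ∀ f : C(circ, ℂ), ∫ x, f x ∂ν = inner ℂ v (π f v)) (x₀ : circ) (hx₀ : (x₀ : ℂ) = 1) :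
    ν {x₀} = 0 := by
  -- `q n` equals `1` at the point `1` and satisfies `q n w · |w - 1| ≤ n^(-1/2)`. Hence `π (q n)`
  -- tends to zero on the range of `U - 1`, and on all vectors since that range is dense and `|q n|
  -- ≤ 1`. The mass at `1` is at most `‖v‖ ‖π (q n) v‖`.
  let q : ℕ → circ → ℝ := fun n w => 1 / (1 + n * ‖(w : ℂ) - 1‖ ^ 2)
  have hpos : ∀ (n : ℕ) (w : circ), 0 < 1 + n * ‖(w : ℂ) - 1‖ ^ 2 := fun n w => by positivity
  have hq1 : ∀ n w, q n w ≤ 1 := fun n w => by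
    rw [div_le_one (hpos n w)]
    nlinarith [mul_nonneg (Nat.cast_nonneg (α := ℝ) n) (sq_nonneg ‖(w : ℂ) - 1‖)]
  have hq0 : ∀ n w, 0 ≤ q n w := fun n w => (div_pos one_pos (hpos n w)).le
  have hqc : ∀ n, Continuous (q n) := fun n => by
    refine continuous_const.div (by fun_prop) fun w => (hpos n w).ne'
  let f : ℕ → C(circ, ℂ) := fun n => ⟨fun w => (q n w : ℂ), Complex.continuous_ofReal.comp (hqc n)⟩
  have hf1 : ∀ n, ‖f n‖ ≤ 1 := fun n => by
    rw [ContinuousMap.norm_le _ zero_le_one]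
    intro w
    change ‖((q n w : ℝ) : ℂ)‖ ≤ 1
    rw [Complex.norm_real, Real.norm_of_nonneg (hq0 n w)]
    exact hq1 n w
  have hf2 : ∀ n : ℕ, 0 < n → ‖f n * (circCoe - 1)‖ ≤ (Real.sqrt n)⁻¹ := fun n hn => by
    rw [ContinuousMap.norm_le _ (by positivity)]
    intro w
    change ‖((q n w : ℝ) : ℂ) * ((w : ℂ) - 1)‖ ≤ _
    rw [norm_mul, Complex.norm_real, Real.norm_of_nonneg (hq0 n w)]
    set r := ‖(w : ℂ) - 1‖
    have hr : 0 ≤ r := norm_nonneg _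
    have hs : 0 < Real.sqrt n := Real.sqrt_pos.2 (by exact_mod_cast hn)
    have hss : Real.sqrt n * Real.sqrt n = n := Real.mul_self_sqrt (Nat.cast_nonneg n)
    change 1 / (1 + n * r ^ 2) * r ≤ _
    rw [one_div, inv_mul_le_iff₀ (hpos n w), ← div_eq_mul_inv, le_div_iff₀ hs]
    change _ ≤ 1 + n * r ^ 2
    have e2 : (n : ℝ) * r ^ 2 = (Real.sqrt n * r) ^ 2 := by
      rw [mul_pow, Real.sq_sqrt (Nat.cast_nonneg n)]
    rw [e2]
    nlinarith [sq_nonneg (Real.sqrt n * r - 1), mul_nonneg hs.le hr]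
  have hle : ∀ n, ν.real {x₀} ≤ ‖v‖ * ‖π (f n) v‖ := fun n => by
    have h1 : ∫ x, f n x ∂ν = ((∫ x, q n x ∂ν : ℝ) : ℂ) := integral_ofReal
    have h2 : ν.real {x₀} ≤ ∫ x, q n x ∂ν := by
      have h3 : ∫ x, indicator {x₀} (fun _ => (1 : ℝ)) x ∂ν = ν.real {x₀} := by
        rw [integral_indicator_const _ (measurableSet_singleton _)]; simp
      rw [← h3]
      refine integral_mono ((integrable_const _).indicator (measurableSet_singleton _)) ?_ ?_
      · exact ((integrable_const (1 : ℝ)).mono' (hqc n).aestronglyMeasurable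
          (Eventually.of_forall fun w => by
            rw [Real.norm_of_nonneg (hq0 n w)]; exact hq1 n w))
      · intro w
        by_cases hw : w = x₀
        · simp [hw, q, hx₀]
        · simp [hw, hq0]
    have h4 : ∫ x, q n x ∂ν ≤ ‖inner ℂ v (π (f n) v)‖ := by
      rw [← hν, h1, Complex.norm_real]
      exact Real.le_norm_self _
    exact h2.trans (h4.trans (norm_inner_le_norm _ _))
  have hlim : Tendsto (fun n => π (f n) v) atTop (𝓝 0) := by
    rw [Metric.tendsto_atTop]
    intro ε hε
    obtain ⟨y, hy⟩ := Metric.denseRange_iff.1 hd v (ε / 2) (by positivity)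
    obtain ⟨N, hN⟩ := exists_nat_gt ((2 * ‖y‖ / ε) ^ 2)
    refine ⟨N + 1, fun n hn => ?_⟩
    rw [dist_zero_right]
    have hn0 : 0 < n := by omega
    have hs : 0 < Real.sqrt n := Real.sqrt_pos.2 (by exact_mod_cast hn0)
    have hb : ‖y‖ * (Real.sqrt n)⁻¹ < ε / 2 := by
      rw [← div_eq_mul_inv, div_lt_iff₀ hs]
      have h1 : 2 * ‖y‖ / ε < Real.sqrt n := by
        refine Real.lt_sqrt_of_sq_lt (hN.trans_le ?_)
        exact_mod_cast (by omega : N ≤ n)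
      rw [div_lt_iff₀ hε] at h1
      linarith
    have hdec : π (f n) v = π (f n) (v - (π circCoe - 1) y) + π (f n * (circCoe - 1)) y := by
      have e : π (circCoe - 1) = π circCoe - 1 := by rw [map_sub, map_one]
      rw [map_mul, e, map_sub]
      exact (sub_add_cancel _ _).symm
    rw [hdec]
    refine (norm_add_le _ _).trans_lt ?_
    have e1 : ‖π (f n) (v - (π circCoe - 1) y)‖ ≤ ‖v - (π circCoe - 1) y‖ :=
      (ContinuousLinearMap.le_opNorm _ _).trans (mul_le_of_le_one_left (norm_nonneg _)
        ((NonUnitalStarAlgHom.norm_apply_le π _).trans (hf1 n)))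
    have e2 : ‖π (f n * (circCoe - 1)) y‖ ≤ (Real.sqrt n)⁻¹ * ‖y‖ :=
      (ContinuousLinearMap.le_opNorm _ _).trans (mul_le_mul_of_nonneg_right
        ((NonUnitalStarAlgHom.norm_apply_le π _).trans (hf2 n hn0)) (norm_nonneg _))
    rw [dist_eq_norm] at hy
    linarith
  have hz : ν.real {x₀} ≤ 0 := by
    have h5 : Tendsto (fun n => ‖v‖ * ‖π (f n) v‖) atTop (𝓝 0) := by
      simpa using hlim.norm.const_mul ‖v‖
    exact ge_of_tendsto' h5 hle
  have := le_antisymm hz measureReal_nonneg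
  exact (measureReal_eq_zero_iff (measure_ne_top ν _)).1 this

namespace BoundaryRelation

variable {R : BoundaryRelation H} {C S : Matrix (Fin 2) (Fin 2) ℂ}

/-- The continuous functional calculus of the Cayley transform of a self-adjoint restriction. -/
theorem exists_functional_calculus (h : IsBoundaryPair C S) {k : ℝ} (hk : 0 < k)
    (hs : R.Solvable C S (k * Complex.I)) (hs' : R.Solvable C S (-(k * Complex.I))) :
    ∃ (A : H →L[ℂ] H) (π : C(circ, ℂ) →⋆ₐ[ℂ] (H →L[ℂ] H)),
      (∀ f, ∃ a b, (A f, (k * Complex.I) • A f + f, a, b) ∈ R.rel ∧ C *ᵥ a + S *ᵥ b = 0) ∧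
      π circCoe = 1 + (2 * k * Complex.I) • A ∧ DenseRange ⇑(π circCoe - 1) := by
  have hz : ((k : ℂ) * Complex.I).im ≠ 0 := by simpa using hk.ne'
  have hz' : (-((k : ℂ) * Complex.I)).im ≠ 0 := by simpa using hk.ne'
  obtain ⟨A, hA, -⟩ := exists_resolvent h hz hs
  obtain ⟨B, hB, -⟩ := exists_resolvent h hz' hs'
  have hA' := fun f => (hA f (A f)).2 rfl
  have hB' := fun f => (hB f (B f)).2 rfl
  have hadj : ∀ f g, inner ℂ (A f) g = inner ℂ f (B g) := fun f g => by
    obtain ⟨a, b, h1, h1'⟩ := hA' f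
    obtain ⟨c, d, h2, h2'⟩ := hB' g
    have e := green_hom h h1 h2 h1' h2'
    simp only [inner_add_right, inner_add_left, inner_smul_right, inner_smul_left, map_mul,
      Complex.conj_ofReal, Complex.conj_I] at e
    linear_combination e
  -- Resolvent identity between `ki` and `-ki`, needed in both orders. Together with `B = A*` it
  -- makes `1 + 2ki A` unitary.
  have hAB : ∀ f, B f = A f - (2 * k * Complex.I) • A (B f) := fun f => by
    rw [← map_smul, ← map_sub]
    refine (hA _ _).1 ?_
    obtain ⟨a, b, h1, h1'⟩ := hB' f
    refine ⟨a, b, ?_, h1'⟩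
    convert h1 using 3
    module
  have hBA : ∀ f, A f = B f + (2 * k * Complex.I) • B (A f) := fun f => by
    rw [← map_smul, ← map_add]
    refine (hB _ _).1 ?_
    obtain ⟨a, b, h1, h1'⟩ := hA' f
    refine ⟨a, b, ?_, h1'⟩
    convert h1 using 3
    module
  set s : ℂ := 2 * k * Complex.I with hsd
  have hs0 : s ≠ 0 := by simp [hsd, hk.ne']
  have hsc : conj s = -s := by
    have h2 : conj (2 : ℂ) = 2 := map_ofNat _ 2
    simp [hsd, h2]
  let U : H →L[ℂ] H := 1 + s • A
  have hstar : star U = 1 - s • B := by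
    rw [ContinuousLinearMap.star_eq_adjoint, eq_comm, ContinuousLinearMap.eq_adjoint_iff]
    intro x y
    have e : inner ℂ (B x) y = inner ℂ x (A y) := by
      rw [← inner_conj_symm, ← hadj, inner_conj_symm]
    change inner ℂ (x - s • B x) y = inner ℂ x (y + s • A y)
    rw [inner_sub_left, inner_add_right, inner_smul_left, inner_smul_right, hsc, e]
    ring
  have hU : U ∈ unitary (H →L[ℂ] H) := by
    rw [Unitary.mem_iff, hstar]
    constructor
    · ext x
      have e : s • B x + s • (s • B (A x)) = s • A x := by rw [← smul_add, ← hBA]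
      change (x + s • A x) - s • B (x + s • A x) = x
      rw [map_add, map_smul, smul_add, e]
      abel
    · ext x
      have e : s • A x - s • (s • A (B x)) = s • B x := by rw [← smul_sub, ← hAB]
      change (x - s • B x) + s • A (x - s • B x) = x
      rw [map_sub, map_smul, smul_sub, e]
      abel
  have hN : IsStarNormal U := ⟨by
    rw [Unitary.mem_iff] at hU
    exact hU.1.trans hU.2.symm⟩
  have hsp := spectrum.subset_circle_of_unitary (𝕜 := ℂ) hU
  let ι : C(spectrum ℂ U, circ) := ⟨fun x => ⟨x, hsp x.2⟩, by fun_prop⟩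
  let π : C(circ, ℂ) →⋆ₐ[ℂ] (H →L[ℂ] H) :=
    (cfcHom (p := IsStarNormal) hN).comp (ContinuousMap.compStarAlgHom' ℂ ℂ ι)
  have hπ : π circCoe = U := cfcHom_id (p := IsStarNormal) hN
  refine ⟨A, π, hA', hπ, ?_⟩
  have hU1 : π circCoe - 1 = s • A := by rw [hπ]; exact add_sub_cancel_left _ _
  rw [hU1]
  -- A vector `x` orthogonal to the range of `A` satisfies `B x = 0`. Then an element with first
  -- entry `0` and image `x` lies in the relation, which forces `x = 0`.
  have hrange : (LinearMap.range (s • A : H →L[ℂ] H).toLinearMap).topologicalClosure = ⊤ := by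
    rw [Submodule.topologicalClosure_eq_top_iff, Submodule.eq_bot_iff]
    intro x hx
    have hBx : B x = 0 := by
      have e := (Submodule.mem_orthogonal _ _).1 hx ((s • A) (s⁻¹ • B x)) ⟨_, rfl⟩
      have e' : (s • A) (s⁻¹ • B x) = A (B x) := by
        rw [map_smul]
        exact inv_smul_smul₀ hs0 _
      rwa [e', hadj, inner_self_eq_zero] at e
    obtain ⟨a, b, h1, -⟩ := hB' x
    rw [hBx, smul_zero, zero_add] at h1
    exact (R.zero h1).1
  have := Submodule.dense_iff_topologicalClosure_eq_top.2 hrange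
  exact this

end BoundaryRelation

section Cayley

variable {k : ℝ}

theorem ofReal_sub_ne_zero {z : ℂ} (hz : z.im ≠ 0) (t : ℝ) : (t : ℂ) - z ≠ 0 := fun e => by
  have := congrArg Complex.im e
  simp at this
  exact hz this

theorem im_ofReal_mul_I_ne_zero (hk : 0 < k) : ((k : ℂ) * Complex.I).im ≠ 0 := by
  simpa using hk.ne'

/-- The Cayley transform of the real line into the unit circle. -/
def cayley (hk : 0 < k) (t : ℝ) : circ :=
  ⟨(t + k * Complex.I) / (t - k * Complex.I), by
    have h1 : (t : ℂ) + k * Complex.I = conj ((t : ℂ) - k * Complex.I) := by simp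
    rw [mem_sphere_zero_iff_norm, norm_div, h1, RCLike.norm_conj, div_self]
    exact norm_ne_zero_iff.2 (ofReal_sub_ne_zero (im_ofReal_mul_I_ne_zero hk) t)⟩

theorem continuous_cayley (hk : 0 < k) : Continuous (cayley hk) := by
  refine Continuous.subtype_mk (Continuous.div (by fun_prop) (by fun_prop) fun t => ?_) _
  exact ofReal_sub_ne_zero (im_ofReal_mul_I_ne_zero hk) t

/-- The inverse `w ↦ ki(w + 1)/(w - 1)` is real on the circle away from `1`. Taking the real part
gives a measurable real function everywhere; its value at `1` is irrelevant. -/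
theorem exists_cayley_section (hk : 0 < k) :
    ∃ τ : circ → ℝ, Measurable τ ∧ ∀ w : circ, (w : ℂ) ≠ 1 → cayley hk (τ w) = w := by
  refine ⟨fun w => (k * Complex.I * ((w : ℂ) + 1) / ((w : ℂ) - 1)).re, by fun_prop, ?_⟩
  intro w hw
  have hk' : (k : ℂ) ≠ 0 := by exact_mod_cast hk.ne'
  have hw1 : (w : ℂ) - 1 ≠ 0 := sub_ne_zero.2 hw
  have hww := circ_normSq w
  have hw0 : (w : ℂ) ≠ 0 := fun e => by simp [e] at hww
  have hcw : conj (w : ℂ) = (w : ℂ)⁻¹ := eq_inv_of_mul_eq_one_right hww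
  have hre : (((k * Complex.I * ((w : ℂ) + 1) / ((w : ℂ) - 1)).re : ℝ) : ℂ) =
      k * Complex.I * ((w : ℂ) + 1) / ((w : ℂ) - 1) := by
    rw [← Complex.conj_eq_iff_re]
    simp only [map_div₀, map_mul, map_add, map_sub, map_one, hcw, Complex.conj_ofReal,
      Complex.conj_I]
    have h2 : (w : ℂ)⁻¹ - 1 ≠ 0 := by
      rw [sub_ne_zero, ne_eq, inv_eq_one]
      exact hw
    rw [div_eq_div_iff h2 hw1]
    field_simp
    ring
  ext
  change (((_ : ℝ) : ℂ) + k * Complex.I) / (((_ : ℝ) : ℂ) - k * Complex.I) = (w : ℂ)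
  rw [hre]
  have e1 : k * Complex.I * ((w : ℂ) + 1) / ((w : ℂ) - 1) + k * Complex.I =
      2 * k * Complex.I * w / ((w : ℂ) - 1) := by
    field_simp; ring
  have e2 : k * Complex.I * ((w : ℂ) + 1) / ((w : ℂ) - 1) - k * Complex.I =
      2 * k * Complex.I / ((w : ℂ) - 1) := by
    field_simp; ring
  rw [e1, e2]
  have hI := Complex.I_ne_zero
  field_simp

/-- Since `|w| = 1`, a zero would give `|ki - z| = |ki + z|`, making `z` equidistant from `ki` and
`-ki`, that is, real. -/
theorem cayley_kernel_ne_zero (hk : 0 < k) {z : ℂ} (hz : z.im ≠ 0) (w : circ) :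
    (k * Complex.I - z) * (w : ℂ) + (k * Complex.I + z) ≠ 0 := fun e => by
  have h1 : (k * Complex.I + z) = -((k * Complex.I - z) * (w : ℂ)) := by linear_combination e
  have h2 := congrArg (fun x => ‖x‖ ^ 2) h1
  simp only [norm_neg, norm_mul, mem_sphere_zero_iff_norm.1 w.2, mul_one] at h2
  rw [← Complex.normSq_eq_norm_sq, ← Complex.normSq_eq_norm_sq, Complex.normSq_apply,
    Complex.normSq_apply] at h2
  simp at h2
  have h3 : k * z.im = 0 := by linarith
  rcases mul_eq_zero.1 h3 with h | h
  · exact hk.ne' h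
  · exact hz h

/-- The function on the circle which transports the solution at `ki` to the one at `z`. -/
def cayleyKernel (hk : 0 < k) {z : ℂ} (hz : z.im ≠ 0) : C(circ, ℂ) :=
  ⟨fun w => 2 * k * Complex.I / ((k * Complex.I - z) * (w : ℂ) + (k * Complex.I + z)),
    continuous_const.div (by fun_prop) (cayley_kernel_ne_zero hk hz)⟩

/-- Under the functional calculus, where `U - 1 = 2ki A`, this identity becomes `Ψ = ψ + (z - ki) A
Ψ`. It carries a solution at `ki` to a solution at `z` with the same value of `C a + S b`. -/
theorem cayleyKernel_eq (hk : 0 < k) {z : ℂ} (hz : z.im ≠ 0) :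
    cayleyKernel hk hz = 1 + ((z - k * Complex.I) / (2 * k * Complex.I)) •
      ((circCoe - 1) * cayleyKernel hk hz) := by
  ext w
  have hk' : (k : ℂ) ≠ 0 := by exact_mod_cast hk.ne'
  have hI := Complex.I_ne_zero
  have h := cayley_kernel_ne_zero hk hz w
  change 2 * k * Complex.I / ((k * Complex.I - z) * (w : ℂ) + (k * Complex.I + z)) =
    1 + ((z - k * Complex.I) / (2 * k * Complex.I)) * (((w : ℂ) - 1) *
      (2 * k * Complex.I / ((k * Complex.I - z) * (w : ℂ) + (k * Complex.I + z))))
  field_simp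
  ring

theorem cayleyKernel_self (hk : 0 < k) :
    cayleyKernel hk (im_ofReal_mul_I_ne_zero hk) = 1 := by
  rw [cayleyKernel_eq]
  simp

theorem cayleyKernel_cayley (hk : 0 < k) {z : ℂ} (hz : z.im ≠ 0) (t : ℝ) :
    cayleyKernel hk hz (cayley hk t) = (t - k * Complex.I) / (t - z) := by
  have hk' : (k : ℂ) ≠ 0 := by exact_mod_cast hk.ne'
  have hI := Complex.I_ne_zero
  have h1 := ofReal_sub_ne_zero (im_ofReal_mul_I_ne_zero hk) t
  have h2 := ofReal_sub_ne_zero hz t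
  change 2 * k * Complex.I / ((k * Complex.I - z) * ((t + k * Complex.I) / (t - k * Complex.I)) +
    (k * Complex.I + z)) = _
  have h3 : (k * Complex.I - z) * ((t + k * Complex.I) / (t - k * Complex.I)) +
      (k * Complex.I + z) = 2 * k * Complex.I * (t - z) / (t - k * Complex.I) := by
    field_simp
    ring
  rw [h3]
  field_simp

end Cayley

variable {H : Type*} [NormedAddCommGroup H] [InnerProductSpace ℂ H] [CompleteSpace H]
variable {R : BoundaryRelation H} {C S : Matrix (Fin 2) (Fin 2) ℂ}

/-- The matrix-valued spectral measure on the line obtained from one on the circle. -/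
theorem exists_matrixMeasure_line (π : C(circ, ℂ) →⋆ₐ[ℂ] (H →L[ℂ] H))
    (hd : DenseRange ⇑(π circCoe - 1)) (ψ : Fin 2 → H) {k : ℝ} (hk : 0 < k) :
    ∃ Sg : MatrixMeasure, ∀ (f : ℝ → ℂ) (F : C(circ, ℂ)),
      (∀ t : ℝ, f t * ((t : ℂ) ^ 2 + (k : ℂ) ^ 2) = F (cayley hk t)) → Sg.Integrable f ∧
        ∀ i j, Sg.integral f i j = inner ℂ (ψ i) (π F (ψ j)) := by
  obtain ⟨μ, D, hμ, hDp, hDi, hD, hatom⟩ := exists_matrix_density π ψ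
  obtain ⟨τ, hτ, hτc⟩ := exists_cayley_section hk
  have hμ1 : μ {(⟨1, by simp⟩ : circ)} = 0 := hatom _ fun v ν hν hint =>
    measure_singleton_one_eq_zero π hd v ν hint _ rfl
  have hc : Measurable (cayley hk) := (continuous_cayley hk).measurable
  have hmp : MeasurePreserving (cayley hk) (μ.map τ) μ := by
    refine ⟨hc, ?_⟩
    rw [Measure.map_map hc hτ]
    have : (cayley hk ∘ τ) =ᵐ[μ] id := by
      have h1 : ∀ᵐ w ∂μ, w ≠ (⟨1, by simp⟩ : circ) := by
        rw [ae_iff]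
        simpa using hμ1
      filter_upwards [h1] with w hw
      exact hτc w fun e => hw (Subtype.ext e)
    rw [Measure.map_congr this, Measure.map_id]
  have hint : ∀ (F : C(circ, ℂ)) i j,
      Integrable (fun t => F (cayley hk t) * D (cayley hk t) i j) (μ.map τ) := fun F i j => by
    have h1 := integrable_continuousMap_mul (hDi i j) F
    exact (hmp.integrable_comp h1.aestronglyMeasurable).2 h1
  have hcast : ∀ t : ℝ, ((t ^ 2 + k ^ 2 : ℝ) : ℂ) = (t : ℂ) ^ 2 + (k : ℂ) ^ 2 := fun t => by
    push_cast; rfl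
  -- The weight `t² + k²` converts the finite measure of the vectors `ψ j` into `Σ`: a scalar `f` is
  -- integrable whenever `f(t)(t² + k²)` extends continuously to the circle. Nothing is lost in the
  -- transport because `μ` has no mass at `1`.
  refine ⟨⟨μ.map τ, fun t => ((t ^ 2 + k ^ 2 : ℝ) : ℂ) • D (cayley hk t), fun t => ?_,
    fun i j => ?_⟩, fun f F hf => ?_⟩
  · refine (hDp _).smul ?_
    rw [Complex.zero_le_real]
    positivity
  · refine LocallyIntegrable.continuous_mul (g := fun t : ℝ => ((t ^ 2 + k ^ 2 : ℝ) : ℂ))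
      (f := fun t => D (cayley hk t) i j) (by fun_prop) (Integrable.locallyIntegrable ?_)
    simpa using hint 1 i j
  · have e : ∀ t i j, f t * (((t ^ 2 + k ^ 2 : ℝ) : ℂ) • D (cayley hk t)) i j =
        F (cayley hk t) * D (cayley hk t) i j := fun t i j => by
      rw [Matrix.smul_apply, smul_eq_mul, ← hf, hcast]
      ring
    constructor
    · intro i j
      simp only [e]
      exact hint F i j
    · intro i j
      simp only [MatrixMeasure.integral, Matrix.of_apply, e]
      rw [← hD]
      have h1 := (integrable_continuousMap_mul (hDi i j) F).aestronglyMeasurable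
      rw [← hmp.map_eq] at h1
      have h2 := integral_map hc.aemeasurable h1
      rw [hmp.map_eq] at h2
      exact h2.symm

namespace BoundaryRelation

/-- The Herglotz representation of the Weyl function of a boundary relation. -/
theorem exists_herglotz (h : IsBoundaryPair C S) {k : ℝ} (hk : 0 < k)
    (hs : R.Solvable C S (k * Complex.I)) (hs' : R.Solvable C S (-(k * Complex.I))) :
    ∃ (Sg : MatrixMeasure) (M : ℂ → Matrix (Fin 2) (Fin 2) ℂ),
      Sg.Integrable (fun t => 1 / (1 + (t : ℂ) ^ 2)) ∧
      (∀ z : ℂ, z.im ≠ 0 → M z = (1 / 2 : ℂ) • (M Complex.I + (M Complex.I)ᴴ) +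
        Sg.integral (fun t => 1 / ((t : ℂ) - z) - (t : ℂ) / (1 + (t : ℂ) ^ 2))) ∧
      ∀ z : ℂ, z.im ≠ 0 → ∀ j, ∃ u a b, (u, z • u, a, b) ∈ R.rel ∧
        C *ᵥ a + S *ᵥ b = Pi.single j 1 ∧ C *ᵥ b - S *ᵥ a = fun i => M z i j := by
  obtain ⟨A, π, hA, hπ, hd⟩ := exists_functional_calculus h hk hs hs'
  choose ψ a₀ b₀ hψ hbc using fun j : Fin 2 => hs 0 (Pi.single j 1)
  simp only [add_zero] at hψ
  have hk' : (k : ℂ) ≠ 0 := by exact_mod_cast hk.ne'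
  have hI := Complex.I_ne_zero
  have hrel : ∀ (z : {z : ℂ // z.im ≠ 0}) j, ∃ a b, (π (cayleyKernel hk z.2) (ψ j),
      (z : ℂ) • π (cayleyKernel hk z.2) (ψ j), a, b) ∈ R.rel ∧
      C *ᵥ a + S *ᵥ b = Pi.single j 1 := by
    intro z j
    set Ψ := π (cayleyKernel hk z.2) (ψ j) with hΨ
    have e : Ψ = ψ j + ((z : ℂ) - k * Complex.I) • A Ψ := by
      have e1 : π circCoe - 1 = (2 * k * Complex.I) • A := by
        rw [hπ]; exact add_sub_cancel_left _ _
      have e2 := congrArg (fun F => π F (ψ j)) (cayleyKernel_eq hk z.2)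
      simp only [map_add, map_one, map_smul, map_mul, map_sub, e1] at e2
      change Ψ = ψ j + (((z : ℂ) - k * Complex.I) / (2 * k * Complex.I)) •
        ((2 * k * Complex.I) • A Ψ) at e2
      rw [smul_smul, div_mul_cancel₀ _ (by simp [hk'])] at e2
      exact e2
    obtain ⟨a, b, h1, h2⟩ := hA Ψ
    have h3 := R.rel.add_mem (hψ j) (R.rel.smul_mem ((z : ℂ) - k * Complex.I) h1)
    refine ⟨a₀ j + ((z : ℂ) - k * Complex.I) • a, b₀ j + ((z : ℂ) - k * Complex.I) • b, ?_, ?_⟩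
    · convert h3 using 1
      simp only [Prod.smul_mk, Prod.mk_add_mk]
      refine Prod.ext e (Prod.ext ?_ rfl)
      change (z : ℂ) • Ψ = (k * Complex.I) • ψ j + ((z : ℂ) - k * Complex.I) •
        ((k * Complex.I) • A Ψ + Ψ)
      have e3 : (k * Complex.I) • Ψ = (k * Complex.I) • ψ j + (k * Complex.I) •
        (((z : ℂ) - k * Complex.I) • A Ψ) := by rw [← smul_add, ← e]
      calc (z : ℂ) • Ψ = (k * Complex.I) • Ψ + ((z : ℂ) - k * Complex.I) • Ψ := by module
        _ = _ := by rw [e3]; module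
    · rw [← hbc j, Matrix.mulVec_add, Matrix.mulVec_add, Matrix.mulVec_smul, Matrix.mulVec_smul]
      have : C *ᵥ a = -(S *ᵥ b) := eq_neg_of_add_eq_zero_left h2
      rw [this]
      module
  choose a b hab hab' using hrel
  let M : ℂ → Matrix (Fin 2) (Fin 2) ℂ := fun z =>
    if hz : z.im ≠ 0 then Matrix.of fun i j => (C *ᵥ b ⟨z, hz⟩ j - S *ᵥ a ⟨z, hz⟩ j) i else 0
  have hMz : ∀ (z : {z : ℂ // z.im ≠ 0}) j, C *ᵥ b z j - S *ᵥ a z j = fun i => M z i j := by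
    intro z j
    funext i
    simp only [M, dif_pos z.2, Matrix.of_apply]
  -- Green's identity between the `i`-th solution at `ki` and the `j`-th solution at `z`. In rotated
  -- boundary data the boundary form is the `(i, j)` entry of `M(z) - M(ki)*`, and `z - conj(ki) = z
  -- + ki`.
  have hM : ∀ (z : {z : ℂ // z.im ≠ 0}) i j, M z i j = conj (M (k * Complex.I) j i) +
      (z + k * Complex.I) * inner ℂ (ψ i) (π (cayleyKernel hk z.2) (ψ j)) := by
    intro z i j
    set p : {z : ℂ // z.im ≠ 0} := ⟨k * Complex.I, im_ofReal_mul_I_ne_zero hk⟩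
    have e := R.green (hab p i) (hab z j)
    rw [h.form_eq, hab', hab', hMz, hMz, cayleyKernel_self, map_one] at e
    simp only [Pi.star_single, star_one, single_one_dotProduct, dotProduct_single_one,
      Pi.star_apply, inner_smul_left, inner_smul_right] at e
    change (z : ℂ) * inner ℂ (ψ i) (π (cayleyKernel hk z.2) (ψ j)) - conj (k * Complex.I) *
      inner ℂ (ψ i) (π (cayleyKernel hk z.2) (ψ j)) = M z i j - conj (M (k * Complex.I) j i) at e
    simp only [map_mul, Complex.conj_ofReal, Complex.conj_I] at e
    linear_combination -e
  obtain ⟨Sg, hSg⟩ := exists_matrixMeasure_line π hd ψ hk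
  have hIim : Complex.I.im ≠ 0 := by simp
  have hIim' : (-Complex.I).im ≠ 0 := by simp
  have hf1 : ∀ t : ℝ, (t : ℂ) - Complex.I ≠ 0 := ofReal_sub_ne_zero hIim
  have hf2 : ∀ t : ℝ, (t : ℂ) + Complex.I ≠ 0 := fun t => by
    simpa using ofReal_sub_ne_zero hIim' t
  have hf3 : ∀ t : ℝ, 1 + (t : ℂ) ^ 2 = (t - Complex.I) * (t + Complex.I) := fun t => by
    linear_combination Complex.I_sq
  refine ⟨Sg, M, (hSg _ (circCoe * cayleyKernel hk hIim * cayleyKernel hk hIim') fun t => ?_).1,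
    fun z hz => ?_, fun z hz j => ⟨_, _, _, hab ⟨z, hz⟩ j, hab' _ j, hMz ⟨z, hz⟩ j⟩⟩
  · rw [ContinuousMap.mul_apply, ContinuousMap.mul_apply, cayleyKernel_cayley, cayleyKernel_cayley]
    change _ = (t + k * Complex.I) / (t - k * Complex.I) * _ * _
    have h1 := ofReal_sub_ne_zero (im_ofReal_mul_I_ne_zero hk) t
    rw [hf3, sub_neg_eq_add]
    have := hf1 t
    have := hf2 t
    field_simp
    linear_combination ((k : ℂ) ^ 2) * Complex.I_sq
  -- The function on the circle is read off from `hM`: subtracting `Re M(i)` from `M(z)` cancels the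
  -- dependence on `M(ki)`, with `M(ki) - M(ki)* = 2ki ⟨ψ_i, ψ_j⟩`, and leaves this combination of
  -- kernels.
  · have hF := hSg (fun t => 1 / ((t : ℂ) - z) - (t : ℂ) / (1 + (t : ℂ) ^ 2))
      ((z + k * Complex.I) • cayleyKernel hk hz - (k * Complex.I) • (1 : C(circ, ℂ)) -
        ((Complex.I + k * Complex.I) / 2) • (cayleyKernel hk hIim - star (cayleyKernel hk hIim)))
      fun t => by
        simp only [ContinuousMap.sub_apply, ContinuousMap.smul_apply, ContinuousMap.star_apply,
          ContinuousMap.one_apply, cayleyKernel_cayley, smul_eq_mul]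
        have h1 := ofReal_sub_ne_zero hz t
        have h2 := hf1 t
        have h3 := hf2 t
        have e1 : star ((t - k * Complex.I) / ((t : ℂ) - Complex.I)) =
          (t + k * Complex.I) / ((t : ℂ) + Complex.I) := by
          simp
        have e2 : (t - k * Complex.I) / ((t : ℂ) - Complex.I) -
          (t + k * Complex.I) / ((t : ℂ) + Complex.I) =
            2 * Complex.I * t * (1 - k) / ((t - Complex.I) * (t + Complex.I)) := by
          field_simp
          ring
        have e3 : (z + k * Complex.I) * ((t - k * Complex.I) / ((t : ℂ) - z)) - k * Complex.I =
          (t ^ 2 + k ^ 2) / (t - z) - t := by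
          field_simp
          linear_combination (-(k : ℂ) ^ 2) * Complex.I_sq
        rw [e1, e2, mul_one, e3, hf3]
        have e4 : (Complex.I + k * Complex.I) / 2 *
            (2 * Complex.I * t * (1 - k) / ((t - Complex.I) * (t + Complex.I))) =
            -(t * (1 - k ^ 2)) / ((t - Complex.I) * (t + Complex.I)) := by
          field_simp
          linear_combination ((1 - k) * (1 + k) * t : ℂ) * Complex.I_sq
        rw [e4]
        field_simp
        linear_combination (-(t * (t - z)) : ℂ) * Complex.I_sq
    ext i j
    rw [Matrix.add_apply, hF.2 i j, Matrix.smul_apply, Matrix.add_apply,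
      Matrix.conjTranspose_apply]
    have e1 := hM ⟨z, hz⟩ i j
    have e2 := hM ⟨Complex.I, hIim⟩ i j
    have e3 := congrArg conj (hM ⟨Complex.I, hIim⟩ j i)
    have e4 := hM ⟨k * Complex.I, im_ofReal_mul_I_ne_zero hk⟩ i j
    have e5 : conj (inner ℂ (ψ j) (π (cayleyKernel hk hIim) (ψ i))) =
        inner ℂ (ψ i) (π (star (cayleyKernel hk hIim)) (ψ j)) := by
      rw [inner_conj_symm, ← inner_map_star]
    simp only [map_add, map_mul, Complex.conj_conj, Complex.conj_ofReal, Complex.conj_I, e5] at e3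
    rw [cayleyKernel_self, map_one] at e4
    simp only [map_sub, map_smul, map_one]
    change M z i j = (1 / 2 : ℂ) * (M Complex.I i j + conj (M Complex.I j i)) +
      inner ℂ (ψ i) ((z + k * Complex.I) • π (cayleyKernel hk hz) (ψ j) - (k * Complex.I) • ψ j -
        ((Complex.I + k * Complex.I) / 2) • (π (cayleyKernel hk hIim) (ψ j) -
          π (star (cayleyKernel hk hIim)) (ψ j)))
    simp only [inner_sub_right, inner_smul_right]
    change M (k * Complex.I) i j = _ + (k * Complex.I + k * Complex.I) * inner ℂ (ψ i) (ψ j) at e4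
    linear_combination e1 - (1 / 2 : ℂ) * e2 - (1 / 2 : ℂ) * e3 - (1 / 2 : ℂ) * e4

end BoundaryRelation

/-! ### Carathéodory solutions of the initial value problem -/

/-- Global solvability of an integral equation with measurable, Lipschitz right-hand side. -/
theorem exists_caratheodory {V : Type*} [NormedAddCommGroup V] [NormedSpace ℝ V] [CompleteSpace V]
    {f : ℝ → V → V} {L : ℝ} (hL : 0 ≤ L)
    (hm : ∀ Y : ℝ → V, Continuous Y → AEStronglyMeasurable (fun t => f t (Y t)) volume)
    (hlip : ∀ t x y, ‖f t x - f t y‖ ≤ L * ‖x - y‖) (h0 : ∀ t, f t 0 = 0) (y₀ : V) :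
    ∃ Y : ℝ → V, Continuous Y ∧ ∀ x, 0 ≤ x → Y x = y₀ + ∫ t in (0 : ℝ)..x, f t (Y t) := by
  have hb : ∀ t x, ‖f t x‖ ≤ L * ‖x‖ := fun t x => by simpa [h0] using hlip t x 0
  have hint : ∀ Y : ℝ → V, Continuous Y → ∀ a b,
      IntervalIntegrable (fun t => f t (Y t)) volume a b := fun Y hY a b => by
    refine ((hY.norm.const_mul L).intervalIntegrable a b).mono_fun (hm Y hY).restrict
      (Eventually.of_forall fun t => ?_)
    simpa [abs_of_nonneg hL] using hb t (Y t)
  -- Exponential weight: for `G = exp(-γt) Y` in the supremum norm the integral operator has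
  -- Lipschitz constant at most `L/γ < 1/2`, so one contraction covers the whole half-line. The
  -- absolute value in `T` only extends the construction to negative arguments.
  set γ : ℝ := 2 * L + 1 with hγ
  have hγ0 : 0 < γ := by positivity
  let lift : (ℝ → V) → ℝ → V := fun G t => Real.exp (γ * t) • G t
  have hlift : ∀ G : ℝ → V, Continuous G → Continuous (lift G) := fun G hG => by
    simp only [lift]; fun_prop
  let T : (ℝ → V) → ℝ → V := fun G x =>
    Real.exp (-γ * |x|) • (y₀ + ∫ t in (0 : ℝ)..|x|, f t (lift G t))
  have hTc : ∀ G : ℝ → V, Continuous G → Continuous (T G) := fun G hG => by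
    have h1 : Continuous fun x => ∫ t in (0 : ℝ)..x, f t (lift G t) :=
      intervalIntegral.continuous_primitive (hint _ (hlift G hG)) 0
    have h2 := h1.comp continuous_abs
    simp only [T]
    exact (by fun_prop : Continuous fun x : ℝ => Real.exp (-γ * |x|)).smul (continuous_const.add h2)
  have hexp : ∀ x : ℝ, 0 ≤ x → ∫ t in (0 : ℝ)..x, Real.exp (γ * t) = (Real.exp (γ * x) - 1) / γ := by
    intro x _
    rw [intervalIntegral.integral_comp_mul_left (fun t => Real.exp t) hγ0.ne', integral_exp]
    simp [div_eq_inv_mul]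
  have key : ∀ (g : ℝ → V) (c : ℝ), 0 ≤ c → (∀ t, ‖g t‖ ≤ L * (Real.exp (γ * t) * c)) →
      ∀ x, ‖Real.exp (-γ * |x|) • ∫ t in (0 : ℝ)..|x|, g t‖ ≤ 1 / 2 * c := by
    intro g c hc hg x
    have h1 : ‖∫ t in (0 : ℝ)..|x|, g t‖ ≤ L * c * ((Real.exp (γ * |x|) - 1) / γ) := by
      rw [← hexp _ (abs_nonneg x), ← intervalIntegral.integral_const_mul]
      refine intervalIntegral.norm_integral_le_of_norm_le (abs_nonneg x)
        (Eventually.of_forall fun t _ => (hg t).trans_eq (by ring)) ?_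
      exact (by fun_prop : Continuous fun t : ℝ => L * c * Real.exp (γ * t)).intervalIntegrable _ _
    rw [norm_smul, Real.norm_of_nonneg (Real.exp_pos _).le]
    refine (mul_le_mul_of_nonneg_left h1 (Real.exp_pos _).le).trans ?_
    have h2 : Real.exp (-γ * |x|) * Real.exp (γ * |x|) = 1 := by rw [← Real.exp_add]; simp
    have h3 : Real.exp (-γ * |x|) * (L * c * ((Real.exp (γ * |x|) - 1) / γ)) =
        L * c * (1 - Real.exp (-γ * |x|)) / γ := by
      rw [mul_div_assoc', ← mul_div_assoc]
      congr 1
      linear_combination L * c * h2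
    rw [h3, div_le_iff₀ hγ0, hγ]
    nlinarith [mul_nonneg (mul_nonneg hL hc) (Real.exp_pos (-γ * |x|)).le]
  have hTb : ∀ G : BoundedContinuousFunction ℝ V, ∀ x, ‖T G x‖ ≤ ‖y₀‖ + 1 / 2 * ‖G‖ := by
    intro G x
    simp only [T, smul_add]
    refine (norm_add_le _ _).trans (add_le_add ?_ (key _ _ (norm_nonneg _) (fun t => ?_) x))
    · rw [norm_smul, Real.norm_of_nonneg (Real.exp_pos _).le]
      refine mul_le_of_le_one_left (norm_nonneg _) (Real.exp_le_one_iff.2 ?_)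
      nlinarith [abs_nonneg x]
    · refine (hb _ _).trans (mul_le_mul_of_nonneg_left ?_ hL)
      rw [norm_smul, Real.norm_of_nonneg (Real.exp_pos _).le]
      exact mul_le_mul_of_nonneg_left (G.norm_coe_le_norm t) (Real.exp_pos _).le
  let TB : BoundedContinuousFunction ℝ V → BoundedContinuousFunction ℝ V := fun G =>
    BoundedContinuousFunction.ofNormedAddCommGroup (T G) (hTc G G.continuous) _ (hTb G)
  have hTB : ContractingWith (1 / 2) TB := by
    refine ⟨by rw [← NNReal.coe_lt_coe]; norm_num, LipschitzWith.of_dist_le_mul fun G G' => ?_⟩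
    rw [BoundedContinuousFunction.dist_le (by positivity)]
    intro x
    rw [dist_eq_norm]
    change ‖T G x - T G' x‖ ≤ _
    have e : T G x - T G' x = Real.exp (-γ * |x|) •
        ∫ t in (0 : ℝ)..|x|, (f t (lift G t) - f t (lift G' t)) := by
      simp only [T]
      rw [intervalIntegral.integral_sub (hint _ (hlift G G.continuous) _ _)
        (hint _ (hlift G' G'.continuous) _ _), ← smul_sub, add_sub_add_left_eq_sub]
    rw [e]
    refine (key _ (dist G G') dist_nonneg (fun t => ?_) x).trans_eq (by norm_num)
    refine (hlip _ _ _).trans (mul_le_mul_of_nonneg_left ?_ hL)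
    simp only [lift]
    rw [← smul_sub, norm_smul, Real.norm_of_nonneg (Real.exp_pos _).le, ← dist_eq_norm]
    exact mul_le_mul_of_nonneg_left (BoundedContinuousFunction.dist_coe_le_dist t)
      (Real.exp_pos _).le
  set G := ContractingWith.fixedPoint TB hTB with hG
  have hfix : ∀ x, G x = T G x := fun x => by
    have := hTB.fixedPoint_isFixedPt
    have h2 := congrArg (fun F : BoundedContinuousFunction ℝ V => F x) this.eq
    exact h2.symm
  refine ⟨lift G, hlift G G.continuous, fun x hx => ?_⟩
  simp only [lift]
  rw [hfix x]
  simp only [T]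
  rw [abs_of_nonneg hx, smul_smul, ← Real.exp_add]
  simp [lift]

section Solutions

variable {Q : ℝ → Matrix (Fin 2) (Fin 2) ℂ} {z : ℂ} {F F' : ℝ → Fin 2 → ℂ}

theorem eps_mulVec (v : Fin 2 → ℂ) (i : Fin 2) : (eps *ᵥ v) i = v (i + 1) := by
  fin_cases i <;> simp [eps, Matrix.mulVec, dotProduct, Fin.sum_univ_two]

theorem IsSolution.congr {Q' : ℝ → Matrix (Fin 2) (Fin 2) ℂ} (h : IsSolution Q z F F')
    (hQ : ∀ t, 0 < t → Q t = Q' t) : IsSolution Q' z F F' := by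
  refine ⟨h.hasDeriv, fun x hx => (h.equation x hx).trans ?_⟩
  refine intervalIntegral.integral_congr_ae (Eventually.of_forall fun t ht => ?_)
  rw [uIoc_of_le hx] at ht
  rw [hQ t ht.1]

theorem IsWeylMatrix.congr {Q' : ℝ → Matrix (Fin 2) (Fin 2) ℂ} {α : OnePoint ℂ}
    {M : Matrix (Fin 2) (Fin 2) ℂ} (h : IsWeylMatrix Q α z M) (hQ : ∀ t, 0 < t → Q t = Q' t) :
    IsWeylMatrix Q' α z M := by
  obtain ⟨Φ, Φ', Θ, Θ', h1, h2, h3, h4, h5⟩ := h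
  exact ⟨Φ, Φ', Θ, Θ', fun j => (h1 j).congr hQ, h2, h3, fun j => (h4 j).congr hQ, h5⟩

theorem aestronglyMeasurable_potential (hm : ∀ i j, Measurable fun x => Q x i j)
    {G : ℝ → Fin 2 → ℂ} {μ : Measure ℝ}
    (hG : ∀ j, AEStronglyMeasurable (fun t => G t j) μ) (i : Fin 2) :
    AEStronglyMeasurable (fun t => (Q t *ᵥ G t - z • G t) i) μ := by
  simp only [Pi.sub_apply, Pi.smul_apply, Matrix.mulVec, dotProduct]
  refine AEStronglyMeasurable.sub ?_ ((hG i).const_smul z)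
  refine Finset.aestronglyMeasurable_fun_sum _ fun j _ => ?_
  exact (hm i j).aestronglyMeasurable.mul (hG j)

theorem intervalIntegrable_potential (hm : ∀ i j, Measurable fun x => Q x i j) {K : ℝ}
    (hK : ∀ x i j, ‖Q x i j‖ ≤ K) {x : ℝ} (hx : 0 ≤ x)
    (hF : ∀ j, ContinuousOn (fun t => F t j) (Ici 0)) (i : Fin 2) :
    IntervalIntegrable (fun t => (Q t *ᵥ F t - z • F t) i) volume 0 x := by
  have hsub : uIcc 0 x ⊆ Ici 0 := fun t ht => by rw [uIcc_of_le hx] at ht; exact ht.1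
  have hc := fun j => ((hF j).mono hsub)
  simp only [Pi.sub_apply, Pi.smul_apply, Matrix.mulVec, dotProduct, Fin.sum_univ_two]
  have hQi : ∀ j, IntervalIntegrable (fun t => Q t i j) volume 0 x := fun j =>
    (intervalIntegrable_const (c := K)).mono_fun (hm i j).aestronglyMeasurable.restrict
      (Eventually.of_forall fun t => (hK t i j).trans (Real.le_norm_self K))
  exact (((hQi 0).mul_continuousOn (hc 0)).add ((hQi 1).mul_continuousOn (hc 1))).sub
    (IntervalIntegrable.const_mul (hc i).intervalIntegrable z)

theorem intervalIntegral_pi_apply {G : ℝ → Fin 2 → ℂ} {x : ℝ}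
    (hG : ∀ i, IntervalIntegrable (fun t => G t i) volume 0 x) (i : Fin 2) :
    (∫ t in (0 : ℝ)..x, G t) i = ∫ t in (0 : ℝ)..x, G t i := by
  have h1 : IntervalIntegrable G volume 0 x :=
    ⟨Integrable.of_eval fun i => (hG i).1, Integrable.of_eval fun i => (hG i).2⟩
  exact ((ContinuousLinearMap.proj (R := ℝ) (φ := fun _ : Fin 2 => ℂ) i).intervalIntegral_comp_comm
    h1).symm

/-- In components `ε` swaps the indices, so the equation prescribes the derivative of each `F' i`
through component `i + 1`. Boundedness of `Q` provides the integrability that allows the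
vector-valued integral to be taken entry by entry. -/
theorem isSolution_iff (hm : ∀ i j, Measurable fun x => Q x i j) {K : ℝ}
    (hK : ∀ x i j, ‖Q x i j‖ ≤ K) :
    IsSolution Q z F F' ↔ ∀ i, IsPrimitive (fun x => F x i) (fun x => F' x i) ∧
    IsPrimitive (fun x => F' x i) fun x => (Q x *ᵥ F x - z • F x) (i + 1) := by
  have h2 : ∀ i : Fin 2, i + 1 + 1 = i := by decide
  constructor
  · intro h i
    have hFc : ∀ j, ContinuousOn (fun t => F t j) (Ici 0) := fun j x hx =>
      (hasDerivWithinAt_pi.1 (h.hasDeriv x hx) j).continuousWithinAt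
    have hI := fun (x : ℝ) (hx : 0 ≤ x) =>
      intervalIntegrable_potential hm hK (z := z) hx hFc
    have hP : ∀ i, IsPrimitive (fun x => F' x i) fun x => (Q x *ᵥ F x - z • F x) (i + 1) :=
      fun i => ⟨fun x hx => hI x hx _, fun x hx => by
        have e := congrFun (h.equation x hx) (i + 1)
        rw [eps_mulVec, h2, intervalIntegral_pi_apply (hI x hx)] at e
        rw [← e, Pi.sub_apply]
        ring⟩
    refine ⟨⟨fun x hx => ((hP i).continuousOn_uIcc hx).intervalIntegrable, fun x hx => ?_⟩, hP i⟩
    have e := intervalIntegral.integral_eq_sub_of_hasDerivAt_of_le hx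
      ((hFc i).mono fun t ht => ht.1) (fun t ht =>
        (hasDerivWithinAt_pi.1 (h.hasDeriv t ht.1.le) i).hasDerivAt (Ici_mem_nhds ht.1))
      ((hP i).continuousOn_uIcc hx).intervalIntegrable
    rw [e]
    ring
  · intro h
    refine ⟨fun x hx => hasDerivWithinAt_pi.2 fun i =>
      (h i).1.hasDerivWithinAt (h i).2.continuousOn hx, fun x hx => ?_⟩
    funext i
    rw [eps_mulVec, intervalIntegral_pi_apply fun i =>
      intervalIntegrable_potential hm hK hx (fun j => (h j).1.continuousOn) i]
    have e := (h (i + 1)).2.eq x hx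
    rw [h2] at e
    rw [Pi.sub_apply, e]
    ring

theorem exists_isSolution (hm : ∀ i j, Measurable fun x => Q x i j) {K : ℝ}
    (hK : ∀ x i j, ‖Q x i j‖ ≤ K) (z : ℂ) (a b : Fin 2 → ℂ) :
    ∃ F F', IsSolution Q z F F' ∧ F 0 = a ∧ F' 0 = b := by
  let f : ℝ → (Fin 2 → ℂ) × (Fin 2 → ℂ) → (Fin 2 → ℂ) × (Fin 2 → ℂ) := fun t y =>
    (y.2, fun i => (Q t *ᵥ y.1 - z • y.1) (i + 1))
  have hK0 : 0 ≤ K := (norm_nonneg _).trans (hK 0 0 0)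
  have hpot : ∀ t (v : Fin 2 → ℂ) i, ‖(Q t *ᵥ v - z • v) i‖ ≤ (2 * K + ‖z‖) * ‖v‖ := by
    intro t v i
    simp only [Pi.sub_apply, Pi.smul_apply, Matrix.mulVec, dotProduct, Fin.sum_univ_two, smul_eq_mul]
    have h1 : ∀ j, ‖Q t i j * v j‖ ≤ K * ‖v‖ := fun j => by
      rw [norm_mul]
      exact mul_le_mul (hK t i j) (norm_le_pi_norm v j) (norm_nonneg _) hK0
    have h2 : ‖z * v i‖ ≤ ‖z‖ * ‖v‖ := by
      rw [norm_mul]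
      exact mul_le_mul_of_nonneg_left (norm_le_pi_norm v i) (norm_nonneg _)
    have h3 := norm_sub_le (Q t i 0 * v 0 + Q t i 1 * v 1) (z * v i)
    have h4 := norm_add_le (Q t i 0 * v 0) (Q t i 1 * v 1)
    linarith [h1 0, h1 1]
  have hlip : ∀ t x y, ‖f t x - f t y‖ ≤ (2 * K + ‖z‖ + 1) * ‖x - y‖ := by
    intro t x y
    have e : f t x - f t y = f t (x - y) := by
      simp only [f]
      refine Prod.ext rfl ?_
      funext i
      simp only [Prod.snd_sub, Prod.fst_sub, Pi.sub_apply, Matrix.mulVec_sub, smul_sub]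
      ring
    rw [e, Prod.norm_def, max_le_iff]
    have hz := norm_nonneg z
    have hn := norm_nonneg (x - y)
    constructor
    · change ‖(x - y).2‖ ≤ _
      have h1 := norm_snd_le (x - y)
      nlinarith [mul_nonneg (by positivity : 0 ≤ 2 * K + ‖z‖) hn]
    · refine (pi_norm_le_iff_of_nonneg (by positivity)).2 fun i => (hpot t _ _).trans ?_
      have h1 := norm_fst_le (x - y)
      nlinarith [mul_le_mul_of_nonneg_left h1 (by positivity : 0 ≤ 2 * K + ‖z‖)]
  have hmeas : ∀ Y : ℝ → (Fin 2 → ℂ) × (Fin 2 → ℂ), Continuous Y →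
      AEStronglyMeasurable (fun t => f t (Y t)) volume := by
    intro Y hY
    refine AEStronglyMeasurable.prodMk hY.snd.aestronglyMeasurable ?_
    refine (aemeasurable_pi_iff.2 fun i => ?_).aestronglyMeasurable
    refine (aestronglyMeasurable_potential hm (fun j => ?_) (i + 1)).aemeasurable
    exact (by fun_prop : Continuous fun t => (Y t).1 j).aestronglyMeasurable
  obtain ⟨Y, hY, hYe⟩ := exists_caratheodory (L := 2 * K + ‖z‖ + 1) (by positivity) hmeas hlip
    (fun t => by
      refine Prod.ext rfl (funext fun i => ?_)
      simp [f, Matrix.mulVec_zero]) (a, b)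
  have hY0 : Y 0 = (a, b) := by simpa using hYe 0 le_rfl
  refine ⟨fun x => (Y x).1, fun x => (Y x).2, (isSolution_iff hm hK).2 fun i => ?_, congrArg Prod.fst hY0,
    congrArg Prod.snd hY0⟩
  have hI : ∀ x, 0 ≤ x → ∀ i, IntervalIntegrable
      (fun t => (Q t *ᵥ (Y t).1 - z • (Y t).1) i) volume 0 x := fun x hx i =>
    intervalIntegrable_potential (F := fun t => (Y t).1) hm hK hx (fun j => by fun_prop) i
  have hI2 : ∀ x (i : Fin 2), IntervalIntegrable (fun t => (Y t).2 i) volume 0 x := fun x i =>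
    (by fun_prop : Continuous fun t => (Y t).2 i).intervalIntegrable _ _
  have hIf : ∀ x, 0 ≤ x → IntervalIntegrable (fun t => f t (Y t)) volume 0 x := fun x hx =>
    ⟨(Integrable.of_eval fun i => (hI2 x i).1).prodMk
      (Integrable.of_eval fun i => (hI x hx (i + 1)).1),
     (Integrable.of_eval fun i => (hI2 x i).2).prodMk
      (Integrable.of_eval fun i => (hI x hx (i + 1)).2)⟩
  refine ⟨⟨fun x hx => hI2 x i, fun x hx => ?_⟩, ⟨fun x hx => hI x hx _, fun x hx => ?_⟩⟩
  · have e := ((ContinuousLinearMap.proj (R := ℝ) (φ := fun _ : Fin 2 => ℂ) i).comp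
      (ContinuousLinearMap.fst ℝ (Fin 2 → ℂ) (Fin 2 → ℂ))).intervalIntegral_comp_comm (hIf x hx)
    simp only [hYe x hx, hY0]
    exact congrArg (a i + ·) e.symm
  · have e := ((ContinuousLinearMap.proj (R := ℝ) (φ := fun _ : Fin 2 => ℂ) i).comp
      (ContinuousLinearMap.snd ℝ (Fin 2 → ℂ) (Fin 2 → ℂ))).intervalIntegral_comp_comm (hIf x hx)
    simp only [hYe x hx, hY0]
    exact congrArg (b i + ·) e.symm

end Solutions

/-! ### Boundary matrices, and Weyl matrices as boundary data -/

theorem bcS_coe (a : ℂ) :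
    bcS (a : OnePoint ℂ) = ((1 / Real.sqrt (1 + ‖a‖ ^ 2) : ℝ) : ℂ) • 1 := rfl

theorem bcC_coe (a : ℂ) : bcC (a : OnePoint ℂ) =
    ((1 / Real.sqrt (1 + ‖a‖ ^ 2) : ℝ) : ℂ) • !![0, a; conj a, 0] := by
  change ((1 / Real.sqrt (1 + ‖a‖ ^ 2) : ℝ) : ℂ) • (eps * bcA a) = _
  congr 1
  ext i j
  fin_cases i <;> fin_cases j <;> simp [eps, bcA, Matrix.mul_apply, Fin.sum_univ_two]

theorem isBoundaryPair_bc (α : OnePoint ℂ) : IsBoundaryPair (bcC α) (bcS α) := by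
  induction α using OnePoint.rec with
  | infty =>
    have hC : bcC OnePoint.infty = eps := rfl
    have hS : bcS OnePoint.infty = 0 := rfl
    rw [hC, hS]
    refine ⟨?_, by simp, by simp, ?_⟩ <;> ext i j <;> fin_cases i <;> fin_cases j <;>
      simp [eps]
  | coe a =>
    rw [bcC_coe, bcS_coe]
    set s : ℝ := 1 / Real.sqrt (1 + ‖a‖ ^ 2) with hs
    have hsq : (s : ℂ) * s * (1 + a * conj a) = 1 := by
      rw [Complex.mul_conj, Complex.normSq_eq_norm_sq]
      norm_cast
      have h0 : 0 < 1 + ‖a‖ ^ 2 := by positivity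
      have h1 := Real.sq_sqrt h0.le
      have h2 := (Real.sqrt_pos.2 h0).ne'
      rw [hs]
      field_simp
      linarith
    refine ⟨?_, ?_, ?_, ?_⟩
    · ext i j
      fin_cases i <;> fin_cases j <;> simp
    · ext i j
      fin_cases i <;> fin_cases j <;> simp
    · simp
    · ext i j
      fin_cases i <;> fin_cases j <;> simp <;>
        linear_combination hsq

theorem fin_two_add_add (i : Fin 2) : i + 1 + 1 = i := by
  fin_cases i <;> rfl

section Weyl

variable {Q : ℝ → Matrix (Fin 2) (Fin 2) ℂ} {α : OnePoint ℂ} {z : ℂ}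
  {M : Matrix (Fin 2) (Fin 2) ℂ}

theorem mulVec_single_one_eq (A : Matrix (Fin 2) (Fin 2) ℂ) (i j : Fin 2) :
    (A *ᵥ Pi.single j 1) i = A i j := by simp

/-- `M` is determined by square-integrable solutions with the boundary values `C a + S b = e_j`. -/
theorem isWeylMatrix_of_rel (hm : ∀ i j, Measurable fun x => Q x i j) {K : ℝ}
    (hK : ∀ x i j, ‖Q x i j‖ ≤ K) {T : L2Space →L[ℂ] L2Space}
    (hTs : ∀ u w, inner ℂ (T u) w = inner ℂ u (T w))
    (hT : ∀ (u : L2Space) (V : Fin 2 → ℝ → ℂ), (∀ i, u i =ᵐ[halfLine] V i) →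
      ∀ i, T u i =ᵐ[halfLine] fun t => ∑ j, Q t i j * V j t)
    (hrel : ∀ j, ∃ u a b, (u, z • u, a, b) ∈ (freeRelation.perturb T hTs).rel ∧
      bcC α *ᵥ a + bcS α *ᵥ b = Pi.single j 1 ∧ bcC α *ᵥ b - bcS α *ᵥ a = fun i => M i j) :
    IsWeylMatrix Q α z M := by
  have hp := isBoundaryPair_bc α
  choose u a b hu hbc hM using hrel
  simp only [BoundaryRelation.mem_perturb, mem_freeRelation] at hu
  choose V V' G hV huV hG ha hb using hu
  choose Φ Φ' hΦ hΦ0 hΦ0' using fun j : Fin 2 => exists_isSolution hm hK z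
    (fun i => bcS α i j) (fun i => -bcC α (i + 1) j)
  have hPΦ := fun j => (isSolution_iff hm hK).1 (hΦ j)
  have hsol : ∀ j i, IsPrimitive (V j i) (V' j i) ∧ IsPrimitive (V' j i)
      fun x => (Q x *ᵥ (fun i => V j i x) - z • fun i => V j i x) (i + 1) := by
    intro j i
    refine ⟨(hV j i).prim, ?_⟩
    have hGe : G j i =ᵐ[halfLine]
        fun x => (Q x *ᵥ (fun i => V j i x) - z • fun i => V j i x) (i + 1) := by
      filter_upwards [hG j (i + 1), hT (u j) (V j) (huV j) (i + 1), huV j (i + 1),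
        coeFn_sub_L2 (z • u j) (T (u j)) (i + 1), coeFn_smul_L2 z (u j) (i + 1)]
        with x h1 h2 h3 h4 h5
      rw [h1, h5, h2, h3, fin_two_add_add] at h4
      simp only [Pi.sub_apply, Pi.smul_apply, Matrix.mulVec, dotProduct, smul_eq_mul]
      linear_combination -h4
    refine ⟨fun x hx => intervalIntegrable_potential (F := fun x i => V j i x) hm hK hx
      (fun k => (hV j k).prim.continuousOn) (i + 1), fun x hx => ?_⟩
    rw [(hV j i).prim'.eq x hx]
    congr 1
    refine intervalIntegral.integral_congr_ae ?_
    rw [halfLine, EventuallyEq, ae_restrict_iff' measurableSet_Ioi] at hGe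
    filter_upwards [hGe] with t ht h0
    rw [uIoc_of_le hx] at h0
    exact ht h0.1
  have hrec := fun j => hp.recover (a j) (b j)
  simp only [hbc, hM] at hrec
  -- `Θ` is defined as `V + Φ M`, so `Θ - Φ M = V` is square integrable by construction. Its initial
  -- values follow from `recover`, which gives `a = C e_j - S M e_j` and `b = S e_j + C M e_j`.
  refine ⟨fun x => Matrix.of fun i j => Φ j x i, fun x => Matrix.of fun i j => Φ' j x i,
    fun x => Matrix.of fun i j => V j i x + ∑ k, M k j * Φ k x i,
    fun x => Matrix.of fun i j => V' j i x + ∑ k, M k j * Φ' k x i,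
    hΦ, ?_, ?_, fun j => ?_, ?_, ?_, fun i j => ?_⟩
  · ext i j
    simp [hΦ0]
  · ext i j
    have e : (eps * Matrix.of fun i j => Φ' j 0 i) i j = (eps *ᵥ Φ' j 0) i := rfl
    rw [e, eps_mulVec, hΦ0', Matrix.neg_apply]
    simp only [fin_two_add_add]
  · refine (isSolution_iff hm hK).2 fun i => ?_
    simp only [Matrix.of_apply, Fin.sum_univ_two]
    refine ⟨(hsol j i).1.add (((hPΦ 0 i).1.const_mul _).add ((hPΦ 1 i).1.const_mul _)), ?_⟩
    have h1 := (hsol j i).2.add (((hPΦ 0 i).2.const_mul (M 0 j)).add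
      ((hPΦ 1 i).2.const_mul (M 1 j)))
    refine h1.congr_right fun t _ => ?_
    simp only [Pi.sub_apply, Pi.smul_apply, Matrix.mulVec, dotProduct, smul_eq_mul,
      Fin.sum_univ_two]
    ring
  · ext i j
    have e := congrFun (hrec j).1 i
    rw [Pi.sub_apply, mulVec_single_one_eq] at e
    simp only [Matrix.of_apply, ← ha, e, hΦ0, Matrix.mulVec, dotProduct, mul_comm (M _ j)]
    ring
  · ext i j
    have e := congrFun (hrec j).2 i
    rw [Pi.add_apply, mulVec_single_one_eq] at e
    have e2 := eps_mulVec (fun i => V' j i 0 + ∑ k, M k j * Φ' k 0 i) i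
    have e3 : (eps * Matrix.of fun i j => V' j i 0 + ∑ k, M k j * Φ' k 0 i) i j =
      (eps *ᵥ fun i => V' j i 0 + ∑ k, M k j * Φ' k 0 i) i := rfl
    rw [e3, e2, ← hb, e]
    simp only [hΦ0', fin_two_add_add, Matrix.mulVec, dotProduct, Fin.sum_univ_two]
    ring
  · refine (hV j i).memLp.ae_eq (Eventually.of_forall fun x => ?_)
    simp only [Matrix.sub_apply, Matrix.of_apply, Matrix.mul_apply, mul_comm (M _ j)]
    ring

/-- The columns of the Weyl matrix come from elements of the perturbed relation. -/
theorem IsWeylMatrix.exists_rel (h : IsWeylMatrix Q α z M)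
    (hm : ∀ i j, Measurable fun x => Q x i j) {K : ℝ}
    (hK : ∀ x i j, ‖Q x i j‖ ≤ K) {T : L2Space →L[ℂ] L2Space}
    (hTs : ∀ u w, inner ℂ (T u) w = inner ℂ u (T w))
    (hT : ∀ (u : L2Space) (V : Fin 2 → ℝ → ℂ), (∀ i, u i =ᵐ[halfLine] V i) →
      ∀ i, T u i =ᵐ[halfLine] fun t => ∑ j, Q t i j * V j t) (j : Fin 2) :
    ∃ u a b, (u, z • u, a, b) ∈ (freeRelation.perturb T hTs).rel ∧
      bcC α *ᵥ a + bcS α *ᵥ b = Pi.single j 1 ∧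
      bcC α *ᵥ b - bcS α *ᵥ a = fun i => M i j := by
  have hp := isBoundaryPair_bc α
  obtain ⟨Φ, Φ', Θ, Θ', hΦ, hΦ0, hΦ0', hΘ, hΘ0, hΘ0', hL⟩ := h
  have hPΦ := fun j => (isSolution_iff hm hK).1 (hΦ j)
  have hPΘ := (isSolution_iff hm hK).1 (hΘ j)
  let V : Fin 2 → ℝ → ℂ := fun i x => Θ x i j + (-M 0 j * Φ x i 0 + -M 1 j * Φ x i 1)
  let V' : Fin 2 → ℝ → ℂ := fun i x => Θ' x i j + (-M 0 j * Φ' x i 0 + -M 1 j * Φ' x i 1)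
  have hV : ∀ i, MemLp (V i) 2 halfLine := fun i => by
    refine (hL i j).ae_eq (Eventually.of_forall fun x => ?_)
    simp only [V, Matrix.sub_apply, Matrix.mul_apply, Fin.sum_univ_two]
    ring
  set u := mkL2 V hV
  have hu := coeFn_mkL2 V hV
  let G : Fin 2 → ℝ → ℂ := fun i x => (Q x *ᵥ (fun i => V i x) - z • fun i => V i x) (i + 1)
  have hGu : ∀ i, (z • u - T u) i =ᵐ[halfLine] fun x => -G (i + 1) x := fun i => by
    filter_upwards [hT u V hu i, hu i, coeFn_sub_L2 (z • u) (T u) i, coeFn_smul_L2 z u i]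
      with x h2 h3 h4 h5
    rw [h4, h5, h2, h3]
    simp only [G, Pi.sub_apply, Pi.smul_apply, Matrix.mulVec, dotProduct, smul_eq_mul,
      fin_two_add_add]
    ring
  have hS : ∀ i, IsSobolev (V i) (V' i) (G i) := fun i => by
    refine ⟨(hPΘ i).1.add (((hPΦ 0 i).1.const_mul _).add ((hPΦ 1 i).1.const_mul _)), ?_, hV i, ?_⟩
    · have h1 := (hPΘ i).2.add (((hPΦ 0 i).2.const_mul (-M 0 j)).add
        ((hPΦ 1 i).2.const_mul (-M 1 j)))
      refine h1.congr_right fun t _ => ?_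
      simp only [G, V, Pi.sub_apply, Pi.smul_apply, Matrix.mulVec, dotProduct, smul_eq_mul,
        Fin.sum_univ_two]
      ring
    · have h1 := (Lp.memLp ((z • u - T u) (i + 1))).ae_eq (hGu (i + 1))
      simp only [fin_two_add_add] at h1
      exact h1.neg.ae_eq (Eventually.of_forall fun x => neg_neg _)
  have ha : (fun i => V i 0) = bcC α *ᵥ Pi.single j 1 - bcS α *ᵥ fun i => M i j := by
    funext i
    rw [Pi.sub_apply, mulVec_single_one_eq]
    simp only [V, hΘ0, hΦ0, Matrix.mulVec, dotProduct, Fin.sum_univ_two]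
    ring
  have hb : (fun i => V' (i + 1) 0) = bcS α *ᵥ Pi.single j 1 + bcC α *ᵥ fun i => M i j := by
    funext i
    rw [Pi.add_apply, mulVec_single_one_eq]
    have e1 : ∀ k, Φ' 0 (i + 1) k = -bcC α i k := fun k => by
      rw [← eps_mulVec (fun i => Φ' 0 i k)]
      exact congrFun (congrFun hΦ0' i) k
    have e2 : Θ' 0 (i + 1) j = bcS α i j := by
      rw [← eps_mulVec (fun i => Θ' 0 i j)]
      exact congrFun (congrFun hΘ0' i) j
    simp only [V', e1, e2, Matrix.mulVec, dotProduct, Fin.sum_univ_two]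
    ring
  have hsq : ∀ x : Fin 2 → ℂ, bcC α *ᵥ (bcC α *ᵥ x) + bcS α *ᵥ (bcS α *ᵥ x) = x := fun x => by
    rw [Matrix.mulVec_mulVec, Matrix.mulVec_mulVec, ← Matrix.add_mulVec, hp.sq, Matrix.one_mulVec]
  have hcm : ∀ x : Fin 2 → ℂ, bcC α *ᵥ (bcS α *ᵥ x) = bcS α *ᵥ (bcC α *ᵥ x) := fun x => by
    rw [Matrix.mulVec_mulVec, Matrix.mulVec_mulVec, hp.comm]
  refine ⟨u, fun i => V i 0, fun i => V' (i + 1) 0, ?_, ?_, ?_⟩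
  · rw [BoundaryRelation.mem_perturb, mem_freeRelation]
    exact ⟨V, V', G, hS, hu, hGu, fun _ => rfl, fun _ => rfl⟩
  · rw [ha, hb]
    simp only [Matrix.mulVec_add, Matrix.mulVec_sub]
    rw [hcm (fun i => M i j)]
    conv_rhs => rw [← hsq (Pi.single j 1)]
    abel
  · rw [ha, hb]
    simp only [Matrix.mulVec_add, Matrix.mulVec_sub]
    rw [hcm (Pi.single j 1)]
    conv_rhs => rw [← hsq (fun i => M i j)]
    abel

end Weyl

/-! ### High-energy estimates for the boundary data -/

section Columns

variable {T : L2Space →L[ℂ] L2Space} {hTs : ∀ u w, inner ℂ (T u) w = inner ℂ u (T w)}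
  {u : L2Space} {a b : Fin 2 → ℂ} {r : ℝ}

/-- The sum of the absolute values of the boundary data. -/
def boundarySize (a b : Fin 2 → ℂ) : ℝ := ‖a 0‖ + ‖a 1‖ + (‖b 0‖ + ‖b 1‖)

/-- In Green's identity for `u` with itself the symmetric perturbation drops out, and `4r²‖u‖²` is
the modulus of the boundary form, which is at most the square of `boundarySize a b`. -/
theorem norm_le_boundarySize_div (hr : 1 ≤ r)
    (h : (u, ((2 * r ^ 2 : ℝ) * Complex.I : ℂ) • u, a, b) ∈ (freeRelation.perturb T hTs).rel) :
    ‖u‖ ≤ boundarySize a b / r := by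
  have hr0 : 0 < r := by linarith
  have e := (freeRelation.perturb T hTs).green h h
  rw [inner_smul_left, inner_smul_right, inner_self_eq_norm_sq_to_K] at e
  have e1 : star a ⬝ᵥ b - star b ⬝ᵥ a =
      conj (a 0) * b 0 + conj (a 1) * b 1 - (conj (b 0) * a 0 + conj (b 1) * a 1) := by
    simp [dotProduct, Fin.sum_univ_two]
  rw [e1] at e
  have e2 : ‖(((2 * r ^ 2 : ℝ) * Complex.I : ℂ) * (‖u‖ : ℂ) ^ 2 -
      conj ((2 * r ^ 2 : ℝ) * Complex.I : ℂ) * (‖u‖ : ℂ) ^ 2)‖ = (2 * r * ‖u‖) ^ 2 := by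
    have : (((2 * r ^ 2 : ℝ) * Complex.I : ℂ) * (‖u‖ : ℂ) ^ 2 -
      conj ((2 * r ^ 2 : ℝ) * Complex.I : ℂ) * (‖u‖ : ℂ) ^ 2) =
        (((2 * r * ‖u‖) ^ 2 : ℝ) : ℂ) * Complex.I := by
      simp only [map_mul, Complex.conj_ofReal, Complex.conj_I]
      push_cast
      ring
    rw [this, norm_mul, Complex.norm_I, mul_one, Complex.norm_real, Real.norm_of_nonneg (sq_nonneg _)]
  have e3 := congrArg norm e
  have e4 : (2 * r * ‖u‖) ^ 2 ≤ (boundarySize a b) ^ 2 := by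
    rw [← e2]
    refine e3.le.trans ?_
    have n1 := norm_sub_le (conj (a 0) * b 0 + conj (a 1) * b 1) (conj (b 0) * a 0 + conj (b 1) * a 1)
    have n2 := norm_add_le (conj (a 0) * b 0) (conj (a 1) * b 1)
    have n3 := norm_add_le (conj (b 0) * a 0) (conj (b 1) * a 1)
    simp only [norm_mul, RCLike.norm_conj] at n2 n3
    unfold boundarySize
    nlinarith [norm_nonneg (a 0), norm_nonneg (a 1), norm_nonneg (b 0), norm_nonneg (b 1),
      mul_nonneg (norm_nonneg (a 0)) (norm_nonneg (b 0)),
      mul_nonneg (norm_nonneg (a 0)) (norm_nonneg (b 1)),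
      mul_nonneg (norm_nonneg (a 1)) (norm_nonneg (b 0)),
      mul_nonneg (norm_nonneg (a 1)) (norm_nonneg (b 1)),
      mul_nonneg (norm_nonneg (a 0)) (norm_nonneg (a 1)),
      mul_nonneg (norm_nonneg (b 0)) (norm_nonneg (b 1)),
      sq_nonneg (‖a 0‖), sq_nonneg (‖a 1‖), sq_nonneg (‖b 0‖), sq_nonneg (‖b 1‖)]
  have hN : 0 ≤ boundarySize a b := by unfold boundarySize; positivity
  have e5 := abs_le_of_sq_le_sq e4 hN
  rw [le_div_iff₀ hr0]
  have := le_of_abs_le e5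
  nlinarith [mul_nonneg hr0.le (norm_nonneg u)]

/-- The exponents `κ = r(1 - i)` for `s = 1` and `κ = r(1 + i)` for `s = -1` satisfy `s κ² = -z`
with `z = 2ir²`. The free part therefore cancels in `norm_boundary_le`, and only `-T u` remains on
the right. -/
theorem norm_combination_le (hr : 1 ≤ r)
    (h : (u, ((2 * r ^ 2 : ℝ) * Complex.I : ℂ) • u, a, b) ∈ (freeRelation.perturb T hTs).rel) :
    ‖b 0 + b 1 + r * (1 - Complex.I) * (a 0 + a 1)‖ ≤ ‖T‖ * (boundarySize a b / r) ∧
    ‖b 0 - b 1 - r * (1 + Complex.I) * (a 0 - a 1)‖ ≤ ‖T‖ * (boundarySize a b / r) := by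
  have hr0 : 0 < r := by linarith
  have hu := norm_le_boundarySize_div hr h
  have hsq : (Real.sqrt r)⁻¹ ≤ 1 := inv_le_one_of_one_le₀ (Real.one_le_sqrt.2 hr)
  rw [BoundaryRelation.mem_perturb] at h
  have fin : (Real.sqrt r)⁻¹ * ‖T u‖ ≤ ‖T‖ * (boundarySize a b / r) :=
    (mul_le_of_le_one_left (norm_nonneg _) hsq).trans
      ((T.le_opNorm u).trans (mul_le_mul_of_nonneg_left hu (norm_nonneg _)))
  have re1 : ((r : ℂ) * (1 - Complex.I)).re = r := by simp
  have re2 : ((r : ℂ) * (1 + Complex.I)).re = r := by simp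
  constructor
  · have k := norm_boundary_le h (κ := r * (1 - Complex.I)) (by rw [re1]; exact hr0)
      (s := 1) (by norm_num)
    have e : ((2 * r ^ 2 : ℝ) * Complex.I : ℂ) • u - T u +
        (((1 : ℝ) : ℂ) * (r * (1 - Complex.I)) ^ 2) • u = -T u := by
      have : (((1 : ℝ) : ℂ) * (r * (1 - Complex.I)) ^ 2) = -((2 * r ^ 2 : ℝ) * Complex.I : ℂ) := by
        push_cast
        linear_combination (r : ℂ) ^ 2 * Complex.I_sq
      rw [this]
      module
    rw [e, norm_neg, re1] at k
    refine le_trans (le_of_eq ?_) (k.trans fin)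
    congr 1
    push_cast
    ring
  · have k := norm_boundary_le h (κ := r * (1 + Complex.I)) (by rw [re2]; exact hr0)
      (s := -1) (by norm_num)
    have e : ((2 * r ^ 2 : ℝ) * Complex.I : ℂ) • u - T u +
        (((-1 : ℝ) : ℂ) * (r * (1 + Complex.I)) ^ 2) • u = -T u := by
      have : (((-1 : ℝ) : ℂ) * (r * (1 + Complex.I)) ^ 2) = -((2 * r ^ 2 : ℝ) * Complex.I : ℂ) := by
        push_cast
        linear_combination (-(r : ℂ) ^ 2) * Complex.I_sq
      rw [this]
      module
    rw [e, norm_neg, re2] at k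
    refine le_trans (le_of_eq ?_) (k.trans fin)
    congr 1
    push_cast
    ring

theorem norm_one_sub_I : ‖(1 : ℂ) - Complex.I‖ = Real.sqrt 2 := by
  rw [Complex.norm_def]; norm_num [Complex.normSq_apply]

theorem norm_one_add_I : ‖(1 : ℂ) + Complex.I‖ = Real.sqrt 2 := by
  rw [Complex.norm_def]; norm_num [Complex.normSq_apply]

theorem norm_fst_le_of_sum_diff (x y : ℂ) :
    ‖x‖ ≤ (‖x + y‖ + ‖x - y‖) / 2 ∧ ‖y‖ ≤ (‖x + y‖ + ‖x - y‖) / 2 := by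
  have h1 := norm_add_le (x + y) (x - y)
  have h2 := norm_sub_le (x + y) (x - y)
  rw [show x + y + (x - y) = (2 : ℂ) * x by ring, norm_mul, Complex.norm_ofNat] at h1
  rw [show x + y - (x - y) = (2 : ℂ) * y by ring, norm_mul, Complex.norm_ofNat] at h2
  constructor <;> linarith

/-- Boundary data of a solution with Dirichlet data `e_j`. -/
theorem norm_sub_le_dirichlet (hr : 1 ≤ r) (hrT : 4 * ‖T‖ ≤ r)
    (h : (u, ((2 * r ^ 2 : ℝ) * Complex.I : ℂ) • u, a, b) ∈ (freeRelation.perturb T hTs).rel)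
    {j : Fin 2} (ha : a = Pi.single j 1) (i : Fin 2) :
    ‖b i - r * (if i = j then Complex.I else -1)‖ ≤ 10 * ‖T‖ := by
  have hr0 : 0 < r := by linarith
  obtain ⟨h1, h2⟩ := norm_combination_le hr h
  set N := boundarySize a b with hN
  have hs2 : Real.sqrt 2 ≤ 2 := Real.sqrt_le_iff.2 (by norm_num)
  have hsum : a 0 + a 1 = 1 := by
    rw [ha]; fin_cases j <;> simp
  have hdiff : ‖a 0 - a 1‖ = 1 := by
    rw [ha]; fin_cases j <;> simp
  have hA : ‖a 0‖ + ‖a 1‖ = 1 := by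
    rw [ha]; fin_cases j <;> simp
  have hτ := norm_nonneg T
  have nb1 : ‖b 0 + b 1‖ ≤ 2 * r + ‖T‖ * (N / r) := by
    have := norm_sub_le (b 0 + b 1 + r * (1 - Complex.I) * (a 0 + a 1))
      (r * (1 - Complex.I) * (a 0 + a 1))
    rw [add_sub_cancel_right, hsum, mul_one, norm_mul, norm_one_sub_I, Complex.norm_real,
      Real.norm_of_nonneg hr0.le] at this
    rw [hsum, mul_one] at h1
    nlinarith
  have nb2 : ‖b 0 - b 1‖ ≤ 2 * r + ‖T‖ * (N / r) := by
    have := norm_add_le (b 0 - b 1 - r * (1 + Complex.I) * (a 0 - a 1))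
      (r * (1 + Complex.I) * (a 0 - a 1))
    rw [sub_add_cancel, norm_mul, norm_mul, hdiff, mul_one, norm_one_add_I, Complex.norm_real,
      Real.norm_of_nonneg hr0.le] at this
    nlinarith
  obtain ⟨n0, n1⟩ := norm_fst_le_of_sum_diff (b 0) (b 1)
  -- Absorption: the error `E` is at most `N/4`, while `N ≤ 1 + 4r + 2E`. Hence `N ≤ 2 + 8r ≤ 10r`,
  -- the source of the constant `10`.
  have hE : ‖T‖ * (N / r) ≤ N / 4 := by
    have hN0 : 0 ≤ N := by rw [hN]; unfold boundarySize; positivity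
    rw [← mul_div_assoc, div_le_iff₀ hr0]
    nlinarith
  have hN10 : N ≤ 10 * r := by
    have : N = 1 + (‖b 0‖ + ‖b 1‖) := by rw [hN, boundarySize, hA]
    linarith
  have hE10 : ‖T‖ * (N / r) ≤ 10 * ‖T‖ := by
    rw [mul_comm 10]
    refine mul_le_mul_of_nonneg_left ?_ hτ
    rwa [div_le_iff₀ hr0]
  have key : ∀ x y : ℂ, b 0 + b 1 + r * (1 - Complex.I) * (a 0 + a 1) = (b 0 - x) + (b 1 - y) →
      b 0 - b 1 - r * (1 + Complex.I) * (a 0 - a 1) = (b 0 - x) - (b 1 - y) →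
      ‖b 0 - x‖ ≤ 10 * ‖T‖ ∧ ‖b 1 - y‖ ≤ 10 * ‖T‖ := by
    intro x y e1 e2
    rw [e1] at h1
    rw [e2] at h2
    obtain ⟨m0, m1⟩ := norm_fst_le_of_sum_diff (b 0 - x) (b 1 - y)
    constructor <;> linarith
  have h01 : (0 : Fin 2) ≠ 1 := by decide
  fin_cases j
  · have := key (r * Complex.I) (r * (-1)) (by rw [ha]; simp; ring) (by rw [ha]; simp; ring)
    fin_cases i
    · simpa using this.1
    · simpa using this.2
  · have := key (r * (-1)) (r * Complex.I) (by rw [ha]; simp; ring) (by rw [ha]; simp; ring)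
    fin_cases i
    · simpa using this.1
    · simpa using this.2

/-- A priori bounds for the boundary data of a solution with the boundary condition
`b + [[0, α], [conj α, 0]] a = c e_j`. -/
theorem exists_boundarySize_le_robin (T : L2Space →L[ℂ] L2Space)
    (hTs : ∀ u w, inner ℂ (T u) w = inner ℂ u (T w)) (α : ℂ) {c : ℝ} (hc : 1 ≤ c) (hαc : ‖α‖ ≤ c) :
    ∃ K R : ℝ, 1 ≤ R ∧ ∀ (r : ℝ) (u : L2Space) (a b : Fin 2 → ℂ) (j : Fin 2), R ≤ r →
      (u, ((2 * r ^ 2 : ℝ) * Complex.I : ℂ) • u, a, b) ∈ (freeRelation.perturb T hTs).rel →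
      b 0 + α * a 1 = (if j = 0 then (c : ℂ) else 0) →
      b 1 + conj α * a 0 = (if j = 1 then (c : ℂ) else 0) →
      ‖T‖ * (boundarySize a b / r) + (‖α * a 1‖ + ‖conj α * a 0‖) ≤ K / r := by
  set τ := ‖T‖ with hτd
  have hτ : 0 ≤ τ := norm_nonneg T
  -- With `A = |a₀| + |a₁|`, the boundary condition gives `N ≤ c + (1 + c)A`, and the test
  -- inequalities give `rA ≤ k₁ + k₂A`. For `r ≥ 2k₂` the last term is absorbed, so `A ≤ 2k₁/r`;
  -- then `k₃` bounds `N`.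
  obtain ⟨k₁, hk₁⟩ : ∃ k : ℝ, k = 2 * c + 2 * τ * c := ⟨_, rfl⟩
  obtain ⟨k₂, hk₂⟩ : ∃ k : ℝ, k = 2 * c + 2 * τ * (1 + c) := ⟨_, rfl⟩
  obtain ⟨k₃, hk₃⟩ : ∃ k : ℝ, k = c + (1 + c) * (2 * k₁) := ⟨_, rfl⟩
  have hk₁0 : 0 ≤ k₁ := by rw [hk₁]; positivity
  have hk₃0 : 0 ≤ k₃ := by rw [hk₃]; positivity
  refine ⟨τ * k₃ + c * (2 * k₁), max 1 (2 * k₂), le_max_left _ _,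
    fun r u a b j hR h hb0 hb1 => ?_⟩
  have hr : 1 ≤ r := (le_max_left _ _).trans hR
  have hr2 : 2 * k₂ ≤ r := (le_max_right _ _).trans hR
  have hr0 : 0 < r := by linarith
  obtain ⟨h1, h2⟩ := norm_combination_le hr h
  set N := boundarySize a b with hN
  set A := ‖a 0‖ + ‖a 1‖ with hA
  have hA0 : 0 ≤ A := by positivity
  have hNA : N = A + (‖b 0‖ + ‖b 1‖) := rfl
  have nα1 : ‖α * a 1‖ ≤ c * ‖a 1‖ := by
    rw [norm_mul]; exact mul_le_mul_of_nonneg_right hαc (norm_nonneg _)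
  have nα0 : ‖conj α * a 0‖ ≤ c * ‖a 0‖ := by
    rw [norm_mul, RCLike.norm_conj]; exact mul_le_mul_of_nonneg_right hαc (norm_nonneg _)
  have nb0 : ‖b 0‖ ≤ ‖(if j = 0 then (c : ℂ) else 0)‖ + c * ‖a 1‖ := by
    rw [← hb0]
    have := norm_sub_le (b 0 + α * a 1) (α * a 1)
    rw [add_sub_cancel_right] at this
    linarith
  have nb1 : ‖b 1‖ ≤ ‖(if j = 1 then (c : ℂ) else 0)‖ + c * ‖a 0‖ := by
    rw [← hb1]
    have := norm_sub_le (b 1 + conj α * a 0) (conj α * a 0)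
    rw [add_sub_cancel_right] at this
    linarith
  have hcn : ‖(c : ℂ)‖ = c := by rw [Complex.norm_real, Real.norm_of_nonneg (by linarith)]
  have hite : ‖(if j = 0 then (c : ℂ) else 0)‖ + ‖(if j = 1 then (c : ℂ) else 0)‖ = c := by
    fin_cases j <;> simp [abs_of_nonneg (by linarith : 0 ≤ c)]
  have hB : ‖b 0‖ + ‖b 1‖ ≤ c + c * A := by
    rw [hA]; linarith
  have hs2 : 1 ≤ Real.sqrt 2 := Real.one_le_sqrt.2 (by norm_num)
  have hbp := norm_add_le (b 0) (b 1)
  have hbm := norm_sub_le (b 0) (b 1)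
  have na1 : r * ‖a 0 + a 1‖ ≤ ‖b 0‖ + ‖b 1‖ + τ * (N / r) := by
    have := norm_sub_le (b 0 + b 1 + r * (1 - Complex.I) * (a 0 + a 1)) (b 0 + b 1)
    rw [add_sub_cancel_left, norm_mul, norm_mul, norm_one_sub_I, Complex.norm_real,
      Real.norm_of_nonneg hr0.le] at this
    have h3 : r * ‖a 0 + a 1‖ ≤ r * Real.sqrt 2 * ‖a 0 + a 1‖ := by
      nlinarith [mul_nonneg hr0.le (norm_nonneg (a 0 + a 1))]
    linarith
  have na2 : r * ‖a 0 - a 1‖ ≤ ‖b 0‖ + ‖b 1‖ + τ * (N / r) := by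
    have := norm_sub_le (b 0 - b 1) (b 0 - b 1 - r * (1 + Complex.I) * (a 0 - a 1))
    rw [sub_sub_cancel, norm_mul, norm_mul, norm_one_add_I, Complex.norm_real,
      Real.norm_of_nonneg hr0.le] at this
    have h3 : r * ‖a 0 - a 1‖ ≤ r * Real.sqrt 2 * ‖a 0 - a 1‖ := by
      nlinarith [mul_nonneg hr0.le (norm_nonneg (a 0 - a 1))]
    linarith
  obtain ⟨n0, n1⟩ := norm_fst_le_of_sum_diff (a 0) (a 1)
  have hN0 : 0 ≤ N := by rw [hNA]; positivity
  have hNle : N ≤ c + (1 + c) * A := by rw [hNA]; linarith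
  have hNr : N / r ≤ N := div_le_self hN0 hr
  have hrA : r * A ≤ k₁ + k₂ * A := by
    have e1 : r * A ≤ 2 * (‖b 0‖ + ‖b 1‖ + τ * (N / r)) := by
      have := mul_le_mul_of_nonneg_left (add_le_add n0 n1) hr0.le
      rw [← hA] at this
      linarith
    have e2 : τ * (N / r) ≤ τ * (c + (1 + c) * A) :=
      mul_le_mul_of_nonneg_left (hNr.trans hNle) hτ
    have e3 : k₁ + k₂ * A = 2 * ((c + c * A) + τ * (c + (1 + c) * A)) := by rw [hk₁, hk₂]; ring
    rw [e3]
    linarith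
  have hAr : r * A ≤ 2 * k₁ := by
    have := mul_le_mul_of_nonneg_right hr2 hA0
    linarith
  have hA2 : A ≤ 2 * k₁ / r := by rw [le_div_iff₀ hr0]; linarith
  have hN3 : N ≤ k₃ := by
    have h3 : A ≤ 2 * k₁ := (le_mul_of_one_le_left hA0 hr).trans hAr
    have := mul_le_mul_of_nonneg_left h3 (by linarith : 0 ≤ 1 + c)
    rw [hk₃]
    linarith
  have hE : τ * (N / r) ≤ τ * k₃ / r := by
    rw [mul_div_assoc]
    exact mul_le_mul_of_nonneg_left (div_le_div_of_nonneg_right hN3 hr0.le) hτ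
  have hcA : ‖α * a 1‖ + ‖conj α * a 0‖ ≤ c * (2 * k₁) / r := by
    rw [mul_div_assoc]
    have := mul_le_mul_of_nonneg_left hA2 (by linarith : 0 ≤ c)
    rw [hA] at this
    linarith
  rw [add_div]
  exact add_le_add hE hcA

/-- Boundary data of a solution with the boundary condition `b + [[0, α], [conj α, 0]] a = c e_j`. -/
theorem norm_add_le_robin (hr : 1 ≤ r) {α : ℂ} {c : ℝ} {j : Fin 2}
    (h : (u, ((2 * r ^ 2 : ℝ) * Complex.I : ℂ) • u, a, b) ∈ (freeRelation.perturb T hTs).rel)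
    (hb0 : b 0 + α * a 1 = (if j = 0 then (c : ℂ) else 0))
    (hb1 : b 1 + conj α * a 0 = (if j = 1 then (c : ℂ) else 0)) {B : ℝ}
    (hB : ‖T‖ * (boundarySize a b / r) + (‖α * a 1‖ + ‖conj α * a 0‖) ≤ B) (i : Fin 2) :
    ‖r * a i + c / 2 * (if i = j then Complex.I else 1)‖ ≤ B := by
  obtain ⟨h1, h2⟩ := norm_combination_le hr h
  have half_norm : ∀ w x : ℂ, ‖w‖ = Real.sqrt 2 → ‖x‖ ≤ ‖w * x‖ := fun w x hw => by
    rw [norm_mul, hw]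
    exact le_mul_of_one_le_left (norm_nonneg x) (Real.one_le_sqrt.2 (by norm_num))
  set δ₀ : ℂ := if j = 0 then (c : ℂ) else 0 with hδ₀
  set δ₁ : ℂ := if j = 1 then (c : ℂ) else 0 with hδ₁
  have kp : ‖r * (a 0 + a 1) + (1 + Complex.I) / 2 * (δ₀ + δ₁)‖ ≤
      B := by
    refine (half_norm (1 - Complex.I) _ norm_one_sub_I).trans ?_
    have e : (1 - Complex.I) * (r * (a 0 + a 1) + (1 + Complex.I) / 2 * (δ₀ + δ₁)) =
        (b 0 + b 1 + r * (1 - Complex.I) * (a 0 + a 1)) + (α * a 1 + conj α * a 0) := by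
      rw [← hb0, ← hb1]
      linear_combination (-(1 / 2 : ℂ) * (b 0 + α * a 1 + (b 1 + conj α * a 0))) * Complex.I_sq
    rw [e]
    have t1 := norm_add_le (b 0 + b 1 + r * (1 - Complex.I) * (a 0 + a 1)) (α * a 1 + conj α * a 0)
    have t2 := norm_add_le (α * a 1) (conj α * a 0)
    linarith
  have km : ‖r * (a 0 - a 1) - (1 - Complex.I) / 2 * (δ₀ - δ₁)‖ ≤
      B := by
    refine (half_norm (1 + Complex.I) _ norm_one_add_I).trans ?_
    have e : (1 + Complex.I) * (r * (a 0 - a 1) - (1 - Complex.I) / 2 * (δ₀ - δ₁)) =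
        -((b 0 - b 1 - r * (1 + Complex.I) * (a 0 - a 1)) + (α * a 1 - conj α * a 0)) := by
      rw [← hb0, ← hb1]
      linear_combination ((1 / 2 : ℂ) * (b 0 + α * a 1 - (b 1 + conj α * a 0))) * Complex.I_sq
    rw [e, norm_neg]
    have t1 := norm_add_le (b 0 - b 1 - r * (1 + Complex.I) * (a 0 - a 1)) (α * a 1 - conj α * a 0)
    have t2 := norm_sub_le (α * a 1) (conj α * a 0)
    linarith
  have key : ∀ x y : ℂ, (1 + Complex.I) / 2 * (δ₀ + δ₁) = x + y →
      -((1 - Complex.I) / 2 * (δ₀ - δ₁)) = x - y →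
      ‖r * a 0 + x‖ ≤ B ∧
        ‖r * a 1 + y‖ ≤ B := by
    intro x y e1 e2
    rw [e1, show r * (a 0 + a 1) + (x + y) = (r * a 0 + x) + (r * a 1 + y) by ring] at kp
    rw [sub_eq_add_neg, e2,
      show r * (a 0 - a 1) + (x - y) = (r * a 0 + x) - (r * a 1 + y) by ring] at km
    obtain ⟨m0, m1⟩ := norm_fst_le_of_sum_diff (r * a 0 + x) (r * a 1 + y)
    constructor <;> linarith
  fin_cases j
  · have := key (c / 2 * Complex.I) (c / 2 * 1) (by simp [δ₀, δ₁]; ring) (by simp [δ₀, δ₁]; ring)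
    fin_cases i
    · simpa using this.1
    · simpa using this.2
  · have := key (c / 2 * 1) (c / 2 * Complex.I) (by simp [δ₀, δ₁]; ring) (by simp [δ₀, δ₁]; ring)
    fin_cases i
    · simpa using this.1
    · simpa using this.2

end Columns

/-! ### Asymptotics of `M` along the imaginary axis -/

section Limits

variable (T : L2Space →L[ℂ] L2Space) (hTs : ∀ u w, inner ℂ (T u) w = inner ℂ u (T w))
  (M : ℂ → Matrix (Fin 2) (Fin 2) ℂ)

theorem tendsto_sqrt_half_atTop : Tendsto (fun η : ℝ => Real.sqrt (η / 2)) atTop atTop :=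
  Real.tendsto_sqrt_atTop.comp (tendsto_id.atTop_div_const two_pos)

theorem two_mul_sq_sqrt_half {η : ℝ} (hη : 0 < η) : 2 * Real.sqrt (η / 2) ^ 2 = η := by
  rw [Real.sq_sqrt (by positivity)]; ring

theorem rpow_half_eq (η : ℝ) :
    η ^ (1 / 2 : ℝ) = Real.sqrt 2 * Real.sqrt (η / 2) := by
  rw [← Real.sqrt_eq_rpow, ← Real.sqrt_mul two_pos.le]
  congr 1
  ring

/-- Here `C = ε` and `S = 0`, so `a = e_(j+1)` and `M e_j = ε b`; the two index shifts cancel. With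
`η = 2r²` the deviation of `M` from its leading term stays bounded and disappears after
multiplication by `η^(-1/2)`. The subtracted `0` matches the form of the case `α ≠ ∞`. -/
theorem tendsto_weyl_dirichlet (hM : ∀ z : ℂ, z.im ≠ 0 → ∀ j, ∃ u a b,
      (u, z • u, a, b) ∈ (freeRelation.perturb T hTs).rel ∧
      bcC OnePoint.infty *ᵥ a + bcS OnePoint.infty *ᵥ b = Pi.single j 1 ∧
      bcC OnePoint.infty *ᵥ b - bcS OnePoint.infty *ᵥ a = fun i => M z i j) (i j : Fin 2) :
    Tendsto (fun η : ℝ => ((η ^ (-(1 / 2) : ℝ) : ℝ) : ℂ) * (M (η * Complex.I) i j - 0)) atTop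
      (𝓝 (((1 / Real.sqrt 2 : ℝ) : ℂ) * (if i = j then Complex.I else -1))) := by
  set x : ℂ := if i = j then Complex.I else -1
  have hb : ∀ᶠ η : ℝ in atTop,
      ‖M (η * Complex.I) i j - Real.sqrt (η / 2) * x‖ ≤ 10 * ‖T‖ := by
    filter_upwards [eventually_gt_atTop 0,
      tendsto_sqrt_half_atTop.eventually_ge_atTop (max 1 (4 * ‖T‖))] with η hη hr
    obtain ⟨u, a, b, h1, h2, h3⟩ := hM (η * Complex.I) (by simpa using hη.ne') j
    have hS : bcS OnePoint.infty = 0 := rfl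
    have hC : bcC OnePoint.infty = eps := rfl
    rw [hS, hC, Matrix.zero_mulVec, add_zero] at h2
    rw [hS, hC, Matrix.zero_mulVec, sub_zero] at h3
    have ha : a = Pi.single (j + 1) 1 := by
      funext k
      have e := congrFun h2 (k + 1)
      rw [eps_mulVec, fin_two_add_add] at e
      rw [e]
      fin_cases k <;> fin_cases j <;> simp
    have hbM : M (η * Complex.I) i j = b (i + 1) := by
      rw [← congrFun h3 i, eps_mulVec]
    rw [← two_mul_sq_sqrt_half hη] at h1
    have := norm_sub_le_dirichlet ((le_max_left _ _).trans hr) ((le_max_right _ _).trans hr) h1 ha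
      (i + 1)
    rw [hbM]
    simp only [add_left_inj] at this
    exact this
  have h0 : Tendsto (fun η : ℝ => ((η ^ (-(1 / 2) : ℝ) : ℝ) : ℂ)) atTop (𝓝 0) := by
    have := tendsto_rpow_neg_atTop (by norm_num : (0 : ℝ) < 1 / 2)
    exact_mod_cast (Complex.continuous_ofReal.tendsto 0).comp this
  have h1 := h0.zero_mul_isBoundedUnder_le (isBoundedUnder_of_eventually_le hb)
  have h2 := h1.add_const (((1 / Real.sqrt 2 : ℝ) : ℂ) * x)
  rw [zero_add] at h2
  refine h2.congr' ?_
  filter_upwards [eventually_gt_atTop 0] with η hη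
  have e : (((1 / Real.sqrt 2 : ℝ)) : ℂ) = ((η ^ (-(1 / 2) : ℝ) : ℝ) : ℂ) * Real.sqrt (η / 2) := by
    rw [← Complex.ofReal_mul, Real.rpow_neg hη.le, rpow_half_eq η]
    congr 1
    have : Real.sqrt (η / 2) ≠ 0 := (Real.sqrt_pos.2 (by positivity)).ne'
    field_simp
  rw [e]
  ring

/-- Let `K = [[0, α], [conj α, 0]]` and `c² = 1 + |α|²`. The boundary condition is `b = c e_j - K
a`, and `K² = |α|²`, so `M e_j = (K b - a)/c = K e_j - c a`. Once the constant `K` is removed, `M`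
is governed by the Dirichlet data `a`, which decay like `1/r`. -/
theorem tendsto_weyl_robin (α : ℂ) (hM : ∀ z : ℂ, z.im ≠ 0 → ∀ j, ∃ u a b,
      (u, z • u, a, b) ∈ (freeRelation.perturb T hTs).rel ∧
      bcC (α : OnePoint ℂ) *ᵥ a + bcS (α : OnePoint ℂ) *ᵥ b = Pi.single j 1 ∧
      bcC (α : OnePoint ℂ) *ᵥ b - bcS (α : OnePoint ℂ) *ᵥ a = fun i => M z i j) (i j : Fin 2) :
    Tendsto (fun η : ℝ => ((η ^ (-(-(1 / 2)) : ℝ) : ℝ) : ℂ) * (M (η * Complex.I) i j -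
        (!![0, α; conj α, 0] : Matrix (Fin 2) (Fin 2) ℂ) i j)) atTop
      (𝓝 ((((1 + ‖α‖ ^ 2) / Real.sqrt 2 : ℝ) : ℂ) * (if i = j then Complex.I else 1))) := by
  set x : ℂ := if i = j then Complex.I else 1
  set c := Real.sqrt (1 + ‖α‖ ^ 2) with hcd
  have hc : 1 ≤ c := Real.one_le_sqrt.2 (by nlinarith [sq_nonneg ‖α‖])
  have hαc : ‖α‖ ≤ c := Real.le_sqrt_of_sq_le (by linarith)
  have hcc : c ^ 2 = 1 + ‖α‖ ^ 2 := Real.sq_sqrt (by positivity)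
  have hc0 : (c : ℂ) ≠ 0 := by exact_mod_cast (by linarith : c ≠ 0)
  have hccC : (c : ℂ) ^ 2 = 1 + α * conj α := by
    rw [Complex.mul_conj, Complex.normSq_eq_norm_sq]
    exact_mod_cast hcc
  obtain ⟨K, R, hR, hK⟩ := exists_boundarySize_le_robin T hTs α hc hαc
  set k₀ := (!![0, α; conj α, 0] : Matrix (Fin 2) (Fin 2) ℂ) i j with hk₀
  have hb : ∀ᶠ η : ℝ in atTop, ‖Real.sqrt (η / 2) * (M (η * Complex.I) i j - k₀) -
      c ^ 2 / 2 * x‖ ≤ c * K / Real.sqrt (η / 2) := by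
    filter_upwards [eventually_gt_atTop 0, tendsto_sqrt_half_atTop.eventually_ge_atTop R]
      with η hη hr
    obtain ⟨u, a, b, h1, h2, h3⟩ := hM (η * Complex.I) (by simpa using hη.ne') j
    set r := Real.sqrt (η / 2)
    rw [← two_mul_sq_sqrt_half hη] at h1
    have e0 := congrFun h2 0
    have e1 := congrFun h2 1
    rw [bcC_coe, bcS_coe] at e0 e1 h3
    have hcinv : ((1 / c : ℝ) : ℂ) = (c : ℂ)⁻¹ := by push_cast; rw [one_div]
    rw [← hcd, hcinv] at e0 e1 h3
    simp only [Matrix.smul_mulVec, Matrix.one_mulVec, Pi.add_apply, Pi.smul_apply, smul_eq_mul,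
      Matrix.mulVec, dotProduct, Fin.sum_univ_two, Matrix.of_apply, Matrix.cons_val', Matrix.cons_val_zero,
      Matrix.cons_val_one, Matrix.cons_val_fin_one, zero_mul, zero_add, add_zero] at e0 e1
    have hb0 : b 0 + α * a 1 = (if j = 0 then (c : ℂ) else 0) := by
      have : b 0 + α * a 1 = c * (Pi.single j 1 : Fin 2 → ℂ) 0 := by
        rw [← e0]; field_simp; ring
      rw [this]; fin_cases j <;> simp
    have hb1 : b 1 + conj α * a 0 = (if j = 1 then (c : ℂ) else 0) := by
      have : b 1 + conj α * a 0 = c * (Pi.single j 1 : Fin 2 → ℂ) 1 := by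
        rw [← e1]; field_simp; ring
      rw [this]; fin_cases j <;> simp
    have hB := hK r u a b j hr h1 hb0 hb1
    have hfin := norm_add_le_robin (hR.trans hr) h1 hb0 hb1 hB i
    have hMa : M (η * Complex.I) i j - k₀ = -(c * a i) := by
      have e3 := congrFun h3 i
      simp only [Matrix.smul_mulVec, Matrix.one_mulVec, Pi.sub_apply, Pi.smul_apply, smul_eq_mul,
        Matrix.mulVec, dotProduct, Fin.sum_univ_two] at e3
      rw [← e3]
      have b0 : b 0 = (if j = 0 then (c : ℂ) else 0) - α * a 1 := by rw [← hb0]; ring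
      have b1 : b 1 = (if j = 1 then (c : ℂ) else 0) - conj α * a 0 := by rw [← hb1]; ring
      rw [b0, b1, hk₀]
      have ci : (c : ℂ)⁻¹ * c = 1 := inv_mul_cancel₀ hc0
      have d0 : (c : ℂ)⁻¹ * (1 + α * conj α) = c := by
        rw [← hccC, sq, ← mul_assoc, ci, one_mul]
      fin_cases i <;> fin_cases j <;> simp
      · linear_combination -(a 0) * d0
      · linear_combination -(a 0) * d0 + α * ci
      · linear_combination -(a 1) * d0 + conj α * ci
      · linear_combination -(a 1) * d0
    rw [hMa]
    have e4 : r * -(c * a i) - c ^ 2 / 2 * x = (-c : ℂ) * (r * a i + c / 2 * x) := by ring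
    rw [e4, norm_mul, norm_neg, Complex.norm_real, Real.norm_of_nonneg (by linarith), mul_div_assoc]
    exact mul_le_mul_of_nonneg_left hfin (by linarith)
  have hlim : Tendsto (fun η : ℝ => Real.sqrt (η / 2) * (M (η * Complex.I) i j - k₀) -
      c ^ 2 / 2 * x) atTop (𝓝 0) :=
    squeeze_zero_norm' hb (tendsto_const_nhds.div_atTop tendsto_sqrt_half_atTop)
  have h1 := (hlim.const_mul ((Real.sqrt 2 : ℝ) : ℂ)).add_const
    ((((1 + ‖α‖ ^ 2) / Real.sqrt 2 : ℝ) : ℂ) * x)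
  rw [mul_zero, zero_add] at h1
  refine h1.congr' ?_
  filter_upwards [eventually_gt_atTop 0] with η hη
  rw [neg_neg, rpow_half_eq η]
  have h2 : (((1 + ‖α‖ ^ 2) / Real.sqrt 2 : ℝ) : ℂ) = (Real.sqrt 2 : ℝ) * (c ^ 2 / 2) := by
    have : (1 + ‖α‖ ^ 2) / Real.sqrt 2 = Real.sqrt 2 * (c ^ 2 / 2) := by
      rw [hcc]
      have := Real.sq_sqrt (two_pos (α := ℝ)).le
      field_simp
      rw [this]
    rw [this]; push_cast; rfl
  rw [h2]
  push_cast
  ring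

end Limits

/-! ### Stieltjes transforms of homogeneous densities -/

section BaseIntegrals

/-- An antiderivative of `2 / (1 + s⁴)` (`σ = 1`) and of `2 s² / (1 + s⁴)` (`σ = -1`). -/
def quarticPrimitive (σ s : ℝ) : ℝ :=
  (1 / Real.sqrt 2) * (Real.arctan (Real.sqrt 2 * s + 1) + Real.arctan (Real.sqrt 2 * s - 1)) +
    σ * (1 / (2 * Real.sqrt 2)) *
      (Real.log ((s ^ 2 + Real.sqrt 2 * s + 1) / (s ^ 2 - Real.sqrt 2 * s + 1)))

theorem quartic_factor_pos (s : ℝ) :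
    0 < s ^ 2 + Real.sqrt 2 * s + 1 ∧ 0 < s ^ 2 - Real.sqrt 2 * s + 1 := by
  have h := Real.sq_sqrt (two_pos (α := ℝ)).le
  constructor <;> nlinarith [sq_nonneg (s + Real.sqrt 2 / 2), sq_nonneg (s - Real.sqrt 2 / 2)]

theorem hasDerivAt_quarticPrimitive (σ s : ℝ) : HasDerivAt (quarticPrimitive σ)
    (((1 + σ) + (1 - σ) * s ^ 2) / (1 + s ^ 4)) s := by
  have h := Real.sq_sqrt (two_pos (α := ℝ)).le
  obtain ⟨hp, hm⟩ := quartic_factor_pos s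
  set q := Real.sqrt 2 with hq
  have hq0 : q ≠ 0 := by rw [hq]; positivity
  have l1 : HasDerivAt (fun s : ℝ => q * s) q s := by
    simpa using (hasDerivAt_id s).const_mul q
  have d1 := (l1.add_const 1).arctan
  have d2 := (l1.sub_const 1).arctan
  have s2 : HasDerivAt (fun s : ℝ => s ^ 2) (2 * s) s := by simpa using hasDerivAt_pow 2 s
  have d3 := ((s2.add l1).add_const 1).div ((s2.sub l1).add_const 1) hm.ne'
  have d4 := d3.log (div_ne_zero hp.ne' hm.ne')
  have d5 := ((d1.add d2).const_mul (1 / q)).add (d4.const_mul (σ * (1 / (2 * q))))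
  refine d5.congr_deriv ?_
  have hfac : 1 + s ^ 4 = (s ^ 2 + q * s + 1) * (s ^ 2 - q * s + 1) := by
    linear_combination s ^ 2 * h
  have e1 : 1 + (q * s + 1) ^ 2 = 2 * (s ^ 2 + q * s + 1) := by linear_combination s ^ 2 * h
  have e2 : 1 + (q * s - 1) ^ 2 = 2 * (s ^ 2 - q * s + 1) := by linear_combination s ^ 2 * h
  have e3 : (2 * s + q) * (s ^ 2 - q * s + 1) - (s ^ 2 + q * s + 1) * (2 * s - q) =
    2 * q * (1 - s ^ 2) := by ring
  have e4 : (s ^ 2 + q * s + 1) + (s ^ 2 - q * s + 1) = 2 * (1 + s ^ 2) := by ring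
  change 1 / q * (1 / (1 + (q * s + 1) ^ 2) * q + 1 / (1 + (q * s - 1) ^ 2) * q) +
    σ * (1 / (2 * q)) * (((2 * s + q) * (s ^ 2 - q * s + 1) - (s ^ 2 + q * s + 1) * (2 * s - q)) /
      (s ^ 2 - q * s + 1) ^ 2 / ((s ^ 2 + q * s + 1) / (s ^ 2 - q * s + 1))) = _
  rw [e1, e2, e3, hfac]
  generalize s ^ 2 + q * s + 1 = p at *
  generalize s ^ 2 - q * s + 1 = m at *
  have hp' := hp.ne'
  have hm' := hm.ne'
  have e5 : 1 / q * (1 / (2 * p) * q + 1 / (2 * m) * q) +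
      σ * (1 / (2 * q)) * (2 * q * (1 - s ^ 2) / m ^ 2 / (p / m)) =
      ((p + m) / 2 + σ * (1 - s ^ 2)) / (p * m) := by
    field_simp
    ring
  rw [e5, e4]
  ring

theorem tendsto_quarticPrimitive (σ : ℝ) :
    Tendsto (quarticPrimitive σ) atTop (𝓝 (Real.pi / Real.sqrt 2)) := by
  have hq0 : 0 < Real.sqrt 2 := by positivity
  have l1 : Tendsto (fun s : ℝ => Real.sqrt 2 * s) atTop atTop := tendsto_id.const_mul_atTop hq0
  have hat := Real.tendsto_arctan_atTop.mono_right (nhdsWithin_le_nhds)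
  have a1 := hat.comp (tendsto_atTop_add_const_right _ 1 l1)
  have a2 := hat.comp (tendsto_atTop_add_const_right _ (-1) l1)
  have hinv := tendsto_inv_atTop_zero (𝕜 := ℝ)
  have r0 : Tendsto (fun s : ℝ => (1 + Real.sqrt 2 * s⁻¹ + s⁻¹ * s⁻¹) /
      (1 - Real.sqrt 2 * s⁻¹ + s⁻¹ * s⁻¹)) atTop (𝓝 1) := by
    have n1 : Tendsto (fun s : ℝ => 1 + Real.sqrt 2 * s⁻¹ + s⁻¹ * s⁻¹) atTop (𝓝 1) := by
      simpa using ((hinv.const_mul (Real.sqrt 2)).const_add 1).add (hinv.mul hinv)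
    have n2 : Tendsto (fun s : ℝ => 1 - Real.sqrt 2 * s⁻¹ + s⁻¹ * s⁻¹) atTop (𝓝 1) := by
      simpa using ((hinv.const_mul (Real.sqrt 2)).const_sub 1).add (hinv.mul hinv)
    have := n1.div n2 one_ne_zero
    rw [div_one] at this
    exact this
  have r1 : Tendsto (fun s : ℝ => (s ^ 2 + Real.sqrt 2 * s + 1) / (s ^ 2 - Real.sqrt 2 * s + 1))
      atTop (𝓝 1) := by
    refine r0.congr' ?_
    filter_upwards [eventually_gt_atTop 0] with s hs
    obtain ⟨hp, hm⟩ := quartic_factor_pos s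
    have e1 : 1 + Real.sqrt 2 * s⁻¹ + s⁻¹ * s⁻¹ = (s ^ 2 + Real.sqrt 2 * s + 1) / s ^ 2 := by
      field_simp
    have e2 : 1 - Real.sqrt 2 * s⁻¹ + s⁻¹ * s⁻¹ = (s ^ 2 - Real.sqrt 2 * s + 1) / s ^ 2 := by
      field_simp
    rw [e1, e2, div_div_div_cancel_right₀ (by positivity)]
  have r2 := (Real.continuousAt_log one_ne_zero).tendsto.comp r1
  rw [Real.log_one] at r2
  have := ((a1.add a2).const_mul (1 / Real.sqrt 2)).add
    (r2.const_mul (σ * (1 / (2 * Real.sqrt 2))))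
  have hfin : 1 / Real.sqrt 2 * (Real.pi / 2 + Real.pi / 2) + σ * (1 / (2 * Real.sqrt 2)) * 0 =
      Real.pi / Real.sqrt 2 := by ring
  rw [hfin] at this
  exact this

theorem quarticPrimitive_zero (σ : ℝ) : quarticPrimitive σ 0 = 0 := by
  simp [quarticPrimitive, Real.arctan_neg]

theorem rpow_neg_half_eq {t : ℝ} (ht : 0 < t) : t ^ (-(1 / 2) : ℝ) = (Real.sqrt t)⁻¹ := by
  rw [Real.rpow_neg ht.le, ← Real.sqrt_eq_rpow]

/-- Substituting `t = s²` leads to the two quartic integrands, selected by `σ`. The logarithm in the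
antiderivative contributes nothing at either end, which is why both exponents give the same value.
-/
theorem integral_rpow_half_base {β : ℝ} (hβ : β = 1 / 2 ∨ β = -(1 / 2)) :
    IntegrableOn (fun t : ℝ => t ^ β / (t ^ 2 + 1)) (Ioi 0) ∧
      ∫ t in Ioi (0 : ℝ), t ^ β / (t ^ 2 + 1) = Real.pi / Real.sqrt 2 := by
  obtain ⟨σ, hσ⟩ : ∃ σ : ℝ, ∀ t : ℝ, 0 < t → t ^ β / (t ^ 2 + 1) =
      ((1 + σ) + (1 - σ) * Real.sqrt t ^ 2) / (1 + Real.sqrt t ^ 4) * (1 / (2 * Real.sqrt t)) := by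
    have e4 : ∀ t : ℝ, 0 < t → Real.sqrt t ^ 4 = t ^ 2 := fun t ht => by
      rw [show Real.sqrt t ^ 4 = (Real.sqrt t ^ 2) ^ 2 by ring, Real.sq_sqrt ht.le]
    rcases hβ with rfl | rfl
    · refine ⟨-1, fun t ht => ?_⟩
      have hs := Real.sqrt_pos.2 ht
      have h2 := Real.sq_sqrt ht.le
      rw [e4 t ht, ← Real.sqrt_eq_rpow, add_comm (t ^ 2)]
      have : 0 < 1 + t ^ 2 := by positivity
      field_simp
      linarith
    · refine ⟨1, fun t ht => ?_⟩
      have hs := Real.sqrt_pos.2 ht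
      rw [e4 t ht, rpow_neg_half_eq ht, add_comm (t ^ 2)]
      have : 0 < 1 + t ^ 2 := by positivity
      field_simp
      ring
  have hd : ∀ t ∈ Ioi (0 : ℝ), HasDerivAt (fun t => quarticPrimitive σ (Real.sqrt t))
      (t ^ β / (t ^ 2 + 1)) t := fun t ht => by
    rw [hσ t ht]
    exact (hasDerivAt_quarticPrimitive σ _).comp t (Real.hasDerivAt_sqrt (ne_of_gt ht))
  have hnn : ∀ t ∈ Ioi (0 : ℝ), 0 ≤ t ^ β / (t ^ 2 + 1) := fun t ht =>
    div_nonneg (Real.rpow_nonneg (le_of_lt ht) _) (by positivity)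
  have hc : ContinuousWithinAt (fun t => quarticPrimitive σ (Real.sqrt t)) (Ici 0) 0 :=
    ((hasDerivAt_quarticPrimitive σ _).continuousAt.comp
      Real.continuous_sqrt.continuousAt).continuousWithinAt
  have hl : Tendsto (fun t => quarticPrimitive σ (Real.sqrt t)) atTop (𝓝 (Real.pi / Real.sqrt 2)) :=
    (tendsto_quarticPrimitive σ).comp Real.tendsto_sqrt_atTop
  refine ⟨integrableOn_Ioi_deriv_of_nonneg hc hd hnn hl, ?_⟩
  rw [integral_Ioi_of_hasDerivAt_of_nonneg hc hd hnn hl]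
  simp [quarticPrimitive_zero]

theorem integral_rpow_half {β : ℝ} (hβ : β = 1 / 2 ∨ β = -(1 / 2)) {c : ℝ} (hc : 0 < c) :
    IntegrableOn (fun t : ℝ => t ^ β / (t ^ 2 + c ^ 2)) (Ioi 0) ∧
      ∫ t in Ioi (0 : ℝ), t ^ β / (t ^ 2 + c ^ 2) = c ^ β / c * (Real.pi / Real.sqrt 2) := by
  obtain ⟨h1, h2⟩ := integral_rpow_half_base hβ
  have e : ∀ t ∈ Ioi (0 : ℝ), t ^ β / (t ^ 2 + c ^ 2) =
      (c ^ β / c ^ 2) * ((c⁻¹ * t) ^ β / ((c⁻¹ * t) ^ 2 + 1)) := fun t ht => by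
    have ht0 : 0 < t := ht
    rw [Real.mul_rpow (by positivity) ht0.le, Real.inv_rpow hc.le]
    have := Real.rpow_pos_of_pos hc β
    field_simp
  have hi : IntegrableOn (fun t : ℝ => (c⁻¹ * t) ^ β / ((c⁻¹ * t) ^ 2 + 1)) (Ioi 0) := by
    rw [integrableOn_Ioi_comp_mul_left_iff (fun t : ℝ => t ^ β / (t ^ 2 + 1)) 0 (inv_pos.2 hc),
      mul_zero]
    exact h1
  constructor
  · exact (integrableOn_congr_fun e measurableSet_Ioi).2 (hi.const_mul _)
  · rw [setIntegral_congr_fun measurableSet_Ioi e, integral_const_mul,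
      integral_comp_mul_left_Ioi (fun t : ℝ => t ^ β / (t ^ 2 + 1)) 0 (inv_pos.2 hc), mul_zero, h2,
      inv_inv, smul_eq_mul]
    field_simp

end BaseIntegrals

theorem integral_eq_integral_Ioi_add_neg {f : ℝ → ℂ} (h1 : IntegrableOn f (Ioi 0))
    (h2 : IntegrableOn (fun t => f (-t)) (Ioi 0)) :
    Integrable f ∧ ∫ t, f t = ∫ t in Ioi (0 : ℝ), (f t + f (-t)) := by
  have h3 : IntegrableOn f (Iic 0) := by
    rw [integrableOn_Iic_iff_integrableOn_Iio]
    have := h2.comp_neg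
    simpa using this
  constructor
  · rw [← integrableOn_univ, ← Iic_union_Ioi (a := (0 : ℝ))]
    exact h3.union h1
  · rw [integral_add h1 h2, integral_comp_neg_Ioi, neg_zero, add_comm]
    exact (intervalIntegral.integral_Iic_add_Ioi h3 h1).symm

/-- The density `w` has the Stieltjes transform of a homogeneous function of degree `β`,
with boundary values `mp` and `mm` at `±i`. -/
structure IsHomogeneousModel (w : ℝ → ℂ) (β : ℝ) (mp mm : ℂ) : Prop where
  locInt : LocallyIntegrable w
  integrable : Integrable fun t : ℝ => w t / (1 + (t : ℂ) ^ 2)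
  integral_one : ∫ t : ℝ, w t / (1 + (t : ℂ) ^ 2) = (mp - mm) / (2 * Complex.I)
  -- Partial fractions of `1/((t - iy)(1 + t²))` with poles `iy, i, -i`, applied to a transform
  -- equal to `|y|^β mp` or `|y|^β mm` at `iy`. The excluded `y = ±1` are the double poles.
  integral_inv : ∀ y : ℝ, y ≠ 0 → y ≠ 1 → y ≠ -1 →
    ∫ t : ℝ, (1 / ((t : ℂ) - y * Complex.I)) * (w t / (1 + (t : ℂ) ^ 2)) =
      ((|y| ^ β : ℝ) : ℂ) * (if 0 < y then mp else mm) / (1 - y ^ 2) - mp / (2 * (1 - y)) -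
        mm / (2 * (1 + y))

theorem one_add_sq_ne_zero (t : ℝ) : (1 : ℂ) + (t : ℂ) ^ 2 ≠ 0 := by
  have : (0 : ℝ) < 1 + t ^ 2 := by positivity
  exact_mod_cast this.ne'

theorem locallyIntegrable_of_div_one_add_sq {w : ℝ → ℂ}
    (hw : Integrable fun t : ℝ => w t / (1 + (t : ℂ) ^ 2)) : LocallyIntegrable w := by
  have := hw.locallyIntegrable.continuous_mul (g := fun t : ℝ => 1 + (t : ℂ) ^ 2) (by fun_prop)
  have e : (fun t : ℝ => (1 + (t : ℂ) ^ 2) * (w t / (1 + (t : ℂ) ^ 2))) = w :=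
    funext fun t => mul_div_cancel₀ _ (one_add_sq_ne_zero t)
  rwa [e] at this

theorem IsHomogeneousModel.const_mul {w : ℝ → ℂ} {β : ℝ} {mp mm : ℂ}
    (h : IsHomogeneousModel w β mp mm) (κ : ℂ) :
    IsHomogeneousModel (fun t => κ * w t) β (κ * mp) (κ * mm) := by
  have e : ∀ t : ℝ, κ * w t / (1 + (t : ℂ) ^ 2) = κ * (w t / (1 + (t : ℂ) ^ 2)) := fun t => by ring
  refine ⟨h.locInt.smul κ, ?_, ?_, fun y h0 h1 h2 => ?_⟩
  · simp only [e]; exact h.integrable.const_mul κ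
  · simp only [e]; rw [integral_const_mul, h.integral_one]; ring
  · have e2 : ∀ t : ℝ, (1 / ((t : ℂ) - y * Complex.I)) * (κ * w t / (1 + (t : ℂ) ^ 2)) =
      κ * ((1 / ((t : ℂ) - y * Complex.I)) * (w t / (1 + (t : ℂ) ^ 2))) := fun t => by ring
    simp only [e2]
    rw [integral_const_mul, h.integral_inv y h0 h1 h2]
    split_ifs <;> ring

section Models

variable {β : ℝ} (s : ℝ)

/-- The functions `|t|^β` (`s = 1`) and `sgn(t) |t|^β` (`s = -1`). -/
def homogeneousWeight (β s : ℝ) (t : ℝ) : ℝ := (if 0 < t then 1 else s) * |t| ^ β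

theorem homogeneousWeight_pos {t : ℝ} (ht : 0 < t) : homogeneousWeight β s t = t ^ β := by
  simp [homogeneousWeight, ht, abs_of_pos ht]

theorem homogeneousWeight_neg {t : ℝ} (ht : 0 < t) : homogeneousWeight β s (-t) = s * t ^ β := by
  simp [homogeneousWeight, not_lt.2 ht.le, abs_of_pos ht]

theorem integrable_homogeneousWeight (hβ : β = 1 / 2 ∨ β = -(1 / 2)) :
    IntegrableOn (fun t : ℝ => (homogeneousWeight β s t : ℂ) / (1 + (t : ℂ) ^ 2)) (Ioi 0) ∧
    IntegrableOn (fun t : ℝ => (homogeneousWeight β s (-t) : ℂ) / (1 + ((-t : ℝ) : ℂ) ^ 2))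
      (Ioi 0) := by
  have hb : IntegrableOn (fun t : ℝ => ((t ^ β / (t ^ 2 + 1) : ℝ) : ℂ)) (Ioi 0) :=
    (integral_rpow_half_base hβ).1.ofReal
  constructor
  · refine (integrableOn_congr_fun (fun t ht => ?_) measurableSet_Ioi).2 hb
    simp only [homogeneousWeight_pos s ht]
    push_cast
    rw [add_comm]
  · refine (integrableOn_congr_fun (fun t ht => ?_) measurableSet_Ioi).2 (hb.const_mul (s : ℂ))
    simp only [homogeneousWeight_neg s ht]
    push_cast
    rw [neg_sq, mul_div_assoc, add_comm (1 : ℂ)]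

/-- Multiplying by `1 / (t - iy)` preserves integrability. -/
theorem Integrable.inv_sub_mul {μ : Measure ℝ} {f : ℝ → ℂ} (hf : Integrable f μ) {y : ℝ}
    (hy : y ≠ 0) : Integrable (fun t : ℝ => (1 / ((t : ℂ) - y * Complex.I)) * f t) μ := by
  have hne : ∀ t : ℝ, (t : ℂ) - y * Complex.I ≠ 0 := ofReal_sub_ne_zero (by simpa using hy)
  have hc : Continuous fun t : ℝ => 1 / ((t : ℂ) - y * Complex.I) :=
    continuous_const.div (by fun_prop) hne
  refine hf.bdd_mul (c := |y|⁻¹) hc.aestronglyMeasurable (Eventually.of_forall fun t => ?_)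
  rw [norm_div, norm_one, one_div]
  refine inv_anti₀ (abs_pos.2 hy) ?_
  have := Complex.abs_im_le_norm ((t : ℂ) - y * Complex.I)
  simpa using this

/-- Adding the contributions of `t` and `-t` leaves `2iy t^β / ((t² + y²)(t² + 1))`. Partial
fractions in `t²` reduce its integral to `integral_rpow_half` at `|y|` and to the base case. -/
theorem isHomogeneousModel_even (hβ : β = 1 / 2 ∨ β = -(1 / 2)) :
    IsHomogeneousModel (fun t => (homogeneousWeight β 1 t : ℂ)) β
      (2 * (Real.pi / Real.sqrt 2 : ℝ) * Complex.I)
      (-(2 * (Real.pi / Real.sqrt 2 : ℝ) * Complex.I)) := by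
  obtain ⟨i1, i2⟩ := integrable_homogeneousWeight 1 hβ
  obtain ⟨hi, hint⟩ := integral_eq_integral_Ioi_add_neg i1 i2
  set P : ℝ := Real.pi / Real.sqrt 2 with hP
  have hI := Complex.I_ne_zero
  have hJ1 := (integral_rpow_half_base hβ).2
  rw [← hP] at hJ1
  have hbase := (integral_rpow_half_base hβ).1
  refine ⟨?_, hi, ?_, fun y h0 h1 h2 => ?_⟩
  · exact locallyIntegrable_of_div_one_add_sq hi
  · rw [hint]
    have e : ∀ t ∈ Ioi (0 : ℝ), (homogeneousWeight β 1 t : ℂ) / (1 + (t : ℂ) ^ 2) +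
        (homogeneousWeight β 1 (-t) : ℂ) / (1 + ((-t : ℝ) : ℂ) ^ 2) =
        ((2 * (t ^ β / (t ^ 2 + 1)) : ℝ) : ℂ) := fun t ht => by
      rw [homogeneousWeight_pos 1 ht, homogeneousWeight_neg 1 ht]
      push_cast
      ring
    rw [setIntegral_congr_fun measurableSet_Ioi e, integral_complex_ofReal, integral_const_mul, hJ1]
    field_simp
    push_cast
    ring
  · have hy : 0 < |y| := abs_pos.2 h0
    obtain ⟨k1, k2⟩ := integral_rpow_half hβ hy
    rw [← hP] at k2
    obtain ⟨-, hint⟩ := integral_eq_integral_Ioi_add_neg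
      (f := fun t : ℝ => (1 / ((t : ℂ) - y * Complex.I)) *
        ((homogeneousWeight β 1 t : ℂ) / (1 + (t : ℂ) ^ 2)))
      ((Integrable.inv_sub_mul hi h0).integrableOn)
      ((Integrable.inv_sub_mul hi h0).comp_neg.integrableOn)
    have hy1 : (y : ℂ) ^ 2 - 1 ≠ 0 := by
      have : (y : ℂ) ^ 2 - 1 = ((y - 1) * (y + 1) : ℝ) := by push_cast; ring
      rw [this]
      exact_mod_cast mul_ne_zero (sub_ne_zero.2 h1) (fun e => h2 (by linarith))
    rw [hint]
    have e : ∀ t ∈ Ioi (0 : ℝ), (1 / ((t : ℂ) - y * Complex.I)) *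
        ((homogeneousWeight β 1 t : ℂ) / (1 + (t : ℂ) ^ 2)) +
        (1 / (((-t : ℝ) : ℂ) - y * Complex.I)) *
        ((homogeneousWeight β 1 (-t) : ℂ) / (1 + ((-t : ℝ) : ℂ) ^ 2)) =
        (2 * Complex.I * y / (y ^ 2 - 1)) *
          ((t ^ β / (t ^ 2 + 1) - t ^ β / (t ^ 2 + |y| ^ 2) : ℝ) : ℂ) := fun t ht => by
      rw [homogeneousWeight_pos 1 ht, homogeneousWeight_neg 1 ht, sq_abs]
      have n1 := ofReal_sub_ne_zero (z := y * Complex.I) (by simpa using h0) t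
      have n2 := ofReal_sub_ne_zero (z := y * Complex.I) (by simpa using h0) (-t)
      have n3 : (t : ℂ) ^ 2 + 1 ≠ 0 := by rw [add_comm]; exact one_add_sq_ne_zero t
      have n4 : (t : ℂ) ^ 2 + (y : ℂ) ^ 2 ≠ 0 := by
        have : 0 < t ^ 2 + y ^ 2 := by positivity
        exact_mod_cast this.ne'
      have n5 : (1 / ((t : ℂ) - y * Complex.I)) + 1 / (((-t : ℝ) : ℂ) - y * Complex.I) =
          2 * Complex.I * y / (t ^ 2 + y ^ 2) := by
        rw [div_add_div _ _ n1 n2, div_eq_div_iff (mul_ne_zero n1 n2) n4]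
        push_cast
        linear_combination (-2 * Complex.I * (y : ℂ) ^ 3) * Complex.I_sq
      have n6 : (1 + ((-t : ℝ) : ℂ) ^ 2) = 1 + (t : ℂ) ^ 2 := by push_cast; ring
      rw [n6, one_mul, ← add_mul, n5]
      push_cast
      rw [add_comm (1 : ℂ)]
      field_simp
      ring
    rw [setIntegral_congr_fun measurableSet_Ioi e, integral_const_mul, integral_complex_ofReal,
      integral_sub hbase k1, hJ1, k2]
    have hz : (1 : ℂ) - y ≠ 0 := by exact_mod_cast sub_ne_zero.2 (Ne.symm h1)
    have hz' : (1 : ℂ) + y ≠ 0 := by exact_mod_cast fun e : 1 + y = 0 => h2 (by linarith)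
    have hz2 : (1 : ℂ) - (y : ℂ) ^ 2 ≠ 0 := fun e => hy1 (by linear_combination -e)
    rcases lt_or_gt_of_ne h0 with hneg | hpos
    · rw [if_neg (not_lt.2 hneg.le), abs_of_neg hneg]
      have hy0 : (y : ℂ) ≠ 0 := by exact_mod_cast h0
      generalize ((-y) ^ β : ℝ) = Y
      push_cast
      rw [show (y : ℂ) ^ 2 - 1 = -((1 - y) * (1 + y)) by ring,
        show (1 : ℂ) - (y : ℂ) ^ 2 = (1 - y) * (1 + y) by ring]
      field_simp
      ring
    · rw [if_pos hpos, abs_of_pos hpos]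
      have hy0 : (y : ℂ) ≠ 0 := by exact_mod_cast h0
      generalize (y ^ β : ℝ) = Y
      push_cast
      rw [show (y : ℂ) ^ 2 - 1 = -((1 - y) * (1 + y)) by ring,
        show (1 : ℂ) - (y : ℂ) ^ 2 = (1 - y) * (1 + y) by ring]
      field_simp
      ring

/-- Adding the contributions of `t` and `-t` now leaves `2t·t^β / ((t² + y²)(t² + 1))`. Since
`t·t^(1/2) = t²·t^(-1/2)` and `t·t^(-1/2) = t^(1/2)`, the case `β` reduces to the basic integrals
with exponent `-β`; the sign of the factor `4β` records which case occurs. -/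
theorem isHomogeneousModel_odd (hβ : β = 1 / 2 ∨ β = -(1 / 2)) :
    IsHomogeneousModel (fun t => (homogeneousWeight β (-1) t : ℂ)) β
      (-(4 * β * (Real.pi / Real.sqrt 2) : ℝ)) (-(4 * β * (Real.pi / Real.sqrt 2) : ℝ)) := by
  obtain ⟨i1, i2⟩ := integrable_homogeneousWeight (-1) hβ
  obtain ⟨hi, hint⟩ := integral_eq_integral_Ioi_add_neg i1 i2
  set P : ℝ := Real.pi / Real.sqrt 2 with hP
  refine ⟨locallyIntegrable_of_div_one_add_sq hi, hi, ?_, fun y h0 h1 h2 => ?_⟩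
  · rw [hint, sub_self, zero_div]
    refine setIntegral_eq_zero_of_forall_eq_zero fun t ht => ?_
    rw [homogeneousWeight_pos _ ht, homogeneousWeight_neg _ ht]
    push_cast
    ring
  · have hy : 0 < |y| := abs_pos.2 h0
    obtain ⟨-, hint⟩ := integral_eq_integral_Ioi_add_neg
      (f := fun t : ℝ => (1 / ((t : ℂ) - y * Complex.I)) *
        ((homogeneousWeight β (-1) t : ℂ) / (1 + (t : ℂ) ^ 2)))
      ((Integrable.inv_sub_mul hi h0).integrableOn)
      ((Integrable.inv_sub_mul hi h0).comp_neg.integrableOn)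
    have hz : (1 : ℂ) - y ≠ 0 := by exact_mod_cast sub_ne_zero.2 (Ne.symm h1)
    have hz' : (1 : ℂ) + y ≠ 0 := by exact_mod_cast fun e : 1 + y = 0 => h2 (by linarith)
    have hy1 : y ^ 2 - 1 ≠ 0 := by
      rw [show y ^ 2 - 1 = (y - 1) * (y + 1) by ring]
      exact mul_ne_zero (sub_ne_zero.2 h1) (fun e => h2 (by linarith))
    rw [hint]
    have e : ∀ t ∈ Ioi (0 : ℝ), (1 / ((t : ℂ) - y * Complex.I)) *
        ((homogeneousWeight β (-1) t : ℂ) / (1 + (t : ℂ) ^ 2)) +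
        (1 / (((-t : ℝ) : ℂ) - y * Complex.I)) *
        ((homogeneousWeight β (-1) (-t) : ℂ) / (1 + ((-t : ℝ) : ℂ) ^ 2)) =
        ((2 * t * t ^ β / ((t ^ 2 + y ^ 2) * (t ^ 2 + 1)) : ℝ) : ℂ) := fun t ht => by
      rw [homogeneousWeight_pos _ ht, homogeneousWeight_neg _ ht]
      have n1 := ofReal_sub_ne_zero (z := y * Complex.I) (by simpa using h0) t
      have n2 := ofReal_sub_ne_zero (z := y * Complex.I) (by simpa using h0) (-t)
      have n3 : (t : ℂ) ^ 2 + 1 ≠ 0 := by rw [add_comm]; exact one_add_sq_ne_zero t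
      have n4 : (t : ℂ) ^ 2 + (y : ℂ) ^ 2 ≠ 0 := by
        have : 0 < t ^ 2 + y ^ 2 := by positivity
        exact_mod_cast this.ne'
      have n5 : (1 / ((t : ℂ) - y * Complex.I)) - 1 / (((-t : ℝ) : ℂ) - y * Complex.I) =
          2 * t / (t ^ 2 + y ^ 2) := by
        rw [div_sub_div _ _ n1 n2, div_eq_div_iff (mul_ne_zero n1 n2) n4]
        push_cast
        linear_combination (-2 * (t : ℂ) * (y : ℂ) ^ 2) * Complex.I_sq
      have n6 : (1 + ((-t : ℝ) : ℂ) ^ 2) = 1 + (t : ℂ) ^ 2 := by push_cast; ring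
      rw [n6]
      have n7 : ∀ p q w v : ℂ, p * (w / v) + q * ((((-1 : ℝ) : ℂ) * w) / v) = (p - q) * (w / v) := by
        intro p q w v; push_cast; ring
      push_cast at n7 ⊢
      rw [n7]
      push_cast at n5
      rw [n5, add_comm (1 : ℂ)]
      field_simp
    rw [setIntegral_congr_fun measurableSet_Ioi e, integral_complex_ofReal]
    have hval : ∫ t in Ioi (0 : ℝ), 2 * t * t ^ β / ((t ^ 2 + y ^ 2) * (t ^ 2 + 1)) =
        4 * β * P * (|y| ^ β - 1) / (y ^ 2 - 1) := by
      rcases hβ with rfl | rfl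
      · obtain ⟨k1, k2⟩ := integral_rpow_half (Or.inr rfl) hy
        obtain ⟨j1, j2⟩ := integral_rpow_half_base (Or.inr rfl)
        rw [← hP] at k2 j2
        have e2 : ∀ t ∈ Ioi (0 : ℝ), 2 * t * t ^ (1 / 2 : ℝ) / ((t ^ 2 + y ^ 2) * (t ^ 2 + 1)) =
            2 / (y ^ 2 - 1) * (y ^ 2 * (t ^ (-(1 / 2) : ℝ) / (t ^ 2 + |y| ^ 2)) -
              t ^ (-(1 / 2) : ℝ) / (t ^ 2 + 1)) := fun t ht => by
          have ht0 : 0 < t := ht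
          have e3 : t ^ (1 / 2 : ℝ) = t * t ^ (-(1 / 2) : ℝ) := by
            nth_rewrite 2 [← Real.rpow_one t]
            rw [← Real.rpow_add ht0]
            norm_num
          rw [e3, sq_abs]
          have : 0 < t ^ 2 + y ^ 2 := by positivity
          field_simp
          ring
        rw [setIntegral_congr_fun measurableSet_Ioi e2, integral_const_mul,
          integral_sub (k1.const_mul _) j1, integral_const_mul, k2, j2]
        have e4 : |y| ^ (1 / 2 : ℝ) = |y| * |y| ^ (-(1 / 2) : ℝ) := by
          nth_rewrite 2 [← Real.rpow_one |y|]
          rw [← Real.rpow_add hy]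
          norm_num
        rw [e4]
        generalize |y| ^ (-(1 / 2) : ℝ) = Y
        rw [← sq_abs y] at hy1 ⊢
        field_simp
        ring
      · obtain ⟨k1, k2⟩ := integral_rpow_half (Or.inl rfl) hy
        obtain ⟨j1, j2⟩ := integral_rpow_half_base (Or.inl rfl)
        rw [← hP] at k2 j2
        have e2 : ∀ t ∈ Ioi (0 : ℝ), 2 * t * t ^ (-(1 / 2) : ℝ) / ((t ^ 2 + y ^ 2) * (t ^ 2 + 1)) =
            2 / (y ^ 2 - 1) * (t ^ (1 / 2 : ℝ) / (t ^ 2 + 1) -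
              t ^ (1 / 2 : ℝ) / (t ^ 2 + |y| ^ 2)) := fun t ht => by
          have ht0 : 0 < t := ht
          have e3 : t ^ (1 / 2 : ℝ) = t * t ^ (-(1 / 2) : ℝ) := by
            nth_rewrite 2 [← Real.rpow_one t]
            rw [← Real.rpow_add ht0]
            norm_num
          rw [e3, sq_abs]
          have : 0 < t ^ 2 + y ^ 2 := by positivity
          field_simp
          ring
        rw [setIntegral_congr_fun measurableSet_Ioi e2, integral_const_mul,
          integral_sub j1 k1, k2, j2]
        have e4 : |y| ^ (1 / 2 : ℝ) = |y| * |y| ^ (-(1 / 2) : ℝ) := by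
          nth_rewrite 2 [← Real.rpow_one |y|]
          rw [← Real.rpow_add hy]
          norm_num
        rw [e4]
        generalize |y| ^ (-(1 / 2) : ℝ) = Y
        field_simp
        ring
    rw [hval, ite_self]
    generalize (|y| ^ β : ℝ) = Y
    push_cast
    rw [show (y : ℂ) ^ 2 - 1 = -((1 - y) * (1 + y)) by ring,
      show (1 : ℂ) - (y : ℂ) ^ 2 = (1 - y) * (1 + y) by ring]
    field_simp
    ring

end Models

/-! ### Density of the Cauchy kernels -/

theorem inv_abs_bound {y : ℝ} (hy : y ≠ 0) (t : ℝ) :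
    ‖1 / ((t : ℂ) - y * Complex.I)‖ ≤ |y|⁻¹ := by
  rw [norm_div, norm_one, one_div]
  refine inv_anti₀ (abs_pos.2 hy) ?_
  have := Complex.abs_im_le_norm ((t : ℂ) - y * Complex.I)
  simpa using this

/-- The function `1 / (t - iy)` on the one-point compactification of the line. -/
def cauchyKernel {y : ℝ} (hy : y ≠ 0) : C(OnePoint ℝ, ℂ) :=
  OnePoint.continuousMapMk ⟨fun t : ℝ => 1 / ((t : ℂ) - y * Complex.I),
    continuous_const.div (by fun_prop) (ofReal_sub_ne_zero (by simpa using hy))⟩ 0 <| by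
    rw [coclosedCompact_eq_cocompact]
    have hT := tendsto_norm_cocompact_atTop (E := ℝ)
    refine squeeze_zero_norm' (a := fun t : ℝ => ‖t‖⁻¹) ?_ (tendsto_inv_atTop_zero.comp hT)
    filter_upwards [hT.eventually_gt_atTop 0] with t ht
    change ‖1 / ((t : ℂ) - y * Complex.I)‖ ≤ _
    rw [norm_div, norm_one, one_div]
    refine inv_anti₀ ht ?_
    have := Complex.abs_re_le_norm ((t : ℂ) - y * Complex.I)
    simpa using this

theorem cauchyKernel_coe {y : ℝ} (hy : y ≠ 0) (t : ℝ) :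
    cauchyKernel hy (t : OnePoint ℝ) = 1 / ((t : ℂ) - y * Complex.I) := rfl

theorem cauchyKernel_infty {y : ℝ} (hy : y ≠ 0) : cauchyKernel hy OnePoint.infty = 0 := rfl

theorem cauchyKernel_sub {a b : ℝ} (ha : a ≠ 0) (hb : b ≠ 0) :
    cauchyKernel ha - cauchyKernel hb =
      (((a - b : ℝ) : ℂ) * Complex.I) • (cauchyKernel ha * cauchyKernel hb) := by
  ext x
  induction x using OnePoint.rec with
  | infty =>
    change (0 : ℂ) - 0 = (((a - b : ℝ) : ℂ) * Complex.I) * ((0 : ℂ) * 0)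
    simp
  | coe t =>
    have h1 := ofReal_sub_ne_zero (z := a * Complex.I) (by simpa using ha) t
    have h2 := ofReal_sub_ne_zero (z := b * Complex.I) (by simpa using hb) t
    change 1 / ((t : ℂ) - a * Complex.I) - 1 / ((t : ℂ) - b * Complex.I) =
      (((a - b : ℝ) : ℂ) * Complex.I) * (1 / ((t : ℂ) - a * Complex.I) *
        (1 / ((t : ℂ) - b * Complex.I)))
    rw [one_div, one_div, inv_sub_inv h1 h2, div_eq_mul_inv, mul_inv]
    push_cast
    ring

theorem norm_cauchyKernel_le {y : ℝ} (hy : y ≠ 0) : ‖cauchyKernel hy‖ ≤ |y|⁻¹ := by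
  rw [ContinuousMap.norm_le _ (by positivity)]
  intro x
  induction x using OnePoint.rec with
  | infty => rw [cauchyKernel_infty, norm_zero]; positivity
  | coe t => exact inv_abs_bound hy t

theorem star_cauchyKernel {y : ℝ} (hy : y ≠ 0) :
    star (cauchyKernel hy) = cauchyKernel (neg_ne_zero.2 hy) := by
  ext x
  induction x using OnePoint.rec with
  | infty => change star (0 : ℂ) = 0; simp
  | coe t =>
    change conj (1 / ((t : ℂ) - y * Complex.I)) = 1 / ((t : ℂ) - (-y : ℝ) * Complex.I)
    simp

/-- If a closed subspace contains all the functions of a punctured neighbourhood then it contains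
the limit. -/
theorem mem_of_forall_ne {D : Submodule ℂ C(OnePoint ℝ, ℂ)} (hD : IsClosed (D : Set C(OnePoint ℝ, ℂ)))
    {y : ℝ} (hy : y ≠ 0) (G : C(OnePoint ℝ, ℂ)) (N : Set ℝ) (hN : N.Finite)
    (h : ∀ b (hb : b ≠ 0), b ≠ y → b ∉ N → G * cauchyKernel hb ∈ D) : G * cauchyKernel hy ∈ D := by
  classical
  let f : ℝ → C(OnePoint ℝ, ℂ) := fun b => if hb : b ≠ 0 then G * cauchyKernel hb else 0
  have h0 : ∀ᶠ b in 𝓝[≠] y, b ≠ 0 := eventually_nhdsWithin_of_eventually_nhds (isOpen_ne.mem_nhds hy)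
  have hfin : ∀ᶠ b in 𝓝[≠] y, b ∉ N := by
    have h1 : (N \ {y})ᶜ ∈ 𝓝 y := (hN.subset sdiff_subset).isClosed.isOpen_compl.mem_nhds (by simp)
    filter_upwards [self_mem_nhdsWithin, mem_nhdsWithin_of_mem_nhds h1] with b hb hb1 hbN
    exact hb1 ⟨hbN, hb⟩
  have hmem : ∀ᶠ b in 𝓝[≠] y, f b ∈ D := by
    filter_upwards [h0, hfin, self_mem_nhdsWithin] with b hb hbN hby
    simp only [f, dif_pos hb]
    exact h b hb hby hbN
  refine hD.mem_of_tendsto (b := 𝓝[≠] y) (f := f) ?_ hmem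
  rw [tendsto_iff_norm_sub_tendsto_zero]
  have hlim : Tendsto (fun b => ‖G‖ * (|b - y| * (|b|⁻¹ * |y|⁻¹))) (𝓝[≠] y) (𝓝 0) := by
    have hc : ContinuousAt (fun b => ‖G‖ * (|b - y| * (|b|⁻¹ * |y|⁻¹))) y := by
      have : |y| ≠ 0 := abs_ne_zero.2 hy
      have h2 : ContinuousAt (fun b : ℝ => |b|⁻¹) y := continuous_abs.continuousAt.inv₀ this
      fun_prop
    have h3 := hc.tendsto
    simp only [sub_self, abs_zero, zero_mul, mul_zero] at h3
    exact h3.mono_left nhdsWithin_le_nhds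
  refine squeeze_zero' (Eventually.of_forall fun _ => norm_nonneg _) ?_ hlim
  filter_upwards [h0] with b hb
  simp only [f, dif_pos hb]
  rw [← mul_sub, cauchyKernel_sub]
  refine (norm_mul_le _ _).trans (mul_le_mul_of_nonneg_left ?_ (norm_nonneg _))
  rw [norm_smul, norm_mul, Complex.norm_I, mul_one, Complex.norm_real, Real.norm_eq_abs]
  refine mul_le_mul_of_nonneg_left ((norm_mul_le _ _).trans ?_) (abs_nonneg _)
  exact mul_le_mul (norm_cauchyKernel_le hb) (norm_cauchyKernel_le hy) (norm_nonneg _)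
    (by positivity)

/-- The functions `1` and `1 / (t - iy)`, with finitely many values of `y` excluded, span a dense
subspace of the continuous functions on the one-point compactification of the line. -/
theorem span_cauchyKernel_dense (N : Set ℝ) (hN : N.Finite) :
    (Submodule.span ℂ ({1} ∪ {F : C(OnePoint ℝ, ℂ) | ∃ (y : ℝ) (hy : y ≠ 0), y ∉ N ∧
      F = cauchyKernel hy})).topologicalClosure = ⊤ := by
  set E := Submodule.span ℂ ({1} ∪ {F : C(OnePoint ℝ, ℂ) | ∃ (y : ℝ) (hy : y ≠ 0), y ∉ N ∧
      F = cauchyKernel hy}) with hE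
  set D := E.topologicalClosure with hD
  have hDc : IsClosed (D : Set C(OnePoint ℝ, ℂ)) := E.isClosed_topologicalClosure
  have hED : E ≤ D := E.le_topologicalClosure
  have h1 : (1 : C(OnePoint ℝ, ℂ)) ∈ D := hED (Submodule.subset_span (Or.inl rfl))
  have hker : ∀ y (hy : y ≠ 0), cauchyKernel hy ∈ D := fun y hy => by
    have := mem_of_forall_ne hDc hy 1 N hN fun b hb _ hbN => by
      rw [one_mul]
      exact hED (Submodule.subset_span (Or.inr ⟨b, hb, hbN, rfl⟩))
    rwa [one_mul] at this
  have hprod : ∀ a b (ha : a ≠ 0) (hb : b ≠ 0), b ≠ a →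
      cauchyKernel ha * cauchyKernel hb ∈ D := fun a b ha hb hab => by
    have h2 := D.smul_mem (((a - b : ℝ) : ℂ) * Complex.I)⁻¹ (D.sub_mem (hker a ha) (hker b hb))
    rwa [cauchyKernel_sub, inv_smul_smul₀] at h2
    refine mul_ne_zero ?_ Complex.I_ne_zero
    exact_mod_cast sub_ne_zero.2 hab.symm
  have hsq : ∀ a b (ha : a ≠ 0) (hb : b ≠ 0), cauchyKernel ha * cauchyKernel hb ∈ D := by
    intro a b ha hb
    by_cases hab : b = a
    · subst hab
      exact mem_of_forall_ne hDc hb (cauchyKernel ha) ∅ finite_empty fun c hc hcb _ =>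
        hprod b c ha hc hcb
    · exact hprod a b ha hb hab
  -- `D` is stable under multiplication by kernels: products of distinct kernels are differences by
  -- `cauchyKernel_sub`, while squares and excluded values of `y` are reached as limits. So `D`
  -- contains the star algebra generated by the kernels, to which Stone-Weierstrass applies.
  have hmul : ∀ a (ha : a ≠ 0), ∀ G ∈ D, cauchyKernel ha * G ∈ D := by
    intro a ha
    have hle : E ≤ D.comap (LinearMap.mulLeft ℂ (cauchyKernel ha)) := by
      rw [hE, Submodule.span_le]
      rintro F (hF | ⟨y, hy, -, rfl⟩)
      · rw [mem_singleton_iff.1 hF]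
        change cauchyKernel ha * 1 ∈ D
        rw [mul_one]
        exact hker a ha
      · exact hsq a y ha hy
    have hcl : IsClosed ((D.comap (LinearMap.mulLeft ℂ (cauchyKernel ha)) :
        Submodule ℂ C(OnePoint ℝ, ℂ)) : Set C(OnePoint ℝ, ℂ)) :=
      hDc.preimage (continuous_const.mul continuous_id)
    exact fun G hG => E.topologicalClosure_minimal hle hcl hG
  let s : Set C(OnePoint ℝ, ℂ) := {F | ∃ (y : ℝ) (hy : y ≠ 0), F = cauchyKernel hy}
  have hstar : star s ⊆ s := by
    rintro F ⟨y, hy, hF⟩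
    refine ⟨-y, neg_ne_zero.2 hy, ?_⟩
    rw [← star_cauchyKernel hy, ← hF, star_star]
  have hA : ∀ F ∈ StarAlgebra.adjoin ℂ s, F ∈ D := by
    intro F hF
    have hF' : F ∈ Algebra.adjoin ℂ s := by
      have h2 : F ∈ (StarAlgebra.adjoin ℂ s).toSubalgebra := hF
      rwa [StarAlgebra.adjoin_toSubalgebra, union_eq_self_of_subset_right hstar] at h2
    have hF2 : F ∈ Subalgebra.toSubmodule (Algebra.adjoin ℂ s) := hF'
    rw [Algebra.adjoin_eq_span] at hF2
    refine (Submodule.span_le.2 fun G hG => ?_) hF2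
    refine Submonoid.closure_induction_left (motive := fun G _ => G ∈ D) h1 (fun x hx y _ hy => ?_) hG
    obtain ⟨a, ha, rfl⟩ := hx
    exact hmul a ha y hy
  have hsep : (StarAlgebra.adjoin ℂ s).SeparatesPoints := by
    intro x y hxy
    refine ⟨cauchyKernel one_ne_zero, ⟨_, StarAlgebra.subset_adjoin ℂ s ⟨1, one_ne_zero, rfl⟩, rfl⟩,
      ?_⟩
    have hne : ∀ t : ℝ, (t : ℂ) - (1 : ℝ) * Complex.I ≠ 0 :=
      ofReal_sub_ne_zero (by simp)
    induction x using OnePoint.rec with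
    | infty =>
      induction y using OnePoint.rec with
      | infty => exact absurd rfl hxy
      | coe t =>
        rw [cauchyKernel_infty, cauchyKernel_coe]
        exact (one_div_ne_zero (hne t)).symm
    | coe t =>
      induction y using OnePoint.rec with
      | infty =>
        rw [cauchyKernel_infty, cauchyKernel_coe]
        exact one_div_ne_zero (hne t)
      | coe t' =>
        rw [cauchyKernel_coe, cauchyKernel_coe]
        intro e
        rw [one_div, one_div, inv_inj, sub_left_inj] at e
        exact hxy (congrArg _ (Complex.ofReal_injective e))
  have htop := ContinuousMap.starSubalgebra_topologicalClosure_eq_top_of_separatesPoints _ hsep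
  rw [eq_top_iff]
  intro F _
  have hF : F ∈ (StarAlgebra.adjoin ℂ s).topologicalClosure := by rw [htop]; trivial
  exact hDc.closure_subset_iff.2 (fun G hG => hA G hG) hF

/-- A uniform bound on the functionals extends convergence from a spanning set to the closure of its
span. Linearity and the bound are asked only for large `ρ`. -/
theorem tendsto_of_topologicalClosure_eq_top {E : Type*} [NormedAddCommGroup E] [NormedSpace ℂ E]
    {s : Set E} (hs : (Submodule.span ℂ s).topologicalClosure = ⊤) {Λ : ℝ → E → ℂ}
    {L : E →L[ℂ] ℂ} {K : ℝ}
    (hΛ : ∀ᶠ ρ in atTop, ∃ T : E →L[ℂ] ℂ, (∀ F, Λ ρ F = T F) ∧ ∀ F, ‖T F‖ ≤ K * ‖F‖)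
    (h : ∀ F ∈ s, Tendsto (fun ρ => Λ ρ F) atTop (𝓝 (L F))) (F : E) :
    Tendsto (fun ρ => Λ ρ F) atTop (𝓝 (L F)) := by
  have hspan : ∀ G ∈ Submodule.span ℂ s, Tendsto (fun ρ => Λ ρ G) atTop (𝓝 (L G)) := by
    intro G hG
    induction hG using Submodule.span_induction with
    | mem x hx => exact h x hx
    | zero =>
      rw [map_zero]
      refine tendsto_const_nhds.congr' ?_
      filter_upwards [hΛ] with ρ ⟨T, hT, _⟩
      rw [hT, map_zero]
    | add x y _ _ hx hy =>
      rw [map_add]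
      refine (hx.add hy).congr' ?_
      filter_upwards [hΛ] with ρ ⟨T, hT, _⟩
      rw [hT, hT, hT, map_add]
    | smul c x _ hx =>
      rw [map_smul]
      refine (hx.const_smul c).congr' ?_
      filter_upwards [hΛ] with ρ ⟨T, hT, _⟩
      rw [hT, hT, map_smul]
  rw [Metric.tendsto_atTop']
  intro ε hε
  set K' := max K ‖L‖ + 1 with hK'
  have hKp : 0 < K' := by have := norm_nonneg L; have := le_max_right K ‖L‖; linarith
  have hF : F ∈ closure (Submodule.span ℂ s : Set E) := by
    rw [← Submodule.topologicalClosure_coe, hs]; trivial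
  obtain ⟨G, hG, hFG⟩ := Metric.mem_closure_iff.1 hF (ε / (3 * K')) (by positivity)
  rw [dist_eq_norm] at hFG
  have hsmall : K' * ‖F - G‖ < ε / 3 := by
    rw [lt_div_iff₀ (by positivity)] at hFG
    linarith
  obtain ⟨R, hR⟩ := (Metric.tendsto_atTop'.1 (hspan G hG)) (ε / 3) (by positivity)
  obtain ⟨R', hR'⟩ := eventually_atTop.1 hΛ
  refine ⟨max R R', fun ρ hρ => ?_⟩
  obtain ⟨T, hT, hTK⟩ := hR' ρ ((le_max_right _ _).trans hρ.le)
  have h1 := hR ρ ((le_max_left _ _).trans_lt hρ)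
  rw [dist_eq_norm] at h1 ⊢
  have e : Λ ρ F - L F = T (F - G) + (Λ ρ G - L G) - L (F - G) := by
    rw [hT, hT, map_sub, map_sub]; ring
  rw [e]
  have n1 : ‖T (F - G)‖ ≤ K' * ‖F - G‖ := (hTK _).trans
    (mul_le_mul_of_nonneg_right (by rw [hK']; linarith [le_max_left K ‖L‖]) (norm_nonneg _))
  have n2 : ‖L (F - G)‖ ≤ K' * ‖F - G‖ := (L.le_opNorm _).trans
    (mul_le_mul_of_nonneg_right (by rw [hK']; linarith [le_max_right K ‖L‖]) (norm_nonneg _))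
  have n3 := norm_sub_le (T (F - G) + (Λ ρ G - L G)) (L (F - G))
  have n4 := norm_add_le (T (F - G)) (Λ ρ G - L G)
  linarith

/-! ### Scaled Cauchy integrals in terms of `M` -/

section Moments

variable {μ : Measure ℝ} {g : ℝ → ℂ}

/-- The Herglotz kernel is `1/(1 + t²)` times the bounded function `z + (1 + z²)/(t - z)`. -/
theorem integrable_herglotz (hg : Integrable (fun t : ℝ => (1 / (1 + (t : ℂ) ^ 2)) * g t) μ) {z : ℂ}
    (hz : z.im ≠ 0) :
    Integrable (fun t : ℝ => (1 / ((t : ℂ) - z) - (t : ℂ) / (1 + (t : ℂ) ^ 2)) * g t) μ := by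
  have hne := ofReal_sub_ne_zero hz
  have hc : Continuous fun t : ℝ => z + (1 + z ^ 2) * (1 / ((t : ℂ) - z)) :=
    continuous_const.add (continuous_const.mul (continuous_const.div (by fun_prop) hne))
  have h1 := hg.bdd_mul (c := ‖z‖ + ‖1 + z ^ 2‖ * |z.im|⁻¹) hc.aestronglyMeasurable
    (Eventually.of_forall fun t => by
      refine (norm_add_le _ _).trans (add_le_add le_rfl ?_)
      rw [norm_mul]
      refine mul_le_mul_of_nonneg_left ?_ (norm_nonneg _)
      rw [norm_div, norm_one, one_div]
      refine inv_anti₀ (abs_pos.2 hz) ?_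
      have := Complex.abs_im_le_norm ((t : ℂ) - z)
      simpa using this)
  refine h1.congr (Eventually.of_forall fun t => ?_)
  have h2 := one_add_sq_ne_zero t
  have h3 := hne t
  simp only
  rw [← mul_assoc]
  congr 1
  field_simp
  ring

theorem scaled_moment_pointwise {T : ℂ} (hT : T - Complex.I ≠ 0) (hT' : T + Complex.I ≠ 0) :
    1 / (1 + T ^ 2) = (1 / (T - Complex.I) - 1 / (T + Complex.I)) / (2 * Complex.I) := by
  have e : 1 + T ^ 2 = (T - Complex.I) * (T + Complex.I) := by
    linear_combination Complex.I_sq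
  have hI := Complex.I_ne_zero
  rw [e]
  field_simp
  ring

theorem scaled_moment_pointwise_inv {T y : ℂ} (hT : T - Complex.I ≠ 0) (hT' : T + Complex.I ≠ 0)
    (hy : T - y * Complex.I ≠ 0) (h1 : 1 - y ≠ 0) (h2 : 1 + y ≠ 0) :
    1 / (T - y * Complex.I) * (1 / (1 + T ^ 2)) =
      1 / (T - y * Complex.I) / (1 - y ^ 2) - 1 / (T - Complex.I) / (2 * (1 - y)) -
        1 / (T + Complex.I) / (2 * (1 + y)) := by
  have e : 1 + T ^ 2 = (T - Complex.I) * (T + Complex.I) := by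
    linear_combination Complex.I_sq
  rw [e, show 1 - y ^ 2 = (1 - y) * (1 + y) by ring]
  field_simp
  linear_combination (-(2 * (y ^ 2 - 1)) : ℂ) * Complex.I_sq

variable {m : ℂ → ℂ} {k : ℂ}

theorem integrable_scaled (hg : Integrable (fun t : ℝ => (1 / (1 + (t : ℂ) ^ 2)) * g t) μ) {ρ : ℝ}
    (hρ : 0 < ρ) : Integrable (fun t : ℝ => (1 / (1 + ((t / ρ : ℝ) : ℂ) ^ 2)) * g t) μ := by
  have hc : Continuous fun t : ℝ => (1 + (t : ℂ) ^ 2) / (1 + ((t / ρ : ℝ) : ℂ) ^ 2) :=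
    (by fun_prop : Continuous fun t : ℝ => 1 + (t : ℂ) ^ 2).div (by fun_prop)
      fun t => one_add_sq_ne_zero _
  have h1 := hg.bdd_mul (c := 1 + ρ ^ 2) hc.aestronglyMeasurable
    (Eventually.of_forall fun t => by
      have e : (1 + (t : ℂ) ^ 2) / (1 + ((t / ρ : ℝ) : ℂ) ^ 2) =
        (((1 + t ^ 2) / (1 + (t / ρ) ^ 2) : ℝ) : ℂ) := by push_cast; rfl
      rw [e, Complex.norm_real, Real.norm_of_nonneg (by positivity), div_le_iff₀ (by positivity)]
      have : ρ ^ 2 * (t / ρ) ^ 2 = t ^ 2 := by field_simp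
      nlinarith [sq_nonneg (t / ρ), sq_nonneg ρ])
  refine h1.congr (Eventually.of_forall fun t => ?_)
  have h2 := one_add_sq_ne_zero t
  simp only
  rw [← mul_assoc]
  congr 1
  field_simp

theorem integral_scaled (hg : Integrable (fun t : ℝ => (1 / (1 + (t : ℂ) ^ 2)) * g t) μ)
    (hm : ∀ z : ℂ, z.im ≠ 0 →
      m z = k + ∫ t : ℝ, (1 / ((t : ℂ) - z) - (t : ℂ) / (1 + (t : ℂ) ^ 2)) * g t ∂μ)
    {ρ : ℝ} (hρ : 0 < ρ) :
    ∫ t : ℝ, (1 / (1 + ((t / ρ : ℝ) : ℂ) ^ 2)) * g t ∂μ =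
      ρ * ((m (ρ * Complex.I) - m (-(ρ * Complex.I))) / (2 * Complex.I)) := by
  have z1 : ((ρ : ℂ) * Complex.I).im ≠ 0 := by simpa using hρ.ne'
  have z2 : (-((ρ : ℂ) * Complex.I)).im ≠ 0 := by simpa using hρ.ne'
  have hρ' : (ρ : ℂ) ≠ 0 := by exact_mod_cast hρ.ne'
  have i1 := integrable_herglotz hg z1
  have i2 := integrable_herglotz hg z2
  rw [hm _ z1, hm _ z2, add_sub_add_left_eq_sub, ← integral_sub i1 i2, ← integral_div,
    ← integral_const_mul]
  refine integral_congr_ae (Eventually.of_forall fun t => ?_)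
  have n1 := ofReal_sub_ne_zero (z := Complex.I) (by simp) (t / ρ)
  have n2 : ((t / ρ : ℝ) : ℂ) + Complex.I ≠ 0 := by
    simpa using ofReal_sub_ne_zero (z := -Complex.I) (by simp) (t / ρ)
  simp only
  rw [scaled_moment_pointwise n1 n2]
  have e1 : (t : ℂ) - ρ * Complex.I = ρ * (((t / ρ : ℝ) : ℂ) - Complex.I) := by
    push_cast; field_simp
  have e2 : (t : ℂ) - -(ρ * Complex.I) = ρ * (((t / ρ : ℝ) : ℂ) + Complex.I) := by
    push_cast; field_simp; ring
  rw [e1, e2]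
  generalize ((t / ρ : ℝ) : ℂ) = T at *
  have hI := Complex.I_ne_zero
  field_simp
  ring

/-- The partial fraction coefficients at `iy, i, -i` sum to zero, so both the additive constant `k`
and the compensating term `t/(1 + t²)` drop out. -/
theorem integral_scaled_inv (hg : Integrable (fun t : ℝ => (1 / (1 + (t : ℂ) ^ 2)) * g t) μ)
    (hm : ∀ z : ℂ, z.im ≠ 0 →
      m z = k + ∫ t : ℝ, (1 / ((t : ℂ) - z) - (t : ℂ) / (1 + (t : ℂ) ^ 2)) * g t ∂μ)
    {ρ : ℝ} (hρ : 0 < ρ) {y : ℝ} (h0 : y ≠ 0) (h1 : y ≠ 1) (h2 : y ≠ -1) :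
    ∫ t : ℝ, (1 / (((t / ρ : ℝ) : ℂ) - y * Complex.I)) *
        ((1 / (1 + ((t / ρ : ℝ) : ℂ) ^ 2)) * g t) ∂μ =
      ρ * (m ((y * ρ : ℝ) * Complex.I) / (1 - y ^ 2) - m (ρ * Complex.I) / (2 * (1 - y)) -
        m (-(ρ * Complex.I)) / (2 * (1 + y))) := by
  have z1 : ((ρ : ℂ) * Complex.I).im ≠ 0 := by simpa using hρ.ne'
  have z2 : (-((ρ : ℂ) * Complex.I)).im ≠ 0 := by simpa using hρ.ne'
  have z3 : (((y * ρ : ℝ) : ℂ) * Complex.I).im ≠ 0 := by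
    simpa using ⟨h0, hρ.ne'⟩
  have hρ' : (ρ : ℂ) ≠ 0 := by exact_mod_cast hρ.ne'
  have hz : (1 : ℂ) - y ≠ 0 := by exact_mod_cast sub_ne_zero.2 (Ne.symm h1)
  have hz' : (1 : ℂ) + y ≠ 0 := by exact_mod_cast fun e : 1 + y = 0 => h2 (by linarith)
  have i1 := (integrable_herglotz hg z1).div_const (2 * (1 - y) : ℂ)
  have i2 := (integrable_herglotz hg z2).div_const (2 * (1 + y) : ℂ)
  have i3 := (integrable_herglotz hg z3).div_const (1 - y ^ 2 : ℂ)
  have hk : k / (1 - (y : ℂ) ^ 2) - k / (2 * (1 - y)) - k / (2 * (1 + y)) = 0 := by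
    rw [show (1 : ℂ) - (y : ℂ) ^ 2 = (1 - y) * (1 + y) by ring]
    field_simp
    ring
  rw [hm _ z1, hm _ z2, hm _ z3]
  have e0 : ∀ a b c : ℂ, (k + a) / (1 - (y : ℂ) ^ 2) - (k + b) / (2 * (1 - y)) -
      (k + c) / (2 * (1 + y)) = a / (1 - (y : ℂ) ^ 2) - b / (2 * (1 - y)) - c / (2 * (1 + y)) :=
    fun a b c => by linear_combination hk
  have i31 : Integrable (fun t : ℝ =>
      (1 / ((t : ℂ) - ((y * ρ : ℝ) : ℂ) * Complex.I) - (t : ℂ) / (1 + (t : ℂ) ^ 2)) * g t /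
        (1 - (y : ℂ) ^ 2) -
      (1 / ((t : ℂ) - (ρ : ℂ) * Complex.I) - (t : ℂ) / (1 + (t : ℂ) ^ 2)) * g t /
        (2 * (1 - (y : ℂ)))) μ := i3.sub i1
  rw [e0, ← integral_div, ← integral_div, ← integral_div, ← integral_sub i3 i1,
    ← integral_sub i31 i2, ← integral_const_mul]
  refine integral_congr_ae (Eventually.of_forall fun t => ?_)
  have n1 := ofReal_sub_ne_zero (z := Complex.I) (by simp) (t / ρ)
  have n2 : ((t / ρ : ℝ) : ℂ) + Complex.I ≠ 0 := by
    simpa using ofReal_sub_ne_zero (z := -Complex.I) (by simp) (t / ρ)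
  have n3 := ofReal_sub_ne_zero (z := y * Complex.I) (by simpa using h0) (t / ρ)
  have e1 : (t : ℂ) - ρ * Complex.I = ρ * (((t / ρ : ℝ) : ℂ) - Complex.I) := by
    push_cast; field_simp
  have e2 : (t : ℂ) - -(ρ * Complex.I) = ρ * (((t / ρ : ℝ) : ℂ) + Complex.I) := by
    push_cast; field_simp; ring
  have e3 : (t : ℂ) - (y * ρ : ℝ) * Complex.I = ρ * (((t / ρ : ℝ) : ℂ) - y * Complex.I) := by
    push_cast; field_simp
  have hps := scaled_moment_pointwise_inv n1 n2 n3 hz hz'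
  simp only
  rw [← mul_assoc, hps, e1, e2, e3]
  have hr : ∀ x : ℂ, 1 / (ρ * x) = 1 / ρ * (1 / x) := fun x => by rw [one_div_mul_one_div]
  rw [hr, hr, hr]
  have hρ1 : (ρ : ℂ) * (1 / ρ) = 1 := mul_one_div_cancel hρ'
  have hk2 : ∀ τ : ℂ, τ / (1 - (y : ℂ) ^ 2) - τ / (2 * (1 - y)) - τ / (2 * (1 + y)) = 0 := by
    intro τ
    rw [show (1 : ℂ) - (y : ℂ) ^ 2 = (1 - y) * (1 + y) by ring]
    field_simp
    ring
  have hk3 := hk2 ((t : ℂ) / (1 + (t : ℂ) ^ 2))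
  generalize 1 / (((t / ρ : ℝ) : ℂ) - Complex.I) = A1
  generalize 1 / (((t / ρ : ℝ) : ℂ) + Complex.I) = A2
  generalize 1 / (((t / ρ : ℝ) : ℂ) - y * Complex.I) = A3
  linear_combination (ρ * g t) * hk3 + (-(A3 / (1 - (y : ℂ) ^ 2) - A1 / (2 * (1 - y)) -
    A2 / (2 * (1 + y))) * g t) * hρ1

end Moments

/-! ### Weak convergence of the rescaled measures -/

section WeakLimit

/-- Scaled integrals of compactly supported functions converge. -/
def HasScaledLimit (μ : Measure ℝ) (g : ℝ → ℂ) (c : ℝ → ℝ) (w : ℝ → ℂ) : Prop :=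
  ∀ f : ℝ → ℝ, Continuous f → HasCompactSupport f →
    Tendsto (fun ρ => (c ρ : ℂ) * ∫ t, (f (t / ρ) : ℂ) * g t ∂μ) atTop (𝓝 (∫ t, (f t : ℂ) * w t))

theorem exists_clm_integral {μ : Measure ℝ} {h : ℝ → ℂ} (hh : Integrable h μ) {u : ℝ → ℝ}
    (hu : Continuous u) : ∃ T : C(OnePoint ℝ, ℂ) →L[ℂ] ℂ,
      (∀ F : C(OnePoint ℝ, ℂ), T F = ∫ t, F (u t) * h t ∂μ) ∧
      ∀ F, ‖T F‖ ≤ (∫ t, ‖h t‖ ∂μ) * ‖F‖ := by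
  have hi : ∀ F : C(OnePoint ℝ, ℂ), Integrable (fun t => F (u t) * h t) μ := fun F =>
    hh.bdd_mul (c := ‖F‖)
      (F.continuous.comp (OnePoint.continuous_coe.comp hu)).aestronglyMeasurable
      (Eventually.of_forall fun t => F.norm_coe_le_norm _)
  let T : C(OnePoint ℝ, ℂ) →ₗ[ℂ] ℂ :=
    { toFun := fun F => ∫ t, F (u t) * h t ∂μ
      map_add' := fun F G => by
        rw [← integral_add (hi F) (hi G)]
        refine integral_congr_ae (Eventually.of_forall fun t => ?_)
        simp only [ContinuousMap.add_apply]
        ring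
      map_smul' := fun c F => by
        rw [RingHom.id_apply, smul_eq_mul, ← integral_const_mul]
        refine integral_congr_ae (Eventually.of_forall fun t => ?_)
        simp only [ContinuousMap.smul_apply, smul_eq_mul]
        ring }
  have hb : ∀ F, ‖T F‖ ≤ (∫ t, ‖h t‖ ∂μ) * ‖F‖ := fun F => by
    rw [mul_comm, ← integral_const_mul]
    refine norm_integral_le_of_norm_le (hh.norm.const_mul _) (Eventually.of_forall fun t => ?_)
    rw [norm_mul]
    exact mul_le_mul_of_nonneg_right (F.norm_coe_le_norm _) (norm_nonneg _)
  exact ⟨T.mkContinuous _ hb, fun F => rfl, hb⟩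

variable {μ : Measure ℝ} {g : ℝ → ℂ} {m : ℂ → ℂ} {k k₀ : ℂ} {w : ℝ → ℂ} {β : ℝ} {mp mm : ℂ}

/-- The hypotheses are evaluated at `|y|ρ`; the sign of `y` selects the half of the imaginary axis.
-/
theorem tendsto_scaled_ray
    (hp : Tendsto (fun ρ : ℝ => ((ρ ^ (-β) : ℝ) : ℂ) * (m (ρ * Complex.I) - k₀)) atTop (𝓝 mp))
    (hn : Tendsto (fun ρ : ℝ => ((ρ ^ (-β) : ℝ) : ℂ) * (m (-(ρ * Complex.I)) - k₀)) atTop (𝓝 mm))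
    {y : ℝ} (hy : y ≠ 0) :
    Tendsto (fun ρ : ℝ => ((ρ ^ (-β) : ℝ) : ℂ) * (m ((y * ρ : ℝ) * Complex.I) - k₀)) atTop
      (𝓝 (((|y| ^ β : ℝ) : ℂ) * (if 0 < y then mp else mm))) := by
  have hy0 : 0 < |y| := abs_pos.2 hy
  have hs : Tendsto (fun ρ : ℝ => |y| * ρ) atTop atTop := tendsto_id.const_mul_atTop hy0
  have e : ∀ ρ : ℝ, 0 < ρ → |y| ^ β * (|y| * ρ) ^ (-β) = ρ ^ (-β) := fun ρ hρ => by
    rw [Real.mul_rpow hy0.le hρ.le, ← mul_assoc, ← Real.rpow_add hy0]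
    simp
  rcases lt_or_gt_of_ne hy with h | h
  · rw [if_neg (not_lt.2 h.le)]
    refine ((hn.comp hs).const_mul _).congr' ?_
    filter_upwards [eventually_gt_atTop 0] with ρ hρ
    simp only [Function.comp_apply]
    rw [← mul_assoc, ← Complex.ofReal_mul, e ρ hρ, abs_of_neg h]
    congr 4
    push_cast
    ring
  · rw [if_pos h]
    refine ((hp.comp hs).const_mul _).congr' ?_
    filter_upwards [eventually_gt_atTop 0] with ρ hρ
    simp only [Function.comp_apply]
    rw [← mul_assoc, ← Complex.ofReal_mul, e ρ hρ, abs_of_pos h]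

theorem tendsto_scaled_mass (hg : Integrable (fun t : ℝ => (1 / (1 + (t : ℂ) ^ 2)) * g t) μ)
    (hm : ∀ z : ℂ, z.im ≠ 0 →
      m z = k + ∫ t : ℝ, (1 / ((t : ℂ) - z) - (t : ℂ) / (1 + (t : ℂ) ^ 2)) * g t ∂μ)
    (hp : Tendsto (fun ρ : ℝ => ((ρ ^ (-β) : ℝ) : ℂ) * (m (ρ * Complex.I) - k₀)) atTop (𝓝 mp))
    (hn : Tendsto (fun ρ : ℝ => ((ρ ^ (-β) : ℝ) : ℂ) * (m (-(ρ * Complex.I)) - k₀)) atTop (𝓝 mm)) :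
    Tendsto (fun ρ : ℝ => ((ρ ^ (-β - 1) : ℝ) : ℂ) *
      ∫ t : ℝ, (1 / (1 + ((t / ρ : ℝ) : ℂ) ^ 2)) * g t ∂μ) atTop
      (𝓝 ((mp - mm) / (2 * Complex.I))) := by
  refine ((hp.sub hn).div_const (2 * Complex.I)).congr' ?_
  filter_upwards [eventually_gt_atTop 0] with ρ hρ
  rw [integral_scaled hg hm hρ, Real.rpow_sub_one hρ.ne']
  have hρ' : (ρ : ℂ) ≠ 0 := by exact_mod_cast hρ.ne'
  push_cast
  field_simp
  ring

/-- By `hK` the rescaled measures, weighted with `1/(1 + t²)`, are uniformly bounded functionals on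
`C(OnePoint ℝ, ℂ)`. Their limits on `1` and on the Cauchy kernels are given by `M` and match the
model, and density does the rest. A compactly supported `f` enters as `(1 + t²) f`, extended by `0`
at infinity. -/
theorem hasScaledLimit (hg : Integrable (fun t : ℝ => (1 / (1 + (t : ℂ) ^ 2)) * g t) μ)
    (hm : ∀ z : ℂ, z.im ≠ 0 →
      m z = k + ∫ t : ℝ, (1 / ((t : ℂ) - z) - (t : ℂ) / (1 + (t : ℂ) ^ 2)) * g t ∂μ)
    (hp : Tendsto (fun ρ : ℝ => ((ρ ^ (-β) : ℝ) : ℂ) * (m (ρ * Complex.I) - k₀)) atTop (𝓝 mp))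
    (hn : Tendsto (fun ρ : ℝ => ((ρ ^ (-β) : ℝ) : ℂ) * (m (-(ρ * Complex.I)) - k₀)) atTop (𝓝 mm))
    {K : ℝ} (hK : ∀ᶠ ρ : ℝ in atTop, ρ ^ (-β - 1) *
      ∫ t : ℝ, ‖(1 / (1 + ((t / ρ : ℝ) : ℂ) ^ 2)) * g t‖ ∂μ ≤ K)
    (hw : IsHomogeneousModel w β mp mm) : HasScaledLimit μ g (fun ρ => ρ ^ (-β - 1)) w := by
  obtain ⟨L, hL, -⟩ := exists_clm_integral (μ := volume) hw.integrable continuous_id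
  have hdense := span_cauchyKernel_dense {1, -1} (by simp)
  let Λ : ℝ → C(OnePoint ℝ, ℂ) → ℂ := fun ρ F => ((ρ ^ (-β - 1) : ℝ) : ℂ) *
    ∫ t : ℝ, F ((t / ρ : ℝ) : OnePoint ℝ) * ((1 / (1 + ((t / ρ : ℝ) : ℂ) ^ 2)) * g t) ∂μ
  have hΛ : ∀ᶠ ρ in atTop, ∃ T : C(OnePoint ℝ, ℂ) →L[ℂ] ℂ, (∀ F, Λ ρ F = T F) ∧
      ∀ F, ‖T F‖ ≤ K * ‖F‖ := by
    filter_upwards [eventually_gt_atTop 0, hK] with ρ hρ hKρ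
    obtain ⟨T, hT, hTb⟩ := exists_clm_integral (integrable_scaled hg hρ)
      (u := fun t => t / ρ) (by fun_prop)
    have hc : 0 ≤ ρ ^ (-β - 1) := Real.rpow_nonneg hρ.le _
    refine ⟨((ρ ^ (-β - 1) : ℝ) : ℂ) • T, fun F => ?_, fun F => ?_⟩
    · simp only [Λ]
      rw [← hT]
      rfl
    · change ‖((ρ ^ (-β - 1) : ℝ) : ℂ) • T F‖ ≤ _
      rw [norm_smul, Complex.norm_real, Real.norm_of_nonneg hc]
      refine (mul_le_mul_of_nonneg_left (hTb F) hc).trans ?_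
      rw [← mul_assoc]
      exact mul_le_mul_of_nonneg_right hKρ (norm_nonneg F)
  have hlim : ∀ F : C(OnePoint ℝ, ℂ), Tendsto (fun ρ => Λ ρ F) atTop (𝓝 (L F)) := by
    refine tendsto_of_topologicalClosure_eq_top hdense hΛ ?_
    rintro F (hF | ⟨y, hy, hyN, rfl⟩)
    · rw [mem_singleton_iff.1 hF, hL]
      simp only [Λ, ContinuousMap.one_apply, one_mul]
      rw [hw.integral_one]
      exact tendsto_scaled_mass hg hm hp hn
    · have hy1 : y ≠ 1 := fun e => hyN (by simp [e])
      have hy2 : y ≠ -1 := fun e => hyN (by simp [e])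
      rw [hL]
      simp only [Λ, cauchyKernel_coe, id]
      rw [hw.integral_inv y hy hy1 hy2]
      have hz : (1 : ℂ) - y ≠ 0 := by exact_mod_cast sub_ne_zero.2 (Ne.symm hy1)
      have hz' : (1 : ℂ) + y ≠ 0 := by exact_mod_cast fun e : 1 + y = 0 => hy2 (by linarith)
      have h3 := (((tendsto_scaled_ray hp hn hy).div_const (1 - (y : ℂ) ^ 2)).sub
        (hp.div_const (2 * (1 - (y : ℂ))))).sub (hn.div_const (2 * (1 + (y : ℂ))))
      refine h3.congr' ?_
      filter_upwards [eventually_gt_atTop 0] with ρ hρ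
      rw [integral_scaled_inv hg hm hρ hy hy1 hy2, Real.rpow_sub_one hρ.ne']
      have hρ' : (ρ : ℂ) ≠ 0 := by exact_mod_cast hρ.ne'
      rw [show (1 : ℂ) - (y : ℂ) ^ 2 = (1 - y) * (1 + y) by ring]
      push_cast
      field_simp
      ring
  intro f hf hfc
  let F : C(OnePoint ℝ, ℂ) := OnePoint.continuousMapMk
    ⟨fun t : ℝ => (1 + (t : ℂ) ^ 2) * (f t : ℂ), by fun_prop⟩ 0 <| by
      rw [coclosedCompact_eq_cocompact]
      have hcs : HasCompactSupport fun t : ℝ => (1 + (t : ℂ) ^ 2) * (f t : ℂ) :=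
        (hfc.comp_left (g := fun x : ℝ => (x : ℂ)) (by simp)).mul_left
      exact hcs.is_zero_at_infty
  have h1 := hlim F
  rw [hL] at h1
  have e1 : ∀ t : ℝ, F (t : OnePoint ℝ) = (1 + (t : ℂ) ^ 2) * (f t : ℂ) := fun t => rfl
  simp only [Λ, e1, id] at h1
  have e2 : ∀ t : ℝ, (1 + (t : ℂ) ^ 2) * (f t : ℂ) * (w t / (1 + (t : ℂ) ^ 2)) = f t * w t :=
    fun t => by
      have := one_add_sq_ne_zero t
      field_simp
  have e3 : ∀ (ρ t : ℝ), (1 + ((t / ρ : ℝ) : ℂ) ^ 2) * (f (t / ρ) : ℂ) *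
      ((1 / (1 + ((t / ρ : ℝ) : ℂ) ^ 2)) * g t) = f (t / ρ) * g t := fun ρ t => by
    have := one_add_sq_ne_zero (t / ρ)
    generalize ((t / ρ : ℝ) : ℂ) = T at *
    field_simp
  simp only [e2, e3] at h1
  exact h1

end WeakLimit

/-! ### From test functions to intervals -/

section Sandwich

/-- A continuous approximation of the indicator function of `[p, q]`: from below for `c = 0`, from
above for `c = 1`. -/
def plateau (p q c : ℝ) (n : ℕ) (t : ℝ) : ℝ := max 0 (min 1 (c + n * min (t - p) (q - t)))

variable {p q c : ℝ}

theorem continuous_plateau (n : ℕ) : Continuous (plateau p q c n) := by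
  unfold plateau
  fun_prop

theorem plateau_nonneg (n : ℕ) (t : ℝ) : 0 ≤ plateau p q c n t := le_max_left _ _

theorem plateau_le_one (n : ℕ) (t : ℝ) : plateau p q c n t ≤ 1 :=
  max_le zero_le_one (min_le_left _ _)

theorem plateau_eq_zero {n : ℕ} {t : ℝ} (h : c + n * min (t - p) (q - t) ≤ 0) :
    plateau p q c n t = 0 := max_eq_left ((min_le_right _ _).trans h)

theorem plateau_eq_one {n : ℕ} {t : ℝ} (h : 1 ≤ c + n * min (t - p) (q - t)) :
    plateau p q c n t = 1 := by
  rw [plateau, min_eq_left h, max_eq_right zero_le_one]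

theorem plateau_eq_zero_of_notMem (hc : c ≤ 1) {n : ℕ} (hn : 1 ≤ n) {t : ℝ}
    (ht : t ∉ Icc (p - 1) (q + 1)) : plateau p q c n t = 0 := by
  refine plateau_eq_zero ?_
  have h : min (t - p) (q - t) ≤ -1 := by
    by_contra! h
    have h1 := h.trans_le (min_le_left _ _)
    have h2 := h.trans_le (min_le_right _ _)
    exact ht ⟨by linarith, by linarith⟩
  have hn' : (1 : ℝ) ≤ n := by exact_mod_cast hn
  nlinarith

theorem hasCompactSupport_plateau (hc : c ≤ 1) {n : ℕ} (hn : 1 ≤ n) :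
    HasCompactSupport (plateau p q c n) :=
  HasCompactSupport.of_support_subset_isCompact isCompact_Icc fun _ ht => by
    by_contra h
    exact ht (plateau_eq_zero_of_notMem hc hn h)

theorem plateau_one_of_mem {n : ℕ} {t : ℝ} (ht : t ∈ Icc p q) : plateau p q 1 n t = 1 := by
  refine plateau_eq_one ?_
  have : 0 ≤ min (t - p) (q - t) := le_min (by linarith [ht.1]) (by linarith [ht.2])
  have := mul_nonneg (Nat.cast_nonneg (α := ℝ) n) this
  linarith

theorem plateau_zero_of_notMem {n : ℕ} {t : ℝ} (ht : t ∉ Icc p q) : plateau p q 0 n t = 0 := by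
  refine plateau_eq_zero ?_
  have h : min (t - p) (q - t) ≤ 0 := by
    by_contra! h
    have h1 := h.trans_le (min_le_left _ _)
    have h2 := h.trans_le (min_le_right _ _)
    exact ht ⟨by linarith, by linarith⟩
  have := mul_nonpos_of_nonneg_of_nonpos (Nat.cast_nonneg (α := ℝ) n) h
  linarith

theorem tendsto_plateau {t : ℝ} (hp : t ≠ p) (hq : t ≠ q) :
    Tendsto (fun n => plateau p q c n t) atTop (𝓝 ((Icc p q).indicator 1 t)) := by
  have key : min (t - p) (q - t) ≠ 0 := by
    rcases min_choice (t - p) (q - t) with h | h <;> rw [h]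
    · exact sub_ne_zero.2 hp
    · exact sub_ne_zero.2 (Ne.symm hq)
  rcases lt_or_gt_of_ne key with h | h
  · have hnot : t ∉ Icc p q := fun ht =>
      absurd (le_min (by linarith [ht.1]) (by linarith [ht.2]) : 0 ≤ min (t - p) (q - t))
        (not_le.2 h)
    rw [indicator_of_notMem hnot]
    refine tendsto_const_nhds.congr' ?_
    have h1 := tendsto_atBot_add_const_left atTop c
      (tendsto_natCast_atTop_atTop (R := ℝ).atTop_mul_const_of_neg h)
    filter_upwards [h1.eventually (eventually_le_atBot 0)] with n hn
    exact (plateau_eq_zero hn).symm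
  · have hmem : t ∈ Icc p q :=
      ⟨by linarith [h.trans_le (min_le_left _ _)], by linarith [h.trans_le (min_le_right _ _)]⟩
    rw [indicator_of_mem hmem]
    refine tendsto_const_nhds.congr' ?_
    have h1 := tendsto_atTop_add_const_left atTop c
      (tendsto_natCast_atTop_atTop (R := ℝ).atTop_mul_const h)
    filter_upwards [h1.eventually (eventually_ge_atTop 1)] with n hn
    exact (plateau_eq_one hn).symm

/-- The endpoints, where pointwise convergence can fail, are Lebesgue null. The index is `n + 1`
because for `n = 0` and `c = 1` the plateau is identically `1` and has no compact support. -/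
theorem tendsto_integral_plateau_mul (hc : c ≤ 1) {w : ℝ → ℂ} (hw : LocallyIntegrable w) :
    Tendsto (fun n : ℕ => ∫ t, (plateau p q c (n + 1) t : ℂ) * w t) atTop
      (𝓝 (∫ t in Icc p q, w t)) := by
  rw [← integral_indicator measurableSet_Icc]
  refine tendsto_integral_of_dominated_convergence
    (fun t => (Icc (p - 1) (q + 1)).indicator (fun t => ‖w t‖) t) (fun n => ?_) ?_ ?_ ?_
  · exact (Complex.continuous_ofReal.comp (continuous_plateau _)).aestronglyMeasurable.mul
      hw.aestronglyMeasurable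
  · rw [integrable_indicator_iff measurableSet_Icc]
    exact (hw.integrableOn_isCompact isCompact_Icc).norm
  · refine fun n => Eventually.of_forall fun t => ?_
    by_cases ht : t ∈ Icc (p - 1) (q + 1)
    · rw [indicator_of_mem ht, norm_mul, Complex.norm_real,
        Real.norm_of_nonneg (plateau_nonneg _ _)]
      exact mul_le_of_le_one_left (norm_nonneg _) (plateau_le_one _ _)
    · rw [indicator_of_notMem ht, plateau_eq_zero_of_notMem hc (Nat.le_add_left 1 n) ht]
      simp
  · have h0 : ∀ᵐ t : ℝ, t ≠ p ∧ t ≠ q := by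
      have := (Countable.ae_notMem (μ := volume) (toFinite ({p, q} : Set ℝ)).countable)
      filter_upwards [this] with t ht
      simpa using ht
    filter_upwards [h0] with t ht
    have h1 := (((Complex.continuous_ofReal.tendsto _).comp
      (tendsto_plateau (c := c) ht.1 ht.2)).comp (tendsto_add_atTop_nat 1)).mul_const (w t)
    have e : (((Icc p q).indicator 1 t : ℝ) : ℂ) * w t = (Icc p q).indicator w t := by
      by_cases hm : t ∈ Icc p q <;> simp [hm]
    rw [← e]
    exact h1

theorem LocallyIntegrable.scaled_mul {μ : Measure ℝ} {g : ℝ → ℂ} (hg : LocallyIntegrable g μ)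
    {f : ℝ → ℝ} (hf : Continuous f) (hfc : HasCompactSupport f) {ρ : ℝ} (hρ : 0 < ρ) :
    Integrable (fun t => (f (t / ρ) : ℂ) * g t) μ := by
  have h1 : Continuous fun t => (f (t / ρ) : ℂ) := by fun_prop
  have h2 : HasCompactSupport fun t => (f (t / ρ) : ℂ) :=
    (hfc.comp_homeomorph (Homeomorph.mulRight₀ ρ⁻¹ (inv_ne_zero hρ.ne'))).comp_left
      (g := fun x : ℝ => (x : ℂ)) Complex.ofReal_zero
  exact hg.integrable_smul_left_of_hasCompactSupport h1 h2

theorem HasScaledLimit.add {μ : Measure ℝ} {g g' : ℝ → ℂ} {c : ℝ → ℝ} {w w' : ℝ → ℂ}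
    (hg : HasScaledLimit μ g c w) (hg' : HasScaledLimit μ g' c w') (hgl : LocallyIntegrable g μ)
    (hgl' : LocallyIntegrable g' μ) (hw : LocallyIntegrable w) (hw' : LocallyIntegrable w') :
    HasScaledLimit μ (fun t => g t + g' t) c (fun t => w t + w' t) := by
  intro f hf hfc
  have h1 := LocallyIntegrable.scaled_mul hw hf hfc one_pos
  have h2 := LocallyIntegrable.scaled_mul hw' hf hfc one_pos
  simp only [div_one] at h1 h2
  simp only [mul_add]
  rw [integral_add h1 h2]
  refine ((hg f hf hfc).add (hg' f hf hfc)).congr' ?_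
  filter_upwards [eventually_gt_atTop 0] with ρ hρ
  rw [integral_add (LocallyIntegrable.scaled_mul hgl hf hfc hρ)
    (LocallyIntegrable.scaled_mul hgl' hf hfc hρ), mul_add]

/-- A complex `g` cannot be sandwiched itself. Replacing the indicator by the upper plateau costs at
most the integral of `τ` against the difference of the upper and lower plateaus. The scaled limit of
that integral is small for large `n`, because the limit measure `w' dt` does not charge the
endpoints. -/
theorem HasScaledLimit.tendsto_setIntegral {μ : Measure ℝ} {g : ℝ → ℂ} {τ : ℝ → ℝ} {c : ℝ → ℝ}
    {w w' : ℝ → ℂ} (hgl : LocallyIntegrable g μ) (hτl : LocallyIntegrable (fun t => (τ t : ℂ)) μ)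
    (hle : ∀ t, ‖g t‖ ≤ τ t) (hc : ∀ᶠ ρ in atTop, 0 ≤ c ρ) (hg : HasScaledLimit μ g c w)
    (hτ : HasScaledLimit μ (fun t => (τ t : ℂ)) c w') (hw : LocallyIntegrable w)
    (hw' : LocallyIntegrable w') (p q : ℝ) :
    Tendsto (fun ρ => (c ρ : ℂ) * ∫ t in Icc (ρ * p) (ρ * q), g t ∂μ) atTop
      (𝓝 (∫ t in Icc p q, w t)) := by
  have a1 := tendsto_integral_plateau_mul (p := p) (q := q) (c := 1) le_rfl hw
  have a2 := (tendsto_integral_plateau_mul (p := p) (q := q) (c := 1) le_rfl hw').sub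
    (tendsto_integral_plateau_mul (p := p) (q := q) (c := 0) zero_le_one hw')
  rw [sub_self] at a2
  rw [Metric.tendsto_nhds]
  intro ε hε
  have hε3 : 0 < ε / 3 := by positivity
  obtain ⟨n, hn1, hn2⟩ := (((Metric.tendsto_nhds.1 a1) _ hε3).and
    ((Metric.tendsto_nhds.1 a2) _ hε3)).exists
  rw [dist_zero_right] at hn2
  have hn0 : 1 ≤ n + 1 := Nat.le_add_left 1 n
  have b1 := hg _ (continuous_plateau (p := p) (q := q) (c := 1) (n + 1))
    (hasCompactSupport_plateau le_rfl hn0)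
  have b2 := (hτ _ (continuous_plateau (p := p) (q := q) (c := 1) (n + 1))
    (hasCompactSupport_plateau le_rfl hn0)).sub
    (hτ _ (continuous_plateau (p := p) (q := q) (c := 0) (n + 1))
    (hasCompactSupport_plateau zero_le_one hn0))
  filter_upwards [hc, eventually_gt_atTop 0, (Metric.tendsto_nhds.1 b1) _ hε3,
    b2.norm.eventually (gt_mem_nhds hn2)] with ρ hcρ hρ hb1 hb2
  have i1 := LocallyIntegrable.scaled_mul hgl (continuous_plateau (p := p) (q := q) (n + 1))
    (hasCompactSupport_plateau le_rfl hn0) hρ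
  have j1 := LocallyIntegrable.scaled_mul hτl (continuous_plateau (p := p) (q := q) (n + 1))
    (hasCompactSupport_plateau le_rfl hn0) hρ
  have j0 := LocallyIntegrable.scaled_mul hτl (continuous_plateau (p := p) (q := q) (n + 1))
    (hasCompactSupport_plateau zero_le_one hn0) hρ
  have i2 : Integrable ((Icc (ρ * p) (ρ * q)).indicator g) μ :=
    (hgl.integrableOn_isCompact isCompact_Icc).integrable_indicator measurableSet_Icc
  have hmem : ∀ t, t ∈ Icc (ρ * p) (ρ * q) ↔ t / ρ ∈ Icc p q := fun t => by
    rw [mem_Icc, mem_Icc, le_div_iff₀ hρ, div_le_iff₀ hρ, mul_comm ρ, mul_comm ρ]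
  have key : ‖(c ρ : ℂ) * (∫ t in Icc (ρ * p) (ρ * q), g t ∂μ) -
      (c ρ : ℂ) * ∫ t, (plateau p q 1 (n + 1) (t / ρ) : ℂ) * g t ∂μ‖ ≤
      ‖(c ρ : ℂ) * (∫ t, (plateau p q 1 (n + 1) (t / ρ) : ℂ) * τ t ∂μ) -
        (c ρ : ℂ) * ∫ t, (plateau p q 0 (n + 1) (t / ρ) : ℂ) * τ t ∂μ‖ := by
    rw [← mul_sub, ← mul_sub, norm_mul, norm_mul, ← integral_indicator measurableSet_Icc,
      ← integral_sub i2 i1, ← integral_sub j1 j0]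
    refine mul_le_mul_of_nonneg_left ?_ (norm_nonneg _)
    have e : ∀ t, (plateau p q 1 (n + 1) (t / ρ) : ℂ) * τ t -
        (plateau p q 0 (n + 1) (t / ρ) : ℂ) * τ t =
        (((plateau p q 1 (n + 1) (t / ρ) - plateau p q 0 (n + 1) (t / ρ)) * τ t : ℝ) : ℂ) :=
      fun t => by push_cast; ring
    have j2 := j1.sub j0
    simp only [e, Pi.sub_def] at j2 ⊢
    rw [integral_complex_ofReal]
    refine (norm_integral_le_of_norm_le j2.re (Eventually.of_forall fun t => ?_)).trans
      ((le_abs_self _).trans_eq (Complex.norm_real _).symm)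
    rw [RCLike.re_eq_complex_re, Complex.ofReal_re]
    by_cases ht : t ∈ Icc (ρ * p) (ρ * q)
    · rw [indicator_of_mem ht, plateau_one_of_mem ((hmem t).1 ht)]
      simp only [Complex.ofReal_one, one_mul, sub_self, norm_zero]
      exact mul_nonneg (sub_nonneg.2 (plateau_le_one _ _)) ((norm_nonneg _).trans (hle t))
    · rw [indicator_of_notMem ht, plateau_zero_of_notMem fun h => ht ((hmem t).2 h), zero_sub,
        norm_neg, norm_mul, Complex.norm_real, Real.norm_of_nonneg (plateau_nonneg _ _), sub_zero]
      exact mul_le_mul_of_nonneg_left (hle t) (plateau_nonneg _ _)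
  rw [dist_eq_norm] at hb1 hn1 ⊢
  have t1 := norm_add₃_le
    (a := (c ρ : ℂ) * (∫ t in Icc (ρ * p) (ρ * q), g t ∂μ) -
      (c ρ : ℂ) * ∫ t, (plateau p q 1 (n + 1) (t / ρ) : ℂ) * g t ∂μ)
    (b := (c ρ : ℂ) * (∫ t, (plateau p q 1 (n + 1) (t / ρ) : ℂ) * g t ∂μ) -
      ∫ t, (plateau p q 1 (n + 1) t : ℂ) * w t)
    (c := (∫ t, (plateau p q 1 (n + 1) t : ℂ) * w t) - ∫ t in Icc p q, w t)
  rw [sub_add_sub_cancel, sub_add_sub_cancel] at t1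
  linarith

end Sandwich

/-! ### The Tauberian theorem for matrix measures -/

section Cumulative

/-- Off the diagonal this is `|W₁₀|² ≤ W₀₀ W₁₁`, the nonnegativity of the determinant. -/
theorem norm_apply_le_of_posSemidef {W : Matrix (Fin 2) (Fin 2) ℂ} (hW : W.PosSemidef)
    (i j : Fin 2) : ‖W i j‖ ≤ (W 0 0).re + (W 1 1).re := by
  have h0 := Complex.nonneg_iff.1 (hW.diag_nonneg (i := 0))
  have h1 := Complex.nonneg_iff.1 (hW.diag_nonneg (i := 1))
  have e0 : W 0 0 = ((W 0 0).re : ℂ) := Complex.ext rfl h0.2.symm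
  have e1 : W 1 1 = ((W 1 1).re : ℂ) := Complex.ext rfl h1.2.symm
  have h10 : conj (W 1 0) = W 0 1 := hW.1.apply 0 1
  have hn : ‖W 0 1‖ = ‖W 1 0‖ := by rw [← h10, RCLike.norm_conj]
  have hd := hW.det_nonneg
  rw [Matrix.det_fin_two, ← h10, mul_comm (conj _), Complex.mul_conj, Complex.normSq_eq_norm_sq,
    e0, e1, ← Complex.ofReal_mul, ← Complex.ofReal_sub, Complex.zero_le_real] at hd
  have hb : ‖W 1 0‖ ≤ (W 0 0).re + (W 1 1).re := by
    refine abs_le_of_sq_le_sq' ?_ (add_nonneg h0.1 h1.1) |>.2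
    nlinarith [mul_nonneg h0.1 h1.1, sq_nonneg ((W 0 0).re), sq_nonneg ((W 1 1).re)]
  fin_cases i <;> fin_cases j
  · change ‖W 0 0‖ ≤ _
    rw [e0, Complex.norm_real, Real.norm_of_nonneg h0.1, Complex.ofReal_re]
    linarith [h1.1]
  · exact hn.trans_le hb
  · exact hb
  · change ‖W 1 1‖ ≤ _
    rw [e1, Complex.norm_real, Real.norm_of_nonneg h1.1, Complex.ofReal_re]
    linarith [h0.1]

theorem ofReal_trace_of_posSemidef {W : Matrix (Fin 2) (Fin 2) ℂ} (hW : W.PosSemidef) :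
    (((W 0 0).re + (W 1 1).re : ℝ) : ℂ) = W 0 0 + W 1 1 := by
  have h0 := Complex.nonneg_iff.1 (hW.diag_nonneg (i := 0))
  have h1 := Complex.nonneg_iff.1 (hW.diag_nonneg (i := 1))
  refine Complex.ext (by simp) ?_
  simp [← h0.2, ← h1.2]

theorem setIntegral_homogeneousWeight {β : ℝ} (hβ : -1 < β) (s : ℝ) :
    (∫ t in Icc 0 1, (homogeneousWeight β s t : ℂ)) = ((1 / (β + 1) : ℝ) : ℂ) ∧
    (∫ t in Icc (-1) 0, (homogeneousWeight β s t : ℂ)) = ((s / (β + 1) : ℝ) : ℂ) := by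
  have hβ' : β + 1 ≠ 0 := by linarith
  have e : ∫ t in (0 : ℝ)..1, t ^ β = 1 / (β + 1) := by
    rw [integral_rpow (Or.inl hβ), Real.one_rpow, Real.zero_rpow hβ', sub_zero]
  constructor
  · rw [integral_complex_ofReal, integral_Icc_eq_integral_Ioc, ← e,
      intervalIntegral.integral_of_le zero_le_one]
    congr 1
    exact setIntegral_congr_fun measurableSet_Ioc fun t ht => homogeneousWeight_pos s ht.1
  · rw [integral_complex_ofReal, integral_Icc_eq_integral_Ioc,
      ← intervalIntegral.integral_of_le (by norm_num : (-1 : ℝ) ≤ 0)]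
    congr 1
    have h1 := intervalIntegral.integral_comp_neg (a := 0) (b := 1)
      (fun t : ℝ => homogeneousWeight β s t)
    rw [neg_zero] at h1
    rw [← h1, div_eq_mul_one_div, ← e, ← intervalIntegral.integral_const_mul,
      intervalIntegral.integral_of_le zero_le_one, intervalIntegral.integral_of_le zero_le_one]
    exact setIntegral_congr_fun measurableSet_Ioc fun t ht => homogeneousWeight_neg s ht.1

namespace MatrixMeasure

variable {Sg : MatrixMeasure} {M : ℂ → Matrix (Fin 2) (Fin 2) ℂ}

theorem conj_integral (f : ℝ → ℂ) (i j : Fin 2) :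
    conj (Sg.integral f j i) = Sg.integral (fun t => conj (f t)) i j := by
  simp only [MatrixMeasure.integral, Matrix.of_apply]
  rw [← integral_conj]
  refine integral_congr_ae (Eventually.of_forall fun t => ?_)
  simp only [map_mul]
  rw [show conj (Sg.density t j i) = Sg.density t i j from (Sg.posSemidef t).1.apply i j]

/-- The constant term and the density are Hermitian, and conjugating the kernel conjugates `z`. This
transfers the asymptotics to the negative imaginary axis. -/
theorem herglotz_conj (hM : ∀ z : ℂ, z.im ≠ 0 → M z = (1 / 2 : ℂ) • (M Complex.I +
      (M Complex.I)ᴴ) + Sg.integral (fun t => 1 / ((t : ℂ) - z) - (t : ℂ) / (1 + (t : ℂ) ^ 2)))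
    {z : ℂ} (hz : z.im ≠ 0) (i j : Fin 2) : M (conj z) i j = conj (M z j i) := by
  rw [hM z hz, hM (conj z) (by simpa using hz), Matrix.add_apply, Matrix.add_apply, map_add,
    conj_integral]
  congr 1
  · simp only [Matrix.smul_apply, Matrix.add_apply, Matrix.conjTranspose_apply, smul_eq_mul,
      map_mul, map_add, RCLike.star_def, Complex.conj_conj]
    rw [add_comm]
    congr 1
    simp [Complex.conj_ofNat]
  · congr 2
    ext t
    simp

/-- On the diagonal the limits at `±i` are conjugate imaginary numbers and belong to the even
density `κ|t|^β`; off the diagonal they are equal and real and belong to `κ sgn(t)|t|^β`. The trace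
bounds all entries, so only diagonal masses need control. The intervals `[0, ρ]` and `[-ρ, 0]`
rescale to `[0, 1]` and `[-1, 0]`, on each of which `|t|^β` has integral `1/(β + 1)`. -/
theorem tendsto_cumulative (hI : Sg.Integrable (fun t => 1 / (1 + (t : ℂ) ^ 2)))
    (hM : ∀ z : ℂ, z.im ≠ 0 → M z = (1 / 2 : ℂ) • (M Complex.I + (M Complex.I)ᴴ) +
      Sg.integral (fun t => 1 / ((t : ℂ) - z) - (t : ℂ) / (1 + (t : ℂ) ^ 2)))
    {k₀ : Matrix (Fin 2) (Fin 2) ℂ} (hk₀ : k₀.IsHermitian) {β : ℝ}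
    (hβ : β = 1 / 2 ∨ β = -(1 / 2)) {κ : ℝ}
    (hlim : ∀ i j, Tendsto (fun ρ : ℝ => ((ρ ^ (-β) : ℝ) : ℂ) *
      (M (ρ * Complex.I) i j - k₀ i j)) atTop
      (𝓝 ((κ : ℂ) * if i = j then 2 * (Real.pi / Real.sqrt 2 : ℝ) * Complex.I
        else -(4 * β * (Real.pi / Real.sqrt 2) : ℝ)))) :
    Tendsto (fun r : ℝ => r ^ (-β - 1) • Sg.cumulative r) atTop
        (𝓝 ((κ / (β + 1)) • !![1, 1; 1, 1])) ∧
      Tendsto (fun r : ℝ => r ^ (-β - 1) • Sg.cumulative (-r)) atTop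
        (𝓝 ((κ / (β + 1)) • !![1, -1; -1, 1])) := by
  have hβ1 : -1 < β := by rcases hβ with rfl | rfl <;> norm_num
  let sg : Fin 2 → Fin 2 → ℝ := fun i j => if i = j then 1 else -1
  let w : Fin 2 → Fin 2 → ℝ → ℂ := fun i j t => κ * (homogeneousWeight β (sg i j) t : ℂ)
  let mp : Fin 2 → Fin 2 → ℂ := fun i j =>
    (κ : ℂ) * if i = j then 2 * (Real.pi / Real.sqrt 2 : ℝ) * Complex.I
        else -(4 * β * (Real.pi / Real.sqrt 2) : ℝ)
  have hneg : ∀ i j, Tendsto (fun ρ : ℝ => ((ρ ^ (-β) : ℝ) : ℂ) *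
      (M (-(ρ * Complex.I)) i j - k₀ i j)) atTop (𝓝 (conj (mp j i))) := fun i j => by
    refine ((Complex.continuous_conj.tendsto _).comp (hlim j i)).congr' ?_
    filter_upwards [eventually_gt_atTop 0] with ρ hρ
    have h1 := herglotz_conj hM (z := ρ * Complex.I) (by simpa using hρ.ne') i j
    have h2 : conj ((ρ : ℂ) * Complex.I) = -(ρ * Complex.I) := by simp
    rw [h2] at h1
    rw [h1, ← show conj (k₀ j i) = k₀ i j from hk₀.apply i j, Function.comp_apply, map_mul,
      map_sub, Complex.conj_ofReal]
  have hmodel : ∀ i j, IsHomogeneousModel (w i j) β (mp i j) (conj (mp j i)) := fun i j => by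
    by_cases hij : i = j
    · have h1 := (isHomogeneousModel_even hβ).const_mul κ
      convert h1 using 1
      · ext t; simp [w, sg, hij]
      · simp [mp, hij]
      · simp [mp, hij, Complex.conj_ofNat]
    · have h1 := (isHomogeneousModel_odd hβ).const_mul κ
      convert h1 using 1
      · ext t; simp [w, sg, hij]
      · simp [mp, hij]
      · simp [mp, Ne.symm hij, Complex.conj_ofNat]
  have hrep : ∀ i j (z : ℂ), z.im ≠ 0 → M z i j =
      ((1 / 2 : ℂ) • (M Complex.I + (M Complex.I)ᴴ)) i j +
        ∫ t, (1 / ((t : ℂ) - z) - (t : ℂ) / (1 + (t : ℂ) ^ 2)) * Sg.density t i j ∂Sg.base :=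
    fun i j z hz => by
      conv_lhs => rw [hM z hz]
      rfl
  have hmass : ∀ i, Tendsto (fun ρ : ℝ => ((ρ ^ (-β - 1) : ℝ) : ℂ) *
      ∫ t : ℝ, (1 / (1 + ((t / ρ : ℝ) : ℂ) ^ 2)) * Sg.density t i i ∂Sg.base) atTop
      (𝓝 ((mp i i - conj (mp i i)) / (2 * Complex.I))) := fun i =>
    tendsto_scaled_mass (m := fun z => M z i i) (hI i i) (hrep i i) (hlim i i) (hneg i i)
  have hbd := ((hmass 0).add (hmass 1)).norm.eventually (ge_mem_nhds (lt_add_one _))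
  have hK : ∀ i j, ∀ᶠ ρ : ℝ in atTop, ρ ^ (-β - 1) *
      ∫ t : ℝ, ‖(1 / (1 + ((t / ρ : ℝ) : ℂ) ^ 2)) * Sg.density t i j‖ ∂Sg.base ≤ _ := fun i j => by
    filter_upwards [hbd, eventually_gt_atTop 0] with ρ hρ hρ0
    refine le_trans ?_ hρ
    have j0 := integrable_scaled (hI 0 0) hρ0
    have j1 := integrable_scaled (hI 1 1) hρ0
    rw [← mul_add, ← integral_add j0 j1, norm_mul, Complex.norm_real,
      Real.norm_of_nonneg (Real.rpow_nonneg hρ0.le _)]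
    refine mul_le_mul_of_nonneg_left ?_ (Real.rpow_nonneg hρ0.le _)
    have e : ∀ t : ℝ, 1 / (1 + ((t / ρ : ℝ) : ℂ) ^ 2) * Sg.density t 0 0 +
        1 / (1 + ((t / ρ : ℝ) : ℂ) ^ 2) * Sg.density t 1 1 =
        ((1 / (1 + (t / ρ) ^ 2) * ((Sg.density t 0 0).re + (Sg.density t 1 1).re) : ℝ) : ℂ) :=
      fun t => by
        rw [Complex.ofReal_mul, ofReal_trace_of_posSemidef (Sg.posSemidef t)]
        push_cast
        ring
    have j2 := j0.add j1
    simp only [Pi.add_def, e] at j2 ⊢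
    rw [integral_complex_ofReal, Complex.norm_real]
    refine le_trans (integral_mono (integrable_scaled (hI i j) hρ0).norm j2.re fun t => ?_)
      (le_abs_self _)
    have e2 : (1 : ℂ) / (1 + ((t / ρ : ℝ) : ℂ) ^ 2) = ((1 / (1 + (t / ρ) ^ 2) : ℝ) : ℂ) := by
      push_cast; rfl
    simp only [RCLike.re_eq_complex_re, Complex.ofReal_re]
    rw [norm_mul, e2, Complex.norm_real, Real.norm_of_nonneg (by positivity)]
    exact mul_le_mul_of_nonneg_left (norm_apply_le_of_posSemidef (Sg.posSemidef t) i j)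
      (by positivity)
  have hweak : ∀ i j, HasScaledLimit Sg.base (fun t => Sg.density t i j)
      (fun ρ => ρ ^ (-β - 1)) (w i j) := fun i j =>
    hasScaledLimit (m := fun z => M z i j) (hI i j) (hrep i j) (hlim i j) (hneg i j) (hK i j)
      (hmodel i j)
  have htr := (hweak 0 0).add (hweak 1 1) (Sg.locallyIntegrable 0 0) (Sg.locallyIntegrable 1 1)
    (hmodel 0 0).locInt (hmodel 1 1).locInt
  have htrl := (Sg.locallyIntegrable 0 0).add (Sg.locallyIntegrable 1 1)
  simp only [Pi.add_def, ← ofReal_trace_of_posSemidef (Sg.posSemidef _)] at htr htrl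
  have hfin := fun i j => HasScaledLimit.tendsto_setIntegral (Sg.locallyIntegrable i j) htrl
    (fun t => norm_apply_le_of_posSemidef (Sg.posSemidef t) i j)
    ((eventually_ge_atTop 0).mono fun ρ hρ => Real.rpow_nonneg hρ _) (hweak i j) htr
    (hmodel i j).locInt ((hmodel 0 0).locInt.add (hmodel 1 1).locInt)
  constructor
  · refine tendsto_pi_nhds.2 fun i => tendsto_pi_nhds.2 fun j => ?_
    have h1 := hfin i j 0 1
    simp only [w] at h1
    rw [integral_const_mul, (setIntegral_homogeneousWeight hβ1 _).1] at h1
    have e : ((κ / (β + 1)) • (!![1, 1; 1, 1] : Matrix (Fin 2) (Fin 2) ℂ)) i j =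
        (κ : ℂ) * ((1 / (β + 1) : ℝ) : ℂ) := by
      fin_cases i <;> fin_cases j <;> simp [div_eq_mul_inv]
    rw [e]
    refine h1.congr' ?_
    filter_upwards [eventually_ge_atTop 0] with ρ hρ
    rw [Matrix.smul_apply, Complex.real_smul, MatrixMeasure.cumulative, if_pos hρ, mul_zero,
      mul_one]
    rfl
  · refine tendsto_pi_nhds.2 fun i => tendsto_pi_nhds.2 fun j => ?_
    have h1 := hfin i j (-1) 0
    simp only [w] at h1
    rw [integral_const_mul, (setIntegral_homogeneousWeight hβ1 _).2] at h1
    have e : ((κ / (β + 1)) • (!![1, -1; -1, 1] : Matrix (Fin 2) (Fin 2) ℂ)) i j =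
        (κ : ℂ) * ((sg i j / (β + 1) : ℝ) : ℂ) := by
      fin_cases i <;> fin_cases j <;> simp [sg, div_eq_mul_inv]
    rw [e]
    refine h1.congr' ?_
    filter_upwards [eventually_gt_atTop 0] with ρ hρ
    rw [Matrix.smul_apply, Complex.real_smul, MatrixMeasure.cumulative, if_neg (by linarith),
      mul_zero, mul_neg_one]
    rfl

end MatrixMeasure
end Cumulative

/-! ### Assembly of existence and asymptotics -/

theorem exists_zero_extension {Q : ℝ → Matrix (Fin 2) (Fin 2) ℂ}
    (hm : ∀ i j, Measurable fun x : Ioi (0 : ℝ) => Q x i j)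
    (hherm : ∀ x : ℝ, 0 < x → (Q x).IsHermitian)
    (hb : ∃ K : ℝ, ∀ x : ℝ, 0 < x → ∀ i j, ‖Q x i j‖ ≤ K) :
    ∃ Q' : ℝ → Matrix (Fin 2) (Fin 2) ℂ, (∀ x, 0 < x → Q x = Q' x) ∧
      (∀ i j, Measurable fun x => Q' x i j) ∧ (∀ x, (Q' x).IsHermitian) ∧
      ∃ K : ℝ, ∀ x i j, ‖Q' x i j‖ ≤ K := by
  obtain ⟨K, hK⟩ := hb
  have hpos : ∀ x : ℝ, 0 < x → (Ioi (0 : ℝ)).indicator Q x = Q x := fun x hx =>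
    indicator_of_mem (mem_Ioi.2 hx) Q
  have hneg : ∀ x : ℝ, ¬0 < x → (Ioi (0 : ℝ)).indicator Q x = 0 := fun x hx =>
    indicator_of_notMem hx Q
  refine ⟨(Ioi 0).indicator Q, fun x hx => (hpos x hx).symm, fun i j => ?_, fun x => ?_, K,
    fun x i j => ?_⟩
  · refine measurable_of_restrict_of_restrict_compl (measurableSet_Ioi (a := (0 : ℝ))) ?_ ?_
    · convert hm i j using 2 with x
      exact congrFun (congrFun (hpos x x.2) i) j
    · convert measurable_const (a := (0 : ℂ)) using 2 with x
      exact congrFun (congrFun (hneg x x.2) i) j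
  · by_cases hx : 0 < x
    · rw [hpos x hx]; exact hherm x hx
    · rw [hneg x hx]; exact Matrix.isHermitian_zero
  · by_cases hx : 0 < x
    · rw [hpos x hx]; exact hK x hx i j
    · rw [hneg x hx, Matrix.zero_apply, norm_zero]
      exact (norm_nonneg _).trans (hK 1 one_pos 0 0)

/-- The value `k = ‖T‖ + 1` puts `±ik` in the range of the Neumann series. Solvability at these two
points is enough, since the functional calculus reaches every nonreal `z`. -/
theorem exists_isSpectralMeasure {Q Q' : ℝ → Matrix (Fin 2) (Fin 2) ℂ} (α : OnePoint ℂ)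
    (hQ : ∀ x, 0 < x → Q x = Q' x) (hm : ∀ i j, Measurable fun x => Q' x i j) {K : ℝ}
    (hK : ∀ x i j, ‖Q' x i j‖ ≤ K) {T : L2Space →L[ℂ] L2Space}
    (hTs : ∀ u w, inner ℂ (T u) w = inner ℂ u (T w))
    (hT : ∀ (u : L2Space) (V : Fin 2 → ℝ → ℂ), (∀ i, u i =ᵐ[halfLine] V i) →
      ∀ i, T u i =ᵐ[halfLine] fun t => ∑ j, Q' t i j * V j t) :
    ∃ Sg : MatrixMeasure, IsSpectralMeasure Q α Sg := by
  have hk : 0 < ‖T‖ + 1 := by positivity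
  have hp := isBoundaryPair_bc α
  have hs : ∀ z : ℂ, ‖T‖ < |z.im| → (freeRelation.perturb T hTs).Solvable (bcC α) (bcS α) z :=
    fun z hz => by
      have hz' : z.im ≠ 0 := abs_pos.1 ((norm_nonneg T).trans_lt hz)
      exact BoundaryRelation.Solvable.perturb hp hz'
        (BoundaryRelation.Solvable.of_dirichlet hp hz' (freeRelation_solvable hz')) T hTs hz
  obtain ⟨Sg, M, hI, hM, hrel⟩ := BoundaryRelation.exists_herglotz hp hk
    (hs ((‖T‖ + 1 : ℝ) * Complex.I) (by simp [abs_of_pos hk]))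
    (hs (-((‖T‖ + 1 : ℝ) * Complex.I)) (by
      rw [Complex.neg_im, abs_neg]; simp [abs_of_pos hk]))
  exact ⟨Sg, M, fun z hz => (isWeylMatrix_of_rel hm hK hTs hT (hrel z hz)).congr
    fun t ht => (hQ t ht).symm, hI, hM⟩

theorem Tendsto.smul_inv_rpow {F : ℝ → Matrix (Fin 2) (Fin 2) ℂ} {L : Matrix (Fin 2) (Fin 2) ℂ}
    {e e' : ℝ} (he : e = -e') (h : Tendsto (fun r : ℝ => r ^ e • F r) atTop (𝓝 L)) :
    Tendsto (fun r : ℝ => (r ^ e')⁻¹ • F r) atTop (𝓝 L) := by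
  refine h.congr' ?_
  filter_upwards [eventually_ge_atTop 0] with r hr
  rw [he, Real.rpow_neg hr]

theorem isHermitian_of_conj (a : ℂ) :
    (!![0, a; conj a, 0] : Matrix (Fin 2) (Fin 2) ℂ).IsHermitian := by
  ext i j
  fin_cases i <;> fin_cases j <;> simp

end Hermitised
end

theorem theorem1p9 (Q : ℝ → Matrix (Fin 2) (Fin 2) ℂ)
    (hQ_meas : ∀ i j, Measurable fun x : Set.Ioi (0 : ℝ) => Q x i j)
    (hQ_herm : ∀ x : ℝ, 0 < x → (Q x).IsHermitian)
    (hQ_bdd : ∃ K : ℝ, ∀ x : ℝ, 0 < x → ∀ i j, ‖Q x i j‖ ≤ K)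
    (α : OnePoint ℂ) :
    (∃ Sg : Hermitised.MatrixMeasure, Hermitised.IsSpectralMeasure Q α Sg) ∧
    ∀ Sg : Hermitised.MatrixMeasure, Hermitised.IsSpectralMeasure Q α Sg →
      (∀ a : ℂ, α = (a : OnePoint ℂ) →
        Filter.Tendsto (fun r : ℝ => (r ^ (1 / 2 : ℝ))⁻¹ • Sg.cumulative r) Filter.atTop
          (𝓝 (((1 + ‖a‖ ^ 2) / Real.pi) • (!![1, 1; 1, 1] : Matrix (Fin 2) (Fin 2) ℂ))) ∧
        Filter.Tendsto (fun r : ℝ => (r ^ (1 / 2 : ℝ))⁻¹ • Sg.cumulative (-r)) Filter.atTop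
          (𝓝 (((1 + ‖a‖ ^ 2) / Real.pi) • (!![1, -1; -1, 1] : Matrix (Fin 2) (Fin 2) ℂ)))) ∧
      (α = OnePoint.infty →
        Filter.Tendsto (fun r : ℝ => (r ^ (3 / 2 : ℝ))⁻¹ • Sg.cumulative r) Filter.atTop
          (𝓝 ((1 / (3 * Real.pi)) • (!![1, 1; 1, 1] : Matrix (Fin 2) (Fin 2) ℂ))) ∧
        Filter.Tendsto (fun r : ℝ => (r ^ (3 / 2 : ℝ))⁻¹ • Sg.cumulative (-r)) Filter.atTop
          (𝓝 ((1 / (3 * Real.pi)) • (!![1, -1; -1, 1] : Matrix (Fin 2) (Fin 2) ℂ)))) := by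
  obtain ⟨Q', hQQ', hm, hherm, K, hK⟩ := Hermitised.exists_zero_extension hQ_meas hQ_herm hQ_bdd
  obtain ⟨T, hTs, hT⟩ := Hermitised.exists_multiplication hm hherm hK
  refine ⟨Hermitised.exists_isSpectralMeasure α hQQ' hm hK hTs hT, fun Sg hSg => ?_⟩
  obtain ⟨M, hW, hI, hM⟩ := hSg
  -- Uniqueness of `M` or `Σ` plays no role: any matrix satisfying the Weyl condition yields
  -- elements of the relation, and the estimates apply to those.
  have hrel := fun (z : ℂ) (hz : z.im ≠ 0) =>
    ((hW z hz).congr hQQ').exists_rel hm hK hTs hT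
  have hπ := Real.pi_ne_zero
  have h2 : Real.sqrt 2 ≠ 0 := by positivity
  refine ⟨fun a ha => ?_, fun ha => ?_⟩
  · subst ha
    -- Here `β = -1/2`. Matching `2κπ/√2` with the limit `(1 + |a|²)/√2` fixes `κ`, and `κ/(β + 1) =
    -- 2κ` is the asserted constant.
    obtain ⟨h, h'⟩ := Hermitised.MatrixMeasure.tendsto_cumulative hI hM
      (Hermitised.isHermitian_of_conj a) (Or.inr rfl) (κ := (1 + ‖a‖ ^ 2) / (2 * Real.pi))
      fun i j => by
        convert Hermitised.tendsto_weyl_robin T hTs M a hrel i j using 2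
        have e : (1 + ‖a‖ ^ 2) / Real.sqrt 2 =
            (1 + ‖a‖ ^ 2) / (2 * Real.pi) * (2 * (Real.pi / Real.sqrt 2)) := by field_simp
        rw [e]
        split_ifs <;> push_cast <;> ring
    rw [show (1 + ‖a‖ ^ 2) / (2 * Real.pi) / (-(1 / 2) + 1) = (1 + ‖a‖ ^ 2) / Real.pi by
      field_simp; ring] at h h'
    exact ⟨Hermitised.Tendsto.smul_inv_rpow (by norm_num) h,
      Hermitised.Tendsto.smul_inv_rpow (by norm_num) h'⟩
  · subst ha
    -- Here `β = 1/2` and `2κπ/√2 = 1/√2`, so `κ/(β + 1) = (2/3) · 1/(2π)`. The odd model has the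
    -- limit `-2κπ/√2`, which agrees with the off-diagonal entry `-1/√2`.
    obtain ⟨h, h'⟩ := Hermitised.MatrixMeasure.tendsto_cumulative hI hM
      Matrix.isHermitian_zero (Or.inl rfl) (κ := 1 / (2 * Real.pi)) fun i j => by
        convert Hermitised.tendsto_weyl_dirichlet T hTs M hrel i j using 2
        · rfl
        · have e : 1 / Real.sqrt 2 = 1 / (2 * Real.pi) * (2 * (Real.pi / Real.sqrt 2)) := by
            field_simp
          rw [e]
          split_ifs <;> push_cast <;> ring
    rw [show 1 / (2 * Real.pi) / (1 / 2 + 1) = 1 / (3 * Real.pi) by field_simp; ring] at h h'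
    exact ⟨Hermitised.Tendsto.smul_inv_rpow (by norm_num) h,
      Hermitised.Tendsto.smul_inv_rpow (by norm_num) h'⟩
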